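/- **Conventions.** Let $V=\mathbb{R}^n$ be the standard Euclidean space and $L\subset V$ a lattice (a subgroup generated by a basis of $V$) that is integral, i.e. $x\cdot y\in\mathbb{Z}$ for all $x,y\in L$. - ${\rm O}(L)=\{\gamma\in {\rm O}(V): \gamma(L)=L\}$; ${\rm R}(L)=\{\alpha\in L:\alpha\cdot\alpha=2\}$; ${\rm W}(L)$ is the normal subgroup of ${\rm O}(L)$ generated by the reflections ${\rm s}_\alpha$, $\alpha\in{\rm R}(L)$; ${\rm G}(L)={\rm O}(L)/{\rm W}(L)$. The same notation is used for lattices in other Euclidean spaces. For an ADE root system $R'$ with root lattice ${\rm Q}(R')=\sum_{\alpha\in R'}\mathbb{Z}\alpha$, put ${\rm O}(R')={\rm O}({\rm Q}(R'))$, ${\rm W}(R')={\rm W}({\rm Q}(R'))$, ${\rm G}(R')={\rm G}({\rm Q}(R'))$. - ${\rm Car}_k\subset\mathbb{Z}[t]$ is the set of polynomials of degree $k$ that are products of cyclotomic polynomials. For a finite nonempty set $S$ of isometries of a $k$-dimensional Euclidean space, ${\rm m}_S:{\rm Car}_k\to\mathbb{Q}$ sends $P$ to the number of $g\in S$ with $\det(t-g)=P$,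 divided by $|S|$. The map ${\rm m}_{{\rm O}(L)}:{\rm Car}_n\to\mathbb{Q}$ gives the *characteristic masses* of $L$. - ${\rm M}(L)$ is the set of nonzero vectors of $L$ of minimal length; ${\rm S}(L)$ is defined inductively by ${\rm S}(0)=\emptyset$ and ${\rm S}(L)={\rm M}(L)\sqcup{\rm S}(L')$, where $L'$ is the orthogonal of ${\rm M}(L)$ in $L$. **Algorithm B**, on input $L$: - B1. Compute $R={\rm R}(L)$, a positive root system $R^+=\{\alpha\in R:\varphi(\alpha)>0\}$ (with $\varphi$ a linear form not vanishing at any root), and $\rho=\frac12\sum_{\alpha\in R^+}\alpha$. - B2. Determine a finite set $\mathcal{G}$ of generators of the stabilizer ${\rm O}(L)_\rho$ of $\rho$ in ${\rm O}(L)$. - B3. Compute ${\rm S}(L)$ and view ${\rm O}(L)_\rho$ as the group of permutations of ${\rm S}(L)$ generated by $\mathcal{G}$. - B4. Determine the sizes $(m_j)_{j\in J}$ and representatives of the conjugacy classes of this permutation group, and the corresponding elements $(\gamma_j)_{j\in J}$ of ${\rm O}(L)_\rho$. - B5. Compute the set ${\rm Irr}(R)$ of irreducible components of $R$, the isomorphism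 class of each of them (given by an isomorphic ADE root system $S'$ in a standard Euclidean space for each $S\in{\rm Irr}(R)$), and a basis of the orthogonal $R^\perp$ of $R$ in $V$. - B6. For each $j\in J$, compute the characteristic polynomial $P_j$ of $\gamma_j$ on $R^\perp$; a set ${\rm Irr}_j\subset{\rm Irr}(R)$ of representatives of the orbits of $\gamma_j$ on ${\rm Irr}(R)$; and, for each $S\in{\rm Irr}_j$, the size $l_S$ of its $\gamma_j$-orbit and the order $d_S\in\{1,2,3\}$ of the permutation of $S$ induced by $\gamma_j^{l_S}$. - B7. For each pair $(S,d_S)$ found in B6, choose any $\tau\in{\rm O}(S')$ whose image in ${\rm G}(S')$ has order $d_S$, and compute $\mu_{S,d_S}:={\rm m}_{\tau{\rm W}(S')}$. - B8. For each $j$, compute $N_j(Q)=\sum\prod_{S\in{\rm Irr}_j}\mu_{S,d_S}(P_S)$ for all $Q\in{\rm Car}_{\dim\langle R\rangle}$, the sum being over the families $(P_S)_{S\in{\rm Irr}_j}$ with $P_S\in{\rm Car}_{\dim\langle S\rangle}$ and $\prod_{S}P_S(t^{l_S})=Q(t)$. Here $\langle\,\cdot\,\rangle$ denotes the real span. - B9.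 For each $j$, define $M_j:{\rm Car}_n\to\mathbb{Q}$ by $M_j(P)=N_j(Q)$ if $P=QP_j$ with $Q\in{\rm Car}_{\dim\langle R\rangle}$, and $M_j(P)=0$ if there is no such $Q$. - B10. Return $\dfrac{\sum_{j\in J}m_jM_j}{\sum_{j\in J}m_j}$. **Proposition.** For every $n\ge 0$ and every integral lattice $L$ in $\mathbb{R}^n$, Algorithm B returns ${\rm m}_{{\rm O}(L)}$. That is: whatever choices were made in the previous steps, each step can be carried out (in particular the orders $d_S$ always lie in $\{1,2,3\}$, and an element $\tau$ as in B7 always exists), and the map returned in B10 equals ${\rm m}_{{\rm O}(L)}$, whatever the choices. -/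

import Mathlib

open Polynomial

noncomputable section

namespace CharMass

section General

variable {E : Type*} [NormedAddCommGroup E] [InnerProductSpace ℝ E]

/-- A lattice is integral if all inner products of its elements are integers. -/
def IsIntegralLattice (L : Submodule ℤ E) : Prop :=
  ∀ x ∈ L, ∀ y ∈ L, ∃ k : ℤ, inner ℝ x y = (k : ℝ)

/-- `O(L)`: the linear isometries `γ` of the ambient space with `γ(L) = L`. -/
def orthogonalGroup (L : Submodule ℤ E) : Subgroup (E ≃ₗᵢ[ℝ] E) where
  carrier := {γ | γ '' (L : Set E) = L}
  one_mem' := by simp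
  mul_mem' := by
    intro a b ha hb
    simp only [Set.mem_ofPred_eq] at ha hb ⊢
    rw [LinearIsometryEquiv.coe_mul, Set.image_comp, hb, ha]
  inv_mem' := by
    intro a ha
    simp only [Set.mem_ofPred_eq] at ha ⊢
    conv_lhs => rw [← ha]
    rw [← Set.image_comp, ← LinearIsometryEquiv.coe_mul, inv_mul_cancel]
    simp

/-- `R(L)`: the roots of `L`, i.e. the `α ∈ L` with `α · α = 2`. -/
def roots (L : Submodule ℤ E) : Set E := {α | α ∈ L ∧ inner ℝ α α = (2 : ℝ)}

/-- The orthogonal reflection `s_α` in the hyperplane `α^⊥`. -/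
def refl (α : E) : E ≃ₗᵢ[ℝ] E := (ℝ ∙ α)ᗮ.reflection

theorem refl_apply {α : E} (hα : inner ℝ α α = (2 : ℝ)) (x : E) :
    refl α x = x - inner ℝ α x • α := by
  rw [refl, Submodule.reflection_orthogonal_apply, Submodule.reflection_singleton_apply]
  have h : ‖α‖ ^ 2 = 2 := by rw [← real_inner_self_eq_norm_sq, hα]
  simp only [RCLike.ofReal_real_eq_id, id_eq, h]
  module

/-- The Weyl group `W(L)`, generated by the reflections in the roots of `L`. -/
def weylGroup (L : Submodule ℤ E) : Subgroup (E ≃ₗᵢ[ℝ] E) :=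
  Subgroup.closure (refl '' roots L)

theorem refl_conj (γ : E ≃ₗᵢ[ℝ] E) {α : E} (hα : inner ℝ α α = (2 : ℝ)) :
    γ * refl α * γ⁻¹ = refl (γ α) := by
  ext x
  have h1 : inner ℝ (γ α) (γ α) = (2 : ℝ) := by rw [γ.inner_map_map, hα]
  have h2 : inner ℝ α (γ⁻¹ x) = inner ℝ (γ α) x := by
    rw [← γ.inner_map_map α (γ⁻¹ x)]
    congr 1
    exact γ.apply_symm_apply x
  simp only [LinearIsometryEquiv.coe_mul, Function.comp_apply]
  rw [refl_apply hα, refl_apply h1, map_sub, map_smul, h2]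
  congr 1
  exact γ.apply_symm_apply x

/-- `W(L)` is normal in `O(L)`. -/
instance weylGroup_normal (L : Submodule ℤ E) :
    ((weylGroup L).subgroupOf (orthogonalGroup L)).Normal := by
  constructor
  rintro ⟨w, hwO⟩ hw ⟨γ, hγ⟩
  rw [Subgroup.mem_subgroupOf] at hw ⊢
  change γ * w * γ⁻¹ ∈ weylGroup L
  change w ∈ weylGroup L at hw
  have key : weylGroup L ≤ (weylGroup L).comap (MulAut.conj γ).toMonoidHom := by
    conv_lhs => rw [weylGroup]
    rw [Subgroup.closure_le]
    rintro _ ⟨α, ⟨hα, h2⟩, rfl⟩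
    change γ * refl α * γ⁻¹ ∈ weylGroup L
    rw [refl_conj γ h2]
    refine Subgroup.subset_closure ⟨γ α, ⟨?_, ?_⟩, rfl⟩
    · have h3 : γ α ∈ γ '' (L : Set E) := ⟨α, hα, rfl⟩
      have h4 : γ '' (L : Set E) = L := hγ
      rw [h4] at h3
      exact h3
    · rw [γ.inner_map_map, h2]
  exact key hw

/-- The quotient group `G(L) = O(L) / W(L)`. -/
abbrev outerGroup (L : Submodule ℤ E) : Type _ :=
  orthogonalGroup L ⧸ (weylGroup L).subgroupOf (orthogonalGroup L)

/-- An ADE root system in the Euclidean space `E`. -/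
structure IsADERootSystem (R : Set E) : Prop where
  finite : R.Finite
  span_eq_top : Submodule.span ℝ R = ⊤
  norm_two : ∀ α ∈ R, inner ℝ α α = (2 : ℝ)
  integral : ∀ α ∈ R, ∀ β ∈ R, ∃ k : ℤ, inner ℝ α β = (k : ℝ)
  refl_mem : ∀ α ∈ R, ∀ β ∈ R, refl α β ∈ R

/-- The root lattice `Q(R)`. -/
def rootLattice (R : Set E) : Submodule ℤ E := Submodule.span ℤ R

/-- `Irr(R)`: the irreducible components of `R`, i.e. its nonempty subsets which are orthogonal
to their complement in `R` and which are not a disjoint union of two nonempty subsets orthogonal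
to each other. -/
def irreducibleComponents (R : Set E) : Set (Set E) :=
  {S | S ⊆ R ∧ S.Nonempty ∧ (∀ α ∈ S, ∀ β ∈ R \ S, inner ℝ α β = (0 : ℝ)) ∧
    ∀ T ⊆ S, T.Nonempty → (∀ α ∈ T, ∀ β ∈ S \ T, inner ℝ α β = (0 : ℝ)) → T = S}

/-- The rank of a set of roots: the dimension of the real space it spans. -/
def rank (R : Set E) : ℕ := Module.finrank ℝ (Submodule.span ℝ R)

/-- `R⁺` is a positive root system in `R`. -/
def IsPositiveSystem (R Rpos : Set E) : Prop :=
  ∃ φ : E →ₗ[ℝ] ℝ, (∀ α ∈ R, φ α ≠ 0) ∧ Rpos = {α | α ∈ R ∧ 0 < φ α}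

/-- Half the sum of the elements of `R⁺`. -/
def weylVector (Rpos : Finset E) : E := (1 / 2 : ℝ) • ∑ α ∈ Rpos, α

/-- `O(L)_ρ`: the stabilizer of `ρ` in `O(L)`. -/
def orthogonalStabilizer (L : Submodule ℤ E) (ρ : E) : Subgroup (E ≃ₗᵢ[ℝ] E) where
  carrier := {γ | γ ∈ orthogonalGroup L ∧ γ ρ = ρ}
  one_mem' := ⟨one_mem _, rfl⟩
  mul_mem' := by
    rintro a b ⟨ha, ha'⟩ ⟨hb, hb'⟩
    refine ⟨mul_mem ha hb, ?_⟩
    rw [LinearIsometryEquiv.coe_mul, Function.comp_apply, hb', ha']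
  inv_mem' := by
    rintro a ⟨ha, ha'⟩
    refine ⟨inv_mem ha, ?_⟩
    conv_lhs => rw [← ha']
    exact a.symm_apply_apply ρ

/-- `M(L)`: the nonzero elements of `L` of minimal length. -/
def minimalVectors (L : Submodule ℤ E) : Set E :=
  {x | x ∈ L ∧ x ≠ 0 ∧ ∀ y ∈ L, y ≠ 0 → ‖x‖ ≤ ‖y‖}

/-- The orthogonal `L'` of `M(L)` in `L`. -/
def orthogonalOfMinimal (L : Submodule ℤ E) : Submodule ℤ E where
  carrier := {x | x ∈ L ∧ ∀ v ∈ minimalVectors L, inner ℝ v x = (0 : ℝ)}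
  add_mem' := by
    rintro a b ⟨ha, ha'⟩ ⟨hb, hb'⟩
    refine ⟨add_mem ha hb, fun v hv => ?_⟩
    rw [inner_add_right, ha' v hv, hb' v hv, add_zero]
  zero_mem' := ⟨zero_mem _, fun v _ => inner_zero_right v⟩
  smul_mem' := by
    rintro c x ⟨hx, hx'⟩
    refine ⟨L.smul_mem c hx, fun v hv => ?_⟩
    rw [← Int.cast_smul_eq_zsmul ℝ c x, inner_smul_right, hx' v hv, mul_zero]

/-- `S(L)`, defined inductively by `S(L) = M(L) ∪ S(L')`; unrolled, it is the union of the
`M(L⁽ᵏ⁾)`, where `L⁽⁰⁾ = L` and `L⁽ᵏ⁺¹⁾ = (L⁽ᵏ⁾)'`. -/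
def canonicalVectors (L : Submodule ℤ E) : Set E :=
  ⋃ k : ℕ, minimalVectors (orthogonalOfMinimal^[k] L)

/-- The group of permutations of `S(L)` generated by the permutations induced by the elements
of `𝒢`. -/
def permutationGroup (L : Submodule ℤ E) (𝒢 : Set (E ≃ₗᵢ[ℝ] E)) :
    Subgroup (Equiv.Perm (canonicalVectors L)) :=
  Subgroup.closure {σ | ∃ g ∈ 𝒢, ∀ x, (σ x : E) = g x}

/-- The size of the orbit of `S` under the powers of `γ`. -/
def orbitSize (γ : E ≃ₗᵢ[ℝ] E) (S : Set E) : ℕ :=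
  {T : Set E | ∃ i : ℤ, T = (γ ^ i) '' S}.ncard

/-- `d` is the order of the permutation of `S` induced by `γ`. -/
def IsPermOrder (γ : E ≃ₗᵢ[ℝ] E) (S : Set E) (d : ℕ) : Prop :=
  γ '' S = S ∧ IsLeast {e : ℕ | 0 < e ∧ ∀ x ∈ S, (γ ^ e) x = x} d

/-- The mass `m_S(P)`: the proportion of the elements of the finite set `S` with characteristic
polynomial `P`. -/
def mass [FiniteDimensional ℝ E] (S : Set (E ≃ₗᵢ[ℝ] E)) (P : ℝ[X]) : ℚ :=
  ({g : E ≃ₗᵢ[ℝ] E | g ∈ S ∧ LinearMap.charpoly (g.toLinearEquiv : E →ₗ[ℝ] E) = P}.ncard : ℚ) /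
    (S.ncard : ℚ)

/-- The left coset `σ W(L)`. -/
def weylCoset (σ : E ≃ₗᵢ[ℝ] E) (L : Submodule ℤ E) : Set (E ≃ₗᵢ[ℝ] E) :=
  {g | ∃ w ∈ weylGroup L, g = σ * w}

end General

/-- `Car_n`: the polynomials of degree `n` which are products of cyclotomic polynomials. -/
def Car (n : ℕ) : Set ℤ[X] :=
  {P | P.natDegree = n ∧ ∃ s : Multiset ℕ, (∀ m ∈ s, 0 < m) ∧
    P = (s.map fun m => cyclotomic m ℤ).prod}

/-- The standard Euclidean space of dimension `n`. -/
abbrev Eucl (n : ℕ) : Type := EuclideanSpace ℝ (Fin n)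

/-- The map `m_S : Car_n → ℚ`. -/
def carMass {n : ℕ} (S : Set (Eucl n ≃ₗᵢ[ℝ] Eucl n)) : Car n → ℚ :=
  fun P => mass S (P.1.map (Int.castRingHom ℝ))

/-- The characteristic masses `m_{O(L)} : Car_n → ℚ` of `L`. -/
def characteristicMasses {n : ℕ} (L : Submodule ℤ (Eucl n)) : Car n → ℚ :=
  carMass (orthogonalGroup L : Set (Eucl n ≃ₗᵢ[ℝ] Eucl n))

/-! The successive stages of an execution of Algorithm B on `L`. Each structure extends the
previous one by the data found, or chosen, at the next step. -/

section AlgorithmB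

variable {n : ℕ}

/-- Step B1: a positive root system `R⁺` of the root system `R = R(L)`. -/
structure RunB1 (L : Submodule ℤ (Eucl n)) where
  posRoots : Finset (Eucl n)
  isPositive : IsPositiveSystem (roots L) (posRoots : Set (Eucl n))

/-- The Weyl vector `ρ` of step B1. -/
def RunB1.ρ {L : Submodule ℤ (Eucl n)} (x : RunB1 L) : Eucl n := weylVector x.posRoots

/-- Step B2: a set of generators of `O(L)_ρ`. -/
structure RunB2 (L : Submodule ℤ (Eucl n)) extends RunB1 L where
  gens : Finset (Eucl n ≃ₗᵢ[ℝ] Eucl n)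
  closure_gens :
    Subgroup.closure (gens : Set (Eucl n ≃ₗᵢ[ℝ] Eucl n)) = orthogonalStabilizer L toRunB1.ρ

/-- Step B3: the group of permutations of `S(L)` generated by the generators found in B2. -/
def RunB2.permGroup {L : Submodule ℤ (Eucl n)} (x : RunB2 L) :
    Subgroup (Equiv.Perm (canonicalVectors L)) :=
  permutationGroup L (x.gens : Set (Eucl n ≃ₗᵢ[ℝ] Eucl n))

/-- Step B4: representatives `r_j` of the conjugacy classes of this permutation group, the sizes
`m_j` of these classes, and the elements `γ_j` of `O(L)_ρ` which correspond to the `r_j`. -/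
structure RunB4 (L : Submodule ℤ (Eucl n)) extends RunB2 L where
  numClasses : ℕ
  r : Fin numClasses → toRunB2.permGroup
  r_bijective : Function.Bijective fun j => ConjClasses.mk (r j)
  m : Fin numClasses → ℕ
  m_eq : ∀ j, m j = (ConjClasses.mk (r j)).carrier.ncard
  γ : Fin numClasses → (Eucl n ≃ₗᵢ[ℝ] Eucl n)
  γ_mem : ∀ j, γ j ∈ orthogonalStabilizer L toRunB1.ρ
  γ_eq : ∀ j x, (((r j : Equiv.Perm (canonicalVectors L)) x : canonicalVectors L) : Eucl n) =
    γ j (x : Eucl n)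

/-- Step B5: the set `Irr(R)`, the isomorphism class of each `S ∈ Irr(R)`, given by an ADE root
system in a standard Euclidean space that is isomorphic to `S`, and a basis of `R^⊥`. -/
structure RunB5 (L : Submodule ℤ (Eucl n)) extends RunB4 L where
  irr : Finset (Set (Eucl n))
  irr_eq : (irr : Set (Set (Eucl n))) = irreducibleComponents (roots L)
  model : (S : Set (Eucl n)) → Set (Eucl (rank S))
  model_ade : ∀ S ∈ irr, IsADERootSystem (model S)
  model_iso : ∀ S ∈ irr, ∃ f : Eucl (rank S) →ₗᵢ[ℝ] Eucl n, f '' model S = S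
  corank : ℕ
  basis : Module.Basis (Fin corank) ℝ (Submodule.span ℝ (roots L))ᗮ

/-- Step B6: for each `j`, the characteristic polynomial `P_j` of `γ_j` on `R^⊥` (computed from
the matrix of `γ_j` in the basis found in B5), a set `Irr_j` of representatives of the orbits of
`γ_j` on `Irr(R)` and, for each `S ∈ Irr_j`, the size `l_S` of its orbit and the order
`d_S ∈ {1, 2, 3}` of the permutation `γ_j ^ l_S` of `S`. -/
structure RunB6 (L : Submodule ℤ (Eucl n)) extends RunB5 L where
  A : Fin numClasses → Matrix (Fin corank) (Fin corank) ℝ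
  A_eq : ∀ j i, γ j (basis i : Eucl n) = ∑ k, A j k i • (basis k : Eucl n)
  Pperp : Fin numClasses → ℤ[X]
  Pperp_eq : ∀ j, (Pperp j).map (Int.castRingHom ℝ) = (A j).charpoly
  irrReps : Fin numClasses → Finset (Set (Eucl n))
  irrReps_subset : ∀ j, irrReps j ⊆ irr
  irrReps_unique : ∀ j, ∀ S ∈ irr, ∃! T, T ∈ irrReps j ∧ ∃ i : ℤ, S = (γ j ^ i) '' T
  l : Fin numClasses → Set (Eucl n) → ℕ
  l_eq : ∀ j, ∀ S ∈ irrReps j, l j S = orbitSize (γ j) S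
  d : Fin numClasses → Set (Eucl n) → ℕ
  d_isOrder : ∀ j, ∀ S ∈ irrReps j, IsPermOrder (γ j ^ l j S) S (d j S)
  d_mem : ∀ j, ∀ S ∈ irrReps j, d j S = 1 ∨ d j S = 2 ∨ d j S = 3

/-- Step B7: for each pair `(S, d_S)` found in B6, an arbitrary element `τ` of `O(S)` whose image
in `G(S) = O(S) / W(S)` has order `d_S`, and the masses of the coset `τ W(S)`. Here `S` is
replaced by the representative of its isomorphism class found in B5. -/
structure RunB7 (L : Submodule ℤ (Eucl n)) extends RunB6 L where
  τ : (S : Set (Eucl n)) → ℕ → orthogonalGroup (rootLattice (model S))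
  τ_order : ∀ j, ∀ S ∈ irrReps j,
    orderOf (QuotientGroup.mk (τ S (d j S)) : outerGroup (rootLattice (model S))) = d j S
  irrMass : (S : Set (Eucl n)) → ℕ → Car (rank S) → ℚ
  irrMass_eq : ∀ j, ∀ S ∈ irrReps j, irrMass S (d j S) =
    carMass (weylCoset (τ S (d j S) : Eucl (rank S) ≃ₗᵢ[ℝ] Eucl (rank S))
      (rootLattice (model S)))

variable {L : Submodule ℤ (Eucl n)}

/-- Step B8: the map that the product formula gives for `m_{γ_j W(R)}`: the sum of
`∏ m_{τ_S W(S)}(P_S)` over the families `(P_S)` indexed by `Irr_j`, with `P_S ∈ Car_{rank S}` and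
`∏ P_S(t ^ l_S) = Q(t)`. -/
def RunB7.rootMass (x : RunB7 L) (j : Fin x.numClasses) : Car (rank (roots L)) → ℚ :=
  fun Q =>
    ∑ᶠ f : {f : (S : x.irrReps j) → Car (rank S.1) //
        ∏ S : x.irrReps j, expand ℤ (x.l j S.1) (f S).1 = Q.1},
      ∏ S : x.irrReps j, x.irrMass S.1 (x.d j S.1) (f.1 S)

open scoped Classical in
/-- Step B9: `M_j(P) = m_{γ_j W(R)}(Q)` if `P = Q P_j`, and `M_j(P) = 0` if there is no such
`Q`. -/
def RunB7.M (x : RunB7 L) (j : Fin x.numClasses) : Car n → ℚ :=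
  fun P =>
    if h : ∃ Q : Car (rank (roots L)), P.1 = Q.1 * x.Pperp j then x.rootMass j h.choose else 0

/-- Step B10: the map returned by the algorithm. -/
def RunB7.output (x : RunB7 L) : Car n → ℚ :=
  fun P => (∑ j, (x.m j : ℚ) * x.M j P) / ∑ j, (x.m j : ℚ)

end AlgorithmB

end CharMass

end

/-!
Let `R = R(L)`, and let `ρ` be the Weyl vector of a positive system of `R`. The positive roots are
those with a positive inner product with `ρ`, and the Weyl group `W(L)` permutes the positive
systems simply transitively (`IsRegular.eq_one_of_pos`, `IsRegular.exists_mul_pos`). So `O(L)` is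
the semidirect product of `W(L)` and of the stabilizer `O(L)_ρ`, which consists of the elements of
`O(L)` that permute the positive roots. Hence the characteristic masses of `L` are the average,
over `γ ∈ O(L)_ρ`, of those of the coset `γ W(L)`; since these depend only on the conjugacy class
of `γ`, the average may be taken over the classes (`sum_eq_sum_conjClasses`), which may be computed
in the group of permutations of `S(L)`, on which `O(L)` acts faithfully
(`eq_one_of_forall_canonicalVectors`).

It remains to see that the algorithm computes the masses of a coset `γ W(L)`
(`RunB7.M_eq_mass`). An element `γ w` of this coset permutes the irreducible components of `R` as
`γ` does, and acts on the orthogonal of `R` as `γ` does. If `S` is a component and `l` the size of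
its orbit, the characteristic polynomial of `γ w` on the span of the orbit is `P (t ^ l)`, with `P`
that of `(γ w) ^ l` on the span of `S` (`charpoly_cyclicMatrix`, `isomCharpoly_mul_weyl`). When `w`
runs through `W(L)`, the elements `(γ w) ^ l` induced on representatives `S` of the orbits run
uniformly and independently through the cosets `σ_S W(S)`, where `σ_S` is induced by `γ ^ l`
(`card_weyl_mul_card`): multiplying `w` on the right by an element of `W(S)` multiplies the
element induced on `S` by this element, and leaves the other ones unchanged.

Finally, the masses of `σ_S W(S)` depend only on the order of `σ_S`, because two automorphisms of
the same order of a connected simply laced diagram are conjugate or inverse to each other, and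
because an isometry and its inverse have the same characteristic polynomial (`mass_weylCoset_eq`).
This, and the fact that this order is at most `3`, is proved without the classification of root
systems: every group of automorphisms of a connected simply laced diagram acts faithfully on an
orbit with at most three elements (`IsSimpleSystem.exists_faithful_orbit`), so that it embeds in
the symmetric group on three letters.
-/

open Polynomial

noncomputable section

namespace CharMass

/-! ### Root systems, simple roots and the Weyl group -/

section RootSets

variable {E : Type*} [NormedAddCommGroup E] [InnerProductSpace ℝ E]

/-- A finite set of vectors of square norm `2`, with integral inner products, which is stable
under its reflections. In contrast to `IsADERootSystem` it need not span the ambient space. -/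
structure IsRootSet (R : Set E) : Prop where
  finite : R.Finite
  norm_two : ∀ α ∈ R, inner ℝ α α = (2 : ℝ)
  integral : ∀ α ∈ R, ∀ β ∈ R, ∃ k : ℤ, inner ℝ α β = (k : ℝ)
  refl_mem : ∀ α ∈ R, ∀ β ∈ R, refl α β ∈ R

/-- A root set together with a linear form which vanishes at none of the roots. -/
structure IsRegular (R : Set E) (φ : E →ₗ[ℝ] ℝ) : Prop extends IsRootSet R where
  ne_zero : ∀ α ∈ R, φ α ≠ 0

/-- The group generated by the reflections in the elements of `R`. -/
def reflGroup (R : Set E) : Subgroup (E ≃ₗᵢ[ℝ] E) := Subgroup.closure (refl '' R)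

/-- The roots at which the linear form `φ` is positive. -/
def posRoots (R : Set E) (φ : E →ₗ[ℝ] ℝ) : Set E := {α | α ∈ R ∧ 0 < φ α}

/-- The simple roots, encoded as the positive roots which are not the sum of two positive
roots. -/
def simpleRoots (R : Set E) (φ : E →ₗ[ℝ] ℝ) : Set E :=
  {α | α ∈ posRoots R φ ∧ ∀ β ∈ posRoots R φ, ∀ γ ∈ posRoots R φ, α ≠ β + γ}

theorem norm_sub_sq_of_norm_two {α β : E} (hα : inner ℝ α α = (2 : ℝ))
    (hβ : inner ℝ β β = (2 : ℝ)) : inner ℝ (α - β) (α - β) = 4 - 2 * inner ℝ α β := by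
  rw [inner_sub_left, inner_sub_right, inner_sub_right, hα, hβ, real_inner_comm α β]; ring

theorem inner_le_one_of_ne {α β : E} (hα : inner ℝ α α = (2 : ℝ)) (hβ : inner ℝ β β = (2 : ℝ))
    (hi : ∃ k : ℤ, inner ℝ α β = (k : ℝ)) (hne : α ≠ β) : inner ℝ α β ≤ (1 : ℝ) := by
  obtain ⟨k, hk⟩ := hi
  have h1 : 0 < inner ℝ (α - β) (α - β) := real_inner_self_pos.2 (sub_ne_zero.2 hne)
  rw [norm_sub_sq_of_norm_two hα hβ, hk] at h1
  rw [hk]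
  have : (k : ℝ) < 2 := by linarith
  have : k < 2 := by exact_mod_cast this
  exact_mod_cast (by omega : k ≤ 1)

theorem neg_one_le_inner_of_ne {α β : E} (hα : inner ℝ α α = (2 : ℝ))
    (hβ : inner ℝ β β = (2 : ℝ)) (hi : ∃ k : ℤ, inner ℝ α β = (k : ℝ)) (hne : α ≠ -β) :
    (-1 : ℝ) ≤ inner ℝ α β := by
  have := inner_le_one_of_ne (β := -β) hα (by simpa using hβ)
    (by obtain ⟨k, hk⟩ := hi; exact ⟨-k, by simp [hk]⟩) hne
  rw [inner_neg_right] at this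
  linarith

namespace IsRootSet

variable {R : Set E} (h : IsRootSet R) {α β : E}
include h

theorem neg_mem (hα : α ∈ R) : -α ∈ R := by
  have := h.refl_mem α hα α hα
  rw [refl_apply (h.norm_two α hα), h.norm_two α hα] at this
  convert this using 1
  module

theorem ne_zero' (hα : α ∈ R) : α ≠ 0 := by
  rintro rfl
  simpa using h.norm_two _ hα

theorem inner_le_one (hα : α ∈ R) (hβ : β ∈ R) (hne : α ≠ β) : inner ℝ α β ≤ (1 : ℝ) :=
  inner_le_one_of_ne (h.norm_two _ hα) (h.norm_two _ hβ) (h.integral _ hα _ hβ) hne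

theorem inner_eq_one (hα : α ∈ R) (hβ : β ∈ R) (hne : α ≠ β) (hpos : 0 < inner ℝ α β) :
    inner ℝ α β = (1 : ℝ) := by
  have h1 := h.inner_le_one hα hβ hne
  obtain ⟨k, hk⟩ := h.integral α hα β hβ
  rw [hk] at h1 hpos ⊢
  have : 0 < k := by exact_mod_cast hpos
  have : k ≤ 1 := by exact_mod_cast h1
  exact_mod_cast (by omega : k = 1)

theorem sub_mem (hα : α ∈ R) (hβ : β ∈ R) (hne : α ≠ β) (hpos : 0 < inner ℝ α β) :
    α - β ∈ R := by
  have h1 := h.inner_eq_one hβ hα hne.symm (by rwa [real_inner_comm])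
  have := h.refl_mem β hβ α hα
  rwa [refl_apply (h.norm_two β hβ), h1, one_smul] at this

end IsRootSet

theorem refl_apply_self {α : E} (hα : inner ℝ α α = (2 : ℝ)) : refl α α = -α := by
  rw [refl_apply hα, hα]; module

theorem refl_mul_self (α : E) : refl α * refl α = 1 := by
  ext x
  simp [refl]

theorem refl_inv (α : E) : (refl α)⁻¹ = refl α := by
  rw [inv_eq_iff_mul_eq_one, refl_mul_self]

theorem reflGroup_map_mem {R : Set E} (h : IsRootSet R) {w : E ≃ₗᵢ[ℝ] E} (hw : w ∈ reflGroup R) :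
    ∀ α ∈ R, w α ∈ R := by
  induction hw using Subgroup.closure_induction'' with
  | mem x hx => obtain ⟨β, hβ, rfl⟩ := hx; exact fun α hα => h.refl_mem β hβ α hα
  | inv_mem x hx =>
    obtain ⟨β, hβ, rfl⟩ := hx; rw [refl_inv]; exact fun α hα => h.refl_mem β hβ α hα
  | one => exact fun α hα => hα
  | mul x y _ _ hx hy => exact fun α hα => hx _ (hy _ hα)

namespace IsRegular

variable {R : Set E} {φ : E →ₗ[ℝ] ℝ} (h : IsRegular R φ) {α β : E}
include h

theorem pos_or_neg (hα : α ∈ R) : α ∈ posRoots R φ ∨ -α ∈ posRoots R φ := by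
  rcases lt_or_gt_of_ne (h.ne_zero α hα) with h1 | h1
  · exact .inr ⟨h.neg_mem hα, by simpa using h1⟩
  · exact .inl ⟨hα, h1⟩

/-- Removing a simple root from a positive root leaves a positive root, as soon as the
difference is a root. -/
theorem sub_pos_of_simple (hα : α ∈ simpleRoots R φ) (hβ : β ∈ posRoots R φ)
    (hsub : β - α ∈ R) : β - α ∈ posRoots R φ := by
  rcases h.pos_or_neg hsub with h1 | h1
  · exact h1
  · exact absurd (by abel) (hα.2 β hβ _ h1)

theorem simple_inner_nonpos (hα : α ∈ simpleRoots R φ) (hβ : β ∈ simpleRoots R φ)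
    (hne : α ≠ β) : inner ℝ α β ≤ (0 : ℝ) := by
  by_contra! hpos
  have h1 := h.sub_pos_of_simple hβ hα.1 (h.sub_mem hα.1.1 hβ.1.1 hne hpos)
  exact hα.2 _ h1 β hβ.1 (by abel)

/-- Every positive root is a sum of simple roots. -/
theorem posRoots_subset_closure : posRoots R φ ⊆ AddSubmonoid.closure (simpleRoots R φ) := by
  by_contra hcon
  rw [Set.not_subset] at hcon
  have hfin : (posRoots R φ \ AddSubmonoid.closure (simpleRoots R φ)).Finite :=
    h.finite.subset fun x hx => hx.1.1
  -- a counterexample of minimal height is a sum of two positive roots of smaller height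
  obtain ⟨β, ⟨hβ, hβ'⟩, hmin⟩ := hfin.exists_minimalFor φ _ hcon
  by_cases hs : β ∈ simpleRoots R φ
  · exact hβ' (AddSubmonoid.subset_closure hs)
  · simp only [simpleRoots, Set.mem_ofPred_eq, not_and, not_forall, ne_eq, not_not] at hs
    obtain ⟨a, ha, b, hb, rfl⟩ := hs hβ
    rw [map_add] at hmin
    have ha' : a ∈ AddSubmonoid.closure (simpleRoots R φ) := by
      by_contra hc
      have := hmin ⟨ha, hc⟩ (by linarith [hb.2])
      linarith [hb.2]
    have hb' : b ∈ AddSubmonoid.closure (simpleRoots R φ) := by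
      by_contra hc
      have := hmin ⟨hb, hc⟩ (by linarith [ha.2])
      linarith [ha.2]
    exact hβ' (add_mem ha' hb')

theorem exists_simple_inner_pos (hβ : β ∈ posRoots R φ) :
    ∃ α ∈ simpleRoots R φ, 0 < inner ℝ β α := by
  by_contra! hcon
  have key : ∀ x ∈ AddSubmonoid.closure (simpleRoots R φ), inner ℝ β x ≤ (0 : ℝ) := by
    intro x hx
    induction hx using AddSubmonoid.closure_induction with
    | mem x hx => exact hcon x hx
    | zero => simp
    | add x y _ _ hx hy => rw [inner_add_right]; linarith
  have := key β (h.posRoots_subset_closure hβ)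
  rw [h.norm_two β hβ.1] at this
  linarith

/-- Every positive root is obtained from a simple root by adding simple roots one by one, each
partial sum being a positive root. -/
theorem pos_induction {P : E → Prop} (hs : ∀ α ∈ simpleRoots R φ, P α)
    (hadd : ∀ α ∈ simpleRoots R φ, ∀ β ∈ posRoots R φ, inner ℝ β α = (-1 : ℝ) → P β → P (β + α)) :
    ∀ β ∈ posRoots R φ, P β := by
  by_contra! hcon
  have hfin : {β | β ∈ posRoots R φ ∧ ¬ P β}.Finite := h.finite.subset fun x hx => hx.1.1
  obtain ⟨β, ⟨hβ, hβ'⟩, hmin⟩ := hfin.exists_minimalFor φ _ hcon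
  obtain ⟨α, hα, hpos⟩ := h.exists_simple_inner_pos hβ
  have hne : β ≠ α := by rintro rfl; exact hβ' (hs _ hα)
  have h1 := h.sub_mem hβ.1 hα.1.1 hne hpos
  have h2 := h.sub_pos_of_simple hα hβ h1
  have h3 : P (β - α) := by
    by_contra hc
    have := hmin ⟨h2, hc⟩ (by rw [map_sub]; linarith [hα.1.2])
    rw [map_sub] at this
    linarith [hα.1.2]
  have h4 := hadd α hα _ h2 (by
    rw [inner_sub_left, h.inner_eq_one hβ.1 hα.1.1 hne hpos, h.norm_two α hα.1.1]; norm_num) h3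
  rw [sub_add_cancel] at h4
  exact hβ' h4

/-- The reflection in a simple root `α` permutes the positive roots other than `α`. -/
theorem refl_simple_pos (hα : α ∈ simpleRoots R φ) (hβ : β ∈ posRoots R φ) (hne : β ≠ α) :
    refl α β ∈ posRoots R φ := by
  refine ⟨h.refl_mem α hα.1.1 β hβ.1, ?_⟩
  rw [refl_apply (h.norm_two α hα.1.1)]
  by_cases hpos : 0 < inner ℝ α β
  · rw [h.inner_eq_one hα.1.1 hβ.1 hne.symm hpos, one_smul]
    exact (h.sub_pos_of_simple hα hβ (h.sub_mem hβ.1 hα.1.1 hne (by rwa [real_inner_comm]))).2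
  · rw [map_sub, map_smul, smul_eq_mul]
    nlinarith [hα.1.2, hβ.2]

theorem refl_simple_ne (hα : α ∈ simpleRoots R φ) (hβ : β ∈ posRoots R φ) :
    refl α β ≠ α := by
  intro hc
  have h1 : β = refl α α := by
    have h2 : (refl α * refl α) β = β := by rw [refl_mul_self]; rfl
    rw [LinearIsometryEquiv.coe_mul, Function.comp_apply, hc] at h2
    exact h2.symm
  rw [refl_apply_self (h.norm_two α hα.1.1)] at h1
  have := hβ.2
  rw [h1, map_neg] at this
  linarith [hα.1.2]

theorem refl_mem_closure_simple (hβ : β ∈ R) :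
    refl β ∈ Subgroup.closure (refl '' simpleRoots R φ) := by
  have key : ∀ β ∈ posRoots R φ, refl β ∈ Subgroup.closure (refl '' simpleRoots R φ) := by
    refine h.pos_induction (fun α hα => Subgroup.subset_closure ⟨α, hα, rfl⟩) ?_
    intro α hα β hβ hin ih
    have h1 : refl α β = β + α := by
      rw [refl_apply (h.norm_two α hα.1.1), real_inner_comm, hin]; module
    rw [← h1, ← refl_conj _ (h.norm_two β hβ.1)]
    have h2 : refl α ∈ Subgroup.closure (refl '' simpleRoots R φ) :=
      Subgroup.subset_closure ⟨α, hα, rfl⟩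
    exact mul_mem (mul_mem h2 ih) (inv_mem h2)
  rcases h.pos_or_neg hβ with h1 | h1
  · exact key β h1
  · have : refl β = refl (-β) := by
      ext x
      rw [refl_apply (h.norm_two β hβ), refl_apply (h.norm_two _ h1.1)]
      simp
    rw [this]
    exact key _ h1

theorem exists_list_of_mem_reflGroup {w : E ≃ₗᵢ[ℝ] E} (hw : w ∈ reflGroup R) :
    ∃ l : List E, (∀ α ∈ l, α ∈ simpleRoots R φ) ∧ (l.map refl).prod = w := by
  have hle : reflGroup R ≤ Subgroup.closure (refl '' simpleRoots R φ) := by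
    rw [reflGroup, Subgroup.closure_le]
    rintro _ ⟨β, hβ, rfl⟩
    exact h.refl_mem_closure_simple hβ
  have hw' := hle hw
  clear hw
  induction hw' using Subgroup.closure_induction'' with
  | mem x hx => obtain ⟨β, hβ, rfl⟩ := hx; exact ⟨[β], by simpa using hβ, by simp⟩
  | inv_mem x hx =>
    obtain ⟨β, hβ, rfl⟩ := hx; exact ⟨[β], by simpa using hβ, by simp [refl_inv]⟩
  | one => exact ⟨[], by simp, by simp⟩
  | mul x y _ _ hx hy =>
    obtain ⟨l, hl, rfl⟩ := hx
    obtain ⟨l', hl', rfl⟩ := hy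
    refine ⟨l ++ l', fun α hα => ?_, by simp⟩
    rcases List.mem_append.1 hα with h1 | h1
    exacts [hl α h1, hl' α h1]

/-- The exchange condition: if a product of simple reflections sends the simple root `α` to a
negative root, then multiplying it by `s_α` amounts to deleting one of its factors. -/
theorem exchange (hα : α ∈ simpleRoots R φ) (l : List E) (hl : ∀ β ∈ l, β ∈ simpleRoots R φ)
    (hneg : (l.map refl).prod α ∉ posRoots R φ) :
    ∃ l' : List E, (∀ β ∈ l', β ∈ simpleRoots R φ) ∧ l'.length + 1 = l.length ∧
      (l'.map refl).prod = (l.map refl).prod * refl α := by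
  induction l with
  | nil => exact absurd hα.1 hneg
  | cons b t ih =>
    have hb := hl b (by simp)
    have ht : ∀ β ∈ t, β ∈ simpleRoots R φ := fun β hβ => hl β (by simp [hβ])
    by_cases hpos : (t.map refl).prod α ∈ posRoots R φ
    · have h1 : (t.map refl).prod α = b := by
        by_contra hne
        exact hneg (by simpa using h.refl_simple_pos hb hpos hne)
      refine ⟨t, ht, by simp, ?_⟩
      have h2 := refl_conj (t.map refl).prod (h.norm_two α hα.1.1)
      rw [h1] at h2
      rw [List.map_cons, List.prod_cons, ← h2]
      simp only [mul_assoc, inv_mul_cancel_left, refl_mul_self, mul_one]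
    · obtain ⟨l', hl', hlen, hprod⟩ := ih ht hpos
      refine ⟨b :: l', ?_, by simp [hlen], by simp [hprod, mul_assoc]⟩
      intro β hβ
      rcases List.mem_cons.1 hβ with rfl | h1
      exacts [hb, hl' β h1]

/-- The Weyl group acts freely on the positive systems. -/
theorem eq_one_of_pos {w : E ≃ₗᵢ[ℝ] E} (hw : w ∈ reflGroup R)
    (hpos : ∀ α ∈ posRoots R φ, w α ∈ posRoots R φ) : w = 1 := by
  classical
  have hex : ∃ k, ∃ l : List E, (∀ α ∈ l, α ∈ simpleRoots R φ) ∧ (l.map refl).prod = w ∧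
      l.length = k := by
    obtain ⟨l, hl, hlw⟩ := h.exists_list_of_mem_reflGroup hw
    exact ⟨_, l, hl, hlw, rfl⟩
  obtain ⟨l, hl, hlw, hlen⟩ := Nat.find_spec hex
  rcases List.eq_nil_or_concat l with rfl | ⟨t, α, rfl⟩
  · simpa using hlw.symm
  · exfalso
    have hα := hl α (by simp)
    have ht : ∀ β ∈ t, β ∈ simpleRoots R φ := fun β hβ => hl β (by simp [hβ])
    simp only [List.concat_eq_append, List.map_append, List.map_cons, List.map_nil,
      List.prod_append, List.prod_cons, List.prod_nil, mul_one] at hlw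
    have hneg : (t.map refl).prod α ∉ posRoots R φ := by
      intro hc
      have h1 := (hpos α hα.1).2
      rw [← hlw, LinearIsometryEquiv.coe_mul, Function.comp_apply,
        refl_apply_self (h.norm_two α hα.1.1), map_neg, map_neg] at h1
      linarith [hc.2]
    obtain ⟨l', hl', hlen', hprod⟩ := h.exchange hα t ht hneg
    refine Nat.find_min hex ?_ ⟨l', hl', hprod.trans hlw, rfl⟩
    rw [← hlen]
    simp
    omega

section WeylVector

variable {P : Finset E}

theorem refl_weylVector (hP : (P : Set E) = posRoots R φ) (hα : α ∈ simpleRoots R φ) :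
    refl α (weylVector P) = weylVector P - α := by
  classical
  have hmem : ∀ {β}, β ∈ P ↔ β ∈ posRoots R φ := by
    intro β; rw [← hP]; rfl
  have hαP : α ∈ P := hmem.2 hα.1
  have h1 : ∑ β ∈ P.erase α, refl α β = ∑ β ∈ P.erase α, β := by
    have himg : (P.erase α).image (refl α) = P.erase α := by
      apply Finset.eq_of_subset_of_card_le
      · intro β hβ
        obtain ⟨c, hc, rfl⟩ := Finset.mem_image.1 hβ
        rw [Finset.mem_erase] at hc
        rw [Finset.mem_erase]
        exact ⟨h.refl_simple_ne hα (hmem.1 hc.2),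
          hmem.2 (h.refl_simple_pos hα (hmem.1 hc.2) hc.1)⟩
      · rw [Finset.card_image_of_injective _ (refl α).injective]
    conv_rhs => rw [← himg]
    rw [Finset.sum_image (fun x _ y _ hxy => (refl α).injective hxy)]
  rw [weylVector, map_smul, map_sum, ← Finset.add_sum_erase _ _ hαP,
    ← Finset.add_sum_erase P (fun x => x) hαP, h1, refl_apply_self (h.norm_two α hα.1.1)]
  module

theorem inner_weylVector_simple (hP : (P : Set E) = posRoots R φ) (hα : α ∈ simpleRoots R φ) :
    inner ℝ (weylVector P) α = (1 : ℝ) := by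
  have h1 := h.refl_weylVector hP hα
  rw [refl_apply (h.norm_two α hα.1.1), sub_right_inj] at h1
  have h2 : (inner ℝ α (weylVector P) - 1) • α = 0 := by rw [sub_smul, h1, one_smul, sub_self]
  rcases smul_eq_zero.1 h2 with h3 | h3
  · rw [real_inner_comm]; linarith
  · exact absurd h3 (h.ne_zero' hα.1.1)

theorem inner_weylVector_pos (hP : (P : Set E) = posRoots R φ) :
    ∀ β ∈ posRoots R φ, 0 < inner ℝ (weylVector P) β := by
  refine h.pos_induction (fun α hα => by rw [h.inner_weylVector_simple hP hα]; norm_num) ?_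
  intro α hα β _ _ ih
  rw [inner_add_right, h.inner_weylVector_simple hP hα]
  linarith

theorem mem_posRoots_iff_inner (hP : (P : Set E) = posRoots R φ) (hα : α ∈ R) :
    α ∈ posRoots R φ ↔ 0 < inner ℝ (weylVector P) α := by
  refine ⟨h.inner_weylVector_pos hP α, fun h1 => ?_⟩
  rcases h.pos_or_neg hα with h2 | h2
  · exact h2
  · have := h.inner_weylVector_pos hP _ h2
    rw [inner_neg_right] at this
    linarith

/-- An isometry which permutes the roots fixes the Weyl vector if and only if it permutes the
positive roots, which are the roots with a positive inner product with the Weyl vector. -/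
theorem apply_weylVector_eq_iff (hP : (P : Set E) = posRoots R φ) {g : E ≃ₗᵢ[ℝ] E}
    (hg : ∀ α ∈ R, g α ∈ R) :
    g (weylVector P) = weylVector P ↔ ∀ α ∈ posRoots R φ, g α ∈ posRoots R φ := by
  classical
  have hmem : ∀ {β}, β ∈ P ↔ β ∈ posRoots R φ := by
    intro β; rw [← hP]; rfl
  constructor
  · intro h1 α hα
    rw [h.mem_posRoots_iff_inner hP (hg α hα.1), ← h1, g.inner_map_map]
    exact h.inner_weylVector_pos hP α hα
  · intro h1
    have himg : P.image g = P := by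
      apply Finset.eq_of_subset_of_card_le
      · intro β hβ
        obtain ⟨c, hc, rfl⟩ := Finset.mem_image.1 hβ
        exact hmem.2 (h1 c (hmem.1 hc))
      · rw [Finset.card_image_of_injective _ g.injective]
    rw [weylVector, map_smul, map_sum]
    conv_rhs => rw [← himg]
    rw [Finset.sum_image (fun x _ y _ hxy => g.injective hxy)]

/-- The Weyl group acts transitively on the positive systems: the element of the orbit of `ρ`
which is closest to `g⁻¹ ρ` provides the required element. -/
theorem exists_mul_pos [Finite (reflGroup R)] {g : E ≃ₗᵢ[ℝ] E} (hg : ∀ α ∈ R, g α ∈ R) :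
    ∃ w ∈ reflGroup R, ∀ α ∈ posRoots R φ, (g * w) α ∈ posRoots R φ := by
  have hfin : (posRoots R φ).Finite := h.finite.subset fun x hx => hx.1
  have hP : (hfin.toFinset : Set E) = posRoots R φ := hfin.coe_toFinset
  set ρ := weylVector hfin.toFinset
  obtain ⟨⟨w, hw⟩, hmax⟩ := Finite.exists_max
    (fun w : reflGroup R => (inner ℝ ρ (g (w.1 ρ)) : ℝ))
  refine ⟨w, hw, fun α hα => ?_⟩
  have hmem : g (w α) ∈ R := hg _ (reflGroup_map_mem h.toIsRootSet hw α hα.1)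
  have h1 := hmax ⟨w * refl α, mul_mem hw (Subgroup.subset_closure ⟨α, hα.1, rfl⟩)⟩
  simp only [LinearIsometryEquiv.coe_mul, Function.comp_apply] at h1 ⊢
  rw [refl_apply (h.norm_two α hα.1), map_sub, map_sub, map_smul, map_smul, inner_sub_right,
    inner_smul_right] at h1
  have h2 := h.inner_weylVector_pos hP α hα
  rw [real_inner_comm] at h2
  rcases h.pos_or_neg hmem with h3 | h3
  · exact h3
  · have h4 := h.inner_weylVector_pos hP _ h3
    rw [inner_neg_right] at h4
    nlinarith

end WeylVector

theorem map_simple {g : E ≃ₗᵢ[ℝ] E} (hg : ∀ α ∈ posRoots R φ, g α ∈ posRoots R φ) :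
    ∀ α ∈ simpleRoots R φ, g α ∈ simpleRoots R φ := by
  have hfin : (posRoots R φ).Finite := h.finite.subset fun x hx => hx.1
  have himg : g '' posRoots R φ = posRoots R φ :=
    Set.eq_of_subset_of_ncard_le (by rintro _ ⟨α, hα, rfl⟩; exact hg α hα)
      (Set.ncard_image_of_injective _ g.injective).ge hfin
  have hsurj : ∀ β ∈ posRoots R φ, ∃ γ ∈ posRoots R φ, g γ = β := by
    intro β hβ
    rwa [← himg] at hβ
  intro α hα
  refine ⟨hg α hα.1, fun β hβ γ hγ hsum => ?_⟩
  obtain ⟨b, hb, rfl⟩ := hsurj β hβ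
  obtain ⟨c, hc, rfl⟩ := hsurj γ hγ
  rw [← map_add] at hsum
  exact hα.2 b hb c hc (g.injective hsum)

theorem mem_span_simple (hα : α ∈ R) : α ∈ Submodule.span ℝ (simpleRoots R φ) := by
  have key : ∀ β ∈ posRoots R φ, β ∈ Submodule.span ℝ (simpleRoots R φ) :=
    h.pos_induction (fun α hα => Submodule.subset_span hα)
      fun α hα β _ _ ih => add_mem ih (Submodule.subset_span hα)
  rcases h.pos_or_neg hα with h1 | h1
  · exact key α h1
  · simpa using neg_mem (key _ h1)

/-- If the simple roots fall into two mutually orthogonal sets, then every root is a combination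
of the members of one of them. -/
theorem mem_span_or_mem_span {T U : Set E} (hTU : simpleRoots R φ ⊆ T ∪ U)
    (horth : ∀ α ∈ T, ∀ β ∈ U, inner ℝ α β = (0 : ℝ)) (hα : α ∈ R) :
    α ∈ Submodule.span ℝ T ∨ α ∈ Submodule.span ℝ U := by
  have hTo : ∀ x ∈ Submodule.span ℝ T, ∀ β ∈ U, inner ℝ x β = (0 : ℝ) := by
    intro x hx β hβ
    induction hx using Submodule.span_induction with
    | mem x hx => exact horth x hx β hβ
    | zero => simp
    | add x y _ _ hx hy => rw [inner_add_left, hx, hy, add_zero]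
    | smul a x _ hx => rw [inner_smul_left, hx, mul_zero]
  have hUo : ∀ x ∈ Submodule.span ℝ U, ∀ β ∈ T, inner ℝ x β = (0 : ℝ) := by
    intro x hx β hβ
    induction hx using Submodule.span_induction with
    | mem x hx => rw [real_inner_comm]; exact horth β hβ x hx
    | zero => simp
    | add x y _ _ hx hy => rw [inner_add_left, hx, hy, add_zero]
    | smul a x _ hx => rw [inner_smul_left, hx, mul_zero]
  have key : ∀ β ∈ posRoots R φ, β ∈ Submodule.span ℝ T ∨ β ∈ Submodule.span ℝ U := by
    refine h.pos_induction
      (fun α hα => (hTU hα).imp (fun h => Submodule.subset_span h) fun h => Submodule.subset_span h)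
      ?_
    intro α hα β _ hin ih
    rcases ih with h1 | h1 <;> rcases hTU hα with h2 | h2
    · exact .inl (add_mem h1 (Submodule.subset_span h2))
    · rw [hTo β h1 α h2] at hin; norm_num at hin
    · rw [hUo β h1 α h2] at hin; norm_num at hin
    · exact .inr (add_mem h1 (Submodule.subset_span h2))
  rcases h.pos_or_neg hα with h1 | h1
  · exact key α h1
  · exact (key _ h1).imp (fun h => by simpa using neg_mem h) fun h => by simpa using neg_mem h

end IsRegular

/-- A set of roots is irreducible if it is not the union of two nonempty sets which are
orthogonal to each other. -/
def IsIrreducible (R : Set E) : Prop :=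
  R.Nonempty ∧ ∀ T ⊆ R, T.Nonempty → (∀ α ∈ T, ∀ β ∈ R \ T, inner ℝ α β = (0 : ℝ)) → T = R

theorem IsIrreducible.simpleRoots {R : Set E} {φ : E →ₗ[ℝ] ℝ} (hirr : IsIrreducible R)
    (h : IsRegular R φ) : IsIrreducible (simpleRoots R φ) := by
  constructor
  · obtain ⟨α, hα⟩ := hirr.1
    rcases h.pos_or_neg hα with h1 | h1
    · exact (h.exists_simple_inner_pos h1).imp fun a ha => ha.1
    · exact (h.exists_simple_inner_pos h1).imp fun a ha => ha.1
  · intro T hT hne horth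
    set U := CharMass.simpleRoots R φ \ T
    have hor := fun {α} (hα : α ∈ R) => h.mem_span_or_mem_span (T := T) (U := U)
      (fun x hx => by by_cases hxT : x ∈ T; exacts [.inl hxT, .inr ⟨hx, hxT⟩])
      horth hα
    have hspan : ∀ x ∈ Submodule.span ℝ T, ∀ y ∈ Submodule.span ℝ U, inner ℝ x y = (0 : ℝ) := by
      have : Submodule.span ℝ T ⟂ Submodule.span ℝ U := by
        rw [Submodule.isOrtho_span]
        exact fun {u} hu {v} hv => horth u hu v hv
      exact fun x hx y hy => this.inner_eq hx hy
    have h1 : {α | α ∈ R ∧ α ∈ Submodule.span ℝ T} = R := by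
      refine hirr.2 _ (fun x hx => hx.1) ?_ ?_
      · obtain ⟨a, ha⟩ := hne
        exact ⟨a, (hT ha).1.1, Submodule.subset_span ha⟩
      · rintro α ⟨_, hα⟩ β ⟨hβ, hβ'⟩
        refine hspan α hα β ((hor hβ).resolve_left fun hc => hβ' ⟨hβ, hc⟩)
    by_contra hcon
    obtain ⟨β, hβ, hβT⟩ : (CharMass.simpleRoots R φ \ T).Nonempty := by
      rw [Set.sdiff_nonempty]
      exact fun hc => hcon (hT.antisymm hc)
    have h2 : β ∈ {α | α ∈ R ∧ α ∈ Submodule.span ℝ T} := by rw [h1]; exact hβ.1.1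
    have h3 := hspan β h2.2 β (Submodule.subset_span ⟨hβ, hβT⟩)
    rw [h.norm_two β hβ.1.1] at h3
    norm_num at h3

end RootSets

/-! ### Groups of automorphisms of a simply laced diagram -/

section Diagram

variable {E : Type*} [NormedAddCommGroup E] [InnerProductSpace ℝ E]

/-- The simple roots of a simply laced root system, abstractly: vectors of square norm `2` in an
open half space, with pairwise inner products in `{0, -1, -2, …}`. Two of them are adjacent in
the Dynkin diagram if they are not orthogonal. -/
structure IsSimpleSystem (D : Finset E) (φ : E →ₗ[ℝ] ℝ) : Prop where
  norm_two : ∀ α ∈ D, inner ℝ α α = (2 : ℝ)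
  integral : ∀ α ∈ D, ∀ β ∈ D, ∃ k : ℤ, inner ℝ α β = (k : ℝ)
  nonpos : ∀ α ∈ D, ∀ β ∈ D, α ≠ β → inner ℝ α β ≤ (0 : ℝ)
  pos : ∀ α ∈ D, 0 < φ α

/-- The sum of the elements of a set of simple roots. When the set is a connected subdiagram,
this is a root, and in particular has square norm `2`. -/
def total (I : Finset E) : E := ∑ x ∈ I, x

namespace IsSimpleSystem

variable {D I : Finset E} {φ : E →ₗ[ℝ] ℝ} (h : IsSimpleSystem D φ)
include h

/-- The square norm of a sum of simple roots is at most the sum of their square norms. -/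
theorem inner_total_self_le (hI : I ⊆ D) : inner ℝ (total I) (total I) ≤ 2 * (I.card : ℝ) := by
  classical
  have h1 : ∀ a ∈ I, inner ℝ a (total I) ≤ (2 : ℝ) := by
    intro a ha
    rw [total, ← Finset.add_sum_erase I (fun x => x) ha, inner_add_right, h.norm_two a (hI ha),
      inner_sum]
    have : ∑ b ∈ I.erase a, inner ℝ a b ≤ (0 : ℝ) := Finset.sum_nonpos fun b hb =>
      h.nonpos a (hI ha) b (hI (Finset.mem_of_mem_erase hb)) (Finset.ne_of_mem_erase hb).symm
    linarith
  conv_lhs => enter [2]; rw [total]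
  rw [sum_inner]
  calc _ ≤ ∑ _a ∈ I, (2 : ℝ) := Finset.sum_le_sum h1
    _ = _ := by rw [Finset.sum_const, nsmul_eq_mul, mul_comm]

theorem total_pos (hI : I ⊆ D) (hne : I.Nonempty) : 0 < φ (total I) := by
  rw [total, map_sum]
  exact Finset.sum_pos (fun x hx => h.pos x (hI hx)) hne

theorem eq_empty_of_total_eq_zero (hI : I ⊆ D) (h0 : total I = 0) : I = ∅ := by
  by_contra hne
  have := h.total_pos hI (Finset.nonempty_iff_ne_empty.2 hne)
  rw [h0, map_zero] at this
  exact lt_irrefl _ this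

/-- At most three simple roots can be attached to a root: otherwise `2β + a + b + c + d` would
have nonpositive square norm. -/
theorem card_le_three {β : E} (hβ : inner ℝ β β = (2 : ℝ)) (hpos : 0 < φ β) {N : Finset E}
    (hN : N ⊆ D) (hadj : ∀ a ∈ N, inner ℝ β a ≤ (-1 : ℝ)) : N.card ≤ 3 := by
  by_contra! hcard
  obtain ⟨M, hMN, hM⟩ := Finset.exists_subset_card_eq (s := N) (n := 4) hcard
  have h1 := h.inner_total_self_le (hMN.trans hN)
  have h2 : inner ℝ β (total M) ≤ (-4 : ℝ) := by
    rw [total, inner_sum]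
    calc _ ≤ ∑ _a ∈ M, (-1 : ℝ) := Finset.sum_le_sum fun a ha => hadj a (hMN ha)
      _ = _ := by rw [Finset.sum_const, hM]; norm_num
  have h3 : 0 < φ ((2 : ℝ) • β + total M) := by
    rw [map_add, map_smul, smul_eq_mul]
    have := h.total_pos (hMN.trans hN) (Finset.card_pos.1 (by omega))
    linarith
  have h4 : 0 < inner ℝ ((2 : ℝ) • β + total M) ((2 : ℝ) • β + total M) := by
    refine real_inner_self_pos.2 fun h0 => ?_
    rw [h0, map_zero] at h3
    exact lt_irrefl _ h3
  rw [inner_add_left, inner_add_right, inner_add_right, inner_smul_left, inner_smul_right,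
    inner_smul_left, inner_smul_right, real_inner_comm β (total M), hβ] at h4
  rw [hM] at h1
  simp only [conj_trivial] at h4
  push_cast at h1
  linarith

theorem integral_total (hI : I ⊆ D) {a : E} (ha : a ∈ D) :
    ∃ k : ℤ, inner ℝ (total I) a = (k : ℝ) := by
  choose! k hk using fun b (hb : b ∈ I) => h.integral b (hI hb) a ha
  exact ⟨∑ b ∈ I, k b, by rw [total, sum_inner, Int.cast_sum]; exact Finset.sum_congr rfl hk⟩

theorem inner_total_nonpos (hI : I ⊆ D) {a : E} (ha : a ∈ D) (haI : a ∉ I) :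
    inner ℝ (total I) a ≤ (0 : ℝ) := by
  rw [total, sum_inner]
  exact Finset.sum_nonpos fun b hb => h.nonpos b (hI hb) a ha (by rintro rfl; exact haI hb)

theorem inner_total_eq_neg_one (hI : I ⊆ D) (h2 : inner ℝ (total I) (total I) = (2 : ℝ)) {a : E}
    (ha : a ∈ D) (hneg : inner ℝ (total I) a < (0 : ℝ)) : inner ℝ (total I) a = (-1 : ℝ) := by
  have hne : I.Nonempty := by
    rw [Finset.nonempty_iff_ne_empty]; rintro rfl; simp [total] at h2
  have h3 := neg_one_le_inner_of_ne h2 (h.norm_two a ha) (h.integral_total hI ha) (by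
    intro hc
    have := h.total_pos hI hne
    rw [hc, map_neg] at this
    linarith [h.pos a ha])
  obtain ⟨k, hk⟩ := h.integral_total hI ha
  rw [hk] at h3 hneg ⊢
  have h4 : -1 ≤ k := by exact_mod_cast h3
  have h5 : k < 0 := by exact_mod_cast hneg
  exact_mod_cast (by omega : k = -1)

/-- Attaching a vertex to a connected diagram gives a connected diagram, in terms of the sums of
the simple roots. -/
theorem inner_total_insert [DecidableEq E] {a : E} (ha : a ∈ D) (haI : a ∉ I)
    (h2 : inner ℝ (total I) (total I) = (2 : ℝ)) (hadj : inner ℝ (total I) a = (-1 : ℝ)) :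
    inner ℝ (total (insert a I)) (total (insert a I)) = (2 : ℝ) := by
  rw [total, Finset.sum_insert haI]
  change inner ℝ (a + total I) (a + total I) = (2 : ℝ)
  rw [inner_add_left, inner_add_right, inner_add_right, h.norm_two a ha,
    real_inner_comm (total I) a, hadj, h2]
  norm_num

/-- A connected simply laced diagram is a tree, i.e. its simple roots add up to a root. -/
theorem inner_total_eq_two (hirr : IsIrreducible (D : Set E)) :
    inner ℝ (total D) (total D) = (2 : ℝ) := by
  classical
  obtain ⟨x, hx⟩ := hirr.1
  have hne : (D.powerset.filter fun I => inner ℝ (total I) (total I) = (2 : ℝ)).Nonempty := by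
    refine ⟨{x}, ?_⟩
    rw [Finset.mem_filter, Finset.mem_powerset, Finset.singleton_subset_iff]
    exact ⟨hx, by simpa [total] using h.norm_two x hx⟩
  obtain ⟨I, hI, hmax⟩ := Finset.exists_max_image _ Finset.card hne
  rw [Finset.mem_filter, Finset.mem_powerset] at hI
  by_cases hID : I = D
  · rw [← hID]; exact hI.2
  exfalso
  have hIne : I.Nonempty := by
    rw [Finset.nonempty_iff_ne_empty]; rintro rfl; simpa [total] using hI.2
  obtain ⟨b, hb, a, ha, haI, hne⟩ : ∃ b ∈ I, ∃ a ∈ D, a ∉ I ∧ inner ℝ b a ≠ (0 : ℝ) := by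
    by_contra! hcon
    refine hID (Finset.coe_injective (hirr.2 I (by exact_mod_cast hI.1) (by simpa using hIne) ?_))
    rintro b hb a ⟨ha, haI⟩
    exact hcon b hb a ha haI
  have hneg : inner ℝ (total I) a < (0 : ℝ) := by
    rw [total, sum_inner]
    have hnp : ∀ c ∈ I, inner ℝ c a ≤ (0 : ℝ) := fun c hc =>
      h.nonpos c (hI.1 hc) a ha (by rintro rfl; exact haI hc)
    exact Finset.sum_neg' hnp ⟨b, hb, lt_of_le_of_ne (hnp b hb) hne⟩
  have h1 := h.inner_total_insert ha haI hI.2 (h.inner_total_eq_neg_one hI.1 hI.2 ha hneg)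
  have h2 := hmax (insert a I) (by
    rw [Finset.mem_filter, Finset.mem_powerset]
    exact ⟨Finset.insert_subset ha hI.1, h1⟩)
  rw [Finset.card_insert_of_notMem haI] at h2
  omega

/-- A simple root attached to a connected diagram is attached to exactly one of its vertices, by a
simple edge. -/
theorem exists_neighbor (hI : I ⊆ D) {a : E} (ha : a ∈ D) (haI : a ∉ I)
    (hadj : inner ℝ (total I) a = (-1 : ℝ)) :
    ∃ y ∈ I, inner ℝ y a = (-1 : ℝ) ∧ ∀ z ∈ I, z ≠ y → inner ℝ z a = (0 : ℝ) := by
  classical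
  have hnp : ∀ c ∈ I, inner ℝ c a ≤ (0 : ℝ) := fun c hc =>
    h.nonpos c (hI hc) a ha (by rintro rfl; exact haI hc)
  rw [total, sum_inner] at hadj
  obtain ⟨y, hy, hyneg⟩ : ∃ y ∈ I, inner ℝ y a < (0 : ℝ) := by
    by_contra! hcon
    have := Finset.sum_nonneg hcon
    linarith
  have hy1 : inner ℝ y a ≤ (-1 : ℝ) := by
    obtain ⟨k, hk⟩ := h.integral y (hI hy) a ha
    rw [hk] at hyneg ⊢
    have : k < 0 := by exact_mod_cast hyneg
    exact_mod_cast (by omega : k ≤ -1)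
  rw [← Finset.add_sum_erase I _ hy] at hadj
  have hnp' : ∀ c ∈ I.erase y, inner ℝ c a ≤ (0 : ℝ) := fun c hc =>
    hnp c (Finset.mem_of_mem_erase hc)
  have hsum := Finset.sum_nonpos hnp'
  refine ⟨y, hy, by linarith, fun z hz hzy => ?_⟩
  have h0 : ∑ c ∈ I.erase y, inner ℝ c a = (0 : ℝ) := by linarith
  exact (Finset.sum_eq_zero_iff_of_nonpos hnp').1 h0 z (Finset.mem_erase.2 ⟨hzy, hz⟩)

end IsSimpleSystem

/-- The subset `I` is stable under the isometries in `Γ`. -/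
def IsStable (Γ : Subgroup (E ≃ₗᵢ[ℝ] E)) (I : Finset E) : Prop := ∀ g ∈ Γ, ∀ x ∈ I, g x ∈ I

theorem map_total {g : E ≃ₗᵢ[ℝ] E} {I : Finset E} (hg : ∀ x ∈ I, g x ∈ I) :
    g (total I) = total I := by
  classical
  have himg : I.image g = I := by
    apply Finset.eq_of_subset_of_card_le
    · intro β hβ
      obtain ⟨c, hc, rfl⟩ := Finset.mem_image.1 hβ
      exact hg c hc
    · rw [Finset.card_image_of_injective _ g.injective]
  rw [total, map_sum]
  conv_rhs => rw [← himg]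
  rw [Finset.sum_image (fun x _ y _ hxy => g.injective hxy)]

open scoped Classical in
/-- The part of the `Γ`-orbit of `x` which lies in `D`. -/
def orbitIn (Γ : Subgroup (E ≃ₗᵢ[ℝ] E)) (D : Finset E) (x : E) : Finset E :=
  D.filter fun y => ∃ g ∈ Γ, g x = y

theorem mem_orbitIn {Γ : Subgroup (E ≃ₗᵢ[ℝ] E)} {D : Finset E} {x y : E} :
    y ∈ orbitIn Γ D x ↔ y ∈ D ∧ ∃ g ∈ Γ, g x = y := by
  classical
  simp [orbitIn]

theorem isStable_orbitIn {Γ : Subgroup (E ≃ₗᵢ[ℝ] E)} {D : Finset E} (hD : IsStable Γ D) (x : E) :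
    IsStable Γ (orbitIn Γ D x) := by
  intro g hg y hy
  obtain ⟨hyD, k, hk, rfl⟩ := mem_orbitIn.1 hy
  exact mem_orbitIn.2 ⟨hD g hg _ hyD, g * k, mul_mem hg hk, rfl⟩

theorem self_mem_orbitIn {Γ : Subgroup (E ≃ₗᵢ[ℝ] E)} {D : Finset E} {x : E} (hx : x ∈ D) :
    x ∈ orbitIn Γ D x := mem_orbitIn.2 ⟨hx, 1, one_mem _, rfl⟩

theorem not_fixed_of_mem_orbitIn {Γ : Subgroup (E ≃ₗᵢ[ℝ] E)} {D : Finset E} {x y : E}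
    (hx : ∃ g ∈ Γ, g x ≠ x) (hy : y ∈ orbitIn Γ D x) : ∃ g ∈ Γ, g y ≠ y := by
  by_contra! hcon
  obtain ⟨_, k, hk, rfl⟩ := mem_orbitIn.1 hy
  obtain ⟨g, hg, hgx⟩ := hx
  have h1 := hcon k⁻¹ (inv_mem hk)
  have h2 : k⁻¹ (k x) = x := k.symm_apply_apply x
  rw [h2] at h1
  have h3 := hcon g hg
  rw [← h1] at h3
  exact hgx h3

namespace IsSimpleSystem

variable {D I : Finset E} {φ : E →ₗ[ℝ] ℝ} (h : IsSimpleSystem D φ)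
  {Γ : Subgroup (E ≃ₗᵢ[ℝ] E)} (hD : IsStable Γ D)
include h hD

/-- A stable connected diagram is a vertex, or an edge, or is obtained from a smaller stable
connected diagram by attaching an orbit. -/
theorem exists_orbit_removable [DecidableEq E] (hI : I ⊆ D) (hs : IsStable Γ I)
    (h2 : inner ℝ (total I) (total I) = (2 : ℝ)) :
    ∃ x ∈ I, orbitIn Γ D x ⊆ I ∧ ((orbitIn Γ D x).card ≤ 3) ∧ (I = orbitIn Γ D x ∨
      (inner ℝ (total (I \ orbitIn Γ D x)) (total (I \ orbitIn Γ D x)) = (2 : ℝ) ∧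
        ∀ o ∈ orbitIn Γ D x, inner ℝ (total (I \ orbitIn Γ D x)) o = (-1 : ℝ))) := by
  -- the orbit to be removed is that of a vertex which is not orthogonal to the sum of `I`
  obtain ⟨x, hx, hxpos⟩ : ∃ x ∈ I, 0 < inner ℝ (total I) x := by
    by_contra! hcon
    have h3 : inner ℝ (total I) (total I) ≤ (0 : ℝ) := by
      conv_lhs => enter [3]; rw [total]
      rw [inner_sum]
      exact Finset.sum_nonpos hcon
    linarith
  set O := orbitIn Γ D x with hO
  have hxO : x ∈ O := self_mem_orbitIn (hI hx)
  have hOI : O ⊆ I := by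
    intro y hy
    obtain ⟨_, g, hg, rfl⟩ := mem_orbitIn.1 hy
    exact hs g hg x hx
  have hOD : O ⊆ D := hOI.trans hI
  have hdiff : total (I \ O) = total I - total O := by
    rw [eq_sub_iff_add_eq]; exact Finset.sum_sdiff hOI
  refine ⟨x, hx, hOI, ?_⟩
  by_cases hxI : total I = x
  · -- then `I` is the single vertex `x`
    have hIorb : I = O := by
      have h3 : total (I \ {x}) = 0 := by
        have h4 : total (I \ {x}) + total {x} = total I :=
          Finset.sum_sdiff (Finset.singleton_subset_iff.2 hx)
        rw [hxI] at h4
        simpa [total] using h4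
      have h4 := h.eq_empty_of_total_eq_zero (Finset.sdiff_subset.trans hI) h3
      refine (Finset.sdiff_eq_empty_iff_subset.1 h4).trans ?_ |>.antisymm hOI
      simpa using hxO
    have hfix : O ⊆ {x} := by
      intro y hy
      obtain ⟨_, g, hg, rfl⟩ := mem_orbitIn.1 hy
      have := map_total (hs g hg)
      rw [hxI] at this
      simp [this]
    exact ⟨(Finset.card_le_card hfix).trans (by simp), .inl hIorb⟩
  have hx1 : inner ℝ (total I) x = (1 : ℝ) := by
    have h3 := inner_le_one_of_ne h2 (h.norm_two x (hI hx)) (h.integral_total hI (hI hx)) hxI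
    obtain ⟨k, hk⟩ := h.integral_total hI (hI hx)
    rw [hk] at h3 hxpos ⊢
    have h4 : k ≤ 1 := by exact_mod_cast h3
    have h5 : 0 < k := by exact_mod_cast hxpos
    exact_mod_cast (by omega : k = 1)
  have hinv : ∀ {T : Finset E}, IsStable Γ T → ∀ o ∈ O, inner ℝ (total T) o =
      (inner ℝ (total T) x : ℝ) := by
    intro T hT o ho
    obtain ⟨_, g, hg, rfl⟩ := mem_orbitIn.1 ho
    conv_lhs => rw [← map_total (hT g hg)]
    exact g.inner_map_map _ _
  have hOs : IsStable Γ O := isStable_orbitIn hD x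
  have hsum : ∀ {T : Finset E}, IsStable Γ T → inner ℝ (total T) (total O) =
      (O.card : ℝ) * inner ℝ (total T) x := by
    intro T hT
    conv_lhs => enter [3]; rw [total]
    rw [inner_sum, Finset.sum_congr rfl (hinv hT), Finset.sum_const, nsmul_eq_mul]
  have hdn : inner ℝ (total (I \ O)) (total (I \ O)) =
      2 - 2 * (O.card : ℝ) + O.card * inner ℝ (total O) x := by
    rw [hdiff, inner_sub_left, inner_sub_right, inner_sub_right, h2, real_inner_comm (total I),
      hsum hs, hsum hOs, hx1]
    ring
  have hcpos : 0 < inner ℝ (total O) x := by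
    have h3 : 0 < inner ℝ (total O) (total O) := by
      refine real_inner_self_pos.2 fun h0 => ?_
      have := h.eq_empty_of_total_eq_zero hOD h0
      rw [this] at hxO
      simp at hxO
    rw [hsum hOs] at h3
    exact pos_of_mul_pos_right h3 (by positivity)
  have hcle : inner ℝ (total O) x ≤ (2 : ℝ) := by
    rw [total, ← Finset.add_sum_erase O (fun y => y) hxO, inner_add_left, h.norm_two x (hI hx)]
    have := h.inner_total_nonpos (I := O.erase x) ((Finset.erase_subset _ _).trans hOD) (hI hx)
      (by simp)
    rw [total] at this
    linarith
  -- `x` has at most one neighbour in its orbit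
  have hc12 : inner ℝ (total O) x = (1 : ℝ) ∨ inner ℝ (total O) x = (2 : ℝ) := by
    obtain ⟨k, hk⟩ := h.integral_total hOD (hI hx)
    rw [hk] at hcpos hcle ⊢
    have h4 : k ≤ 2 := by exact_mod_cast hcle
    have h5 : 0 < k := by exact_mod_cast hcpos
    rcases (by omega : k = 1 ∨ k = 2) with rfl | rfl <;> simp
  rcases hc12 with hc | hc
  · -- adjacent members of the orbit: then `I` is an edge whose ends are exchanged
    have h3 : (0 : ℝ) ≤ inner ℝ (total (I \ O)) (total (I \ O)) := real_inner_self_nonneg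
    rw [hdn, hc] at h3
    have h4 : O.card ≤ 2 := by
      have : (O.card : ℝ) ≤ 2 := by linarith
      exact_mod_cast this
    have h5 : O.card ≠ 1 := by
      intro h1
      obtain ⟨y, hy⟩ := Finset.card_eq_one.1 h1
      rw [hy, Finset.mem_singleton] at hxO
      rw [hy, ← hxO, total, Finset.sum_singleton, h.norm_two x (hI hx)] at hc
      norm_num at hc
    have h6 : O.card = 2 := by
      have := Finset.card_pos.2 ⟨x, hxO⟩
      omega
    rw [h6, hc] at hdn
    have h7 : total (I \ O) = 0 := by
      rw [← inner_self_eq_zero (𝕜 := ℝ), hdn]; norm_num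
    have h8 := h.eq_empty_of_total_eq_zero (Finset.sdiff_subset.trans hI) h7
    exact ⟨h4.trans (by norm_num), .inl ((Finset.sdiff_eq_empty_iff_subset.1 h8).antisymm hOI)⟩
  · -- pairwise orthogonal members of the orbit: they can be detached from `I`
    have h3 : inner ℝ (total (I \ O)) (total (I \ O)) = (2 : ℝ) := by rw [hdn, hc]; ring
    have h4 : ∀ o ∈ O, inner ℝ (total (I \ O)) o = (-1 : ℝ) := by
      intro o ho
      rw [hdiff, inner_sub_left, hinv hs o ho, hinv hOs o ho, hx1, hc]; norm_num
    have hne : (I \ O).Nonempty := by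
      rw [Finset.nonempty_iff_ne_empty]; intro h0; rw [h0] at h3; simp [total] at h3
    have hsub : I \ O ⊆ D := Finset.sdiff_subset.trans hI
    exact ⟨h.card_le_three h3 (h.total_pos hsub hne) hOD fun a ha => (h4 a ha).le, .inr ⟨h3, h4⟩⟩

open scoped Classical in
/-- The action of a group of diagram automorphisms on a stable connected diagram `I` is trivial,
or faithful on some orbit `O` with two or three elements. For the induction one also keeps track
of the set `J` of fixed vertices: it is empty or connected, and in the latter case `O` is the set
of vertices attached to it which are not fixed. -/
theorem exists_faithful_orbit_aux (n : ℕ) : ∀ I ⊆ D, I.card = n → IsStable Γ I →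
    inner ℝ (total I) (total I) = (2 : ℝ) →
    (∀ x ∈ I, ∀ g ∈ Γ, g x = x) ∨ ∃ x ∈ I, orbitIn Γ D x ⊆ I ∧ (orbitIn Γ D x).card ≤ 3 ∧
      (∃ g ∈ Γ, g x ≠ x) ∧
      (∀ g ∈ Γ, (∀ o ∈ orbitIn Γ D x, g o = o) → ∀ y ∈ I, g y = y) ∧
      ((∀ y ∈ I, ∃ g ∈ Γ, g y ≠ y) ∨ ∃ J ⊆ I, (∀ y ∈ I, y ∈ J ↔ ∀ g ∈ Γ, g y = y) ∧
        inner ℝ (total J) (total J) = (2 : ℝ) ∧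
        ∀ o ∈ orbitIn Γ D x, inner ℝ (total J) o = (-1 : ℝ)) := by
  induction n using Nat.strong_induction_on with
  | _ n ih =>
  intro I hI hn hs h2
  obtain ⟨x, hx, hOI, hO3, hcase⟩ := h.exists_orbit_removable hD hI hs h2
  set O := orbitIn Γ D x with hO
  have hxO : x ∈ O := self_mem_orbitIn (hI hx)
  have hOs : IsStable Γ O := isStable_orbitIn hD x
  have hOD : O ⊆ D := hOI.trans hI
  have hfixO : (∀ g ∈ Γ, g x = x) → ∀ y ∈ O, y = x := by
    intro hfix y hy
    obtain ⟨_, g, hg, rfl⟩ := mem_orbitIn.1 hy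
    exact hfix g hg
  -- `I` is a single orbit, or an orbit `O` attached to a smaller connected diagram `I'`
  rcases hcase with hIorb | ⟨h2', hadj⟩
  · by_cases hfix : ∀ g ∈ Γ, g x = x
    · left
      intro y hy
      rw [hfixO hfix y (hIorb.subset hy)]
      exact hfix
    · push Not at hfix
      exact .inr ⟨x, hx, hOI, hO3, hfix, fun g _ hgO y hy => hgO y (hIorb.subset hy),
        .inl fun y hy => not_fixed_of_mem_orbitIn hfix (hIorb.subset hy)⟩
  set I' := I \ O with hI'
  have hI'D : I' ⊆ D := Finset.sdiff_subset.trans hI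
  have hI's : IsStable Γ I' := by
    intro g hg y hy
    rw [hI', Finset.mem_sdiff] at hy ⊢
    refine ⟨hs g hg y hy.1, fun hc => hy.2 ?_⟩
    have := hOs g⁻¹ (inv_mem hg) _ hc
    rwa [show g⁻¹ (g y) = y from g.symm_apply_apply y] at this
  have hnotI' : ∀ o ∈ O, o ∉ I' := fun o ho hc => (Finset.mem_sdiff.1 hc).2 ho
  have hmemI : ∀ y ∈ I, y ∈ I' ∨ y ∈ O := by
    intro y hy
    by_cases hyO : y ∈ O
    exacts [.inr hyO, .inl (Finset.mem_sdiff.2 ⟨hy, hyO⟩)]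
  have hlt : I'.card < n := by
    rw [← hn]
    exact Finset.card_lt_card ((Finset.sdiff_ssubset hOI ⟨x, hxO⟩))
  -- the unique vertex of `I'` to which a vertex of `O` is attached
  have hnb : ∀ o ∈ O, ∃ y ∈ I', inner ℝ y o = (-1 : ℝ) ∧
      ∀ z ∈ I', z ≠ y → inner ℝ z o = (0 : ℝ) := fun o ho =>
    h.exists_neighbor hI'D (hOD ho) (hnotI' o ho) (hadj o ho)
  have huniq : ∀ o ∈ O, ∀ y ∈ I', ∀ z ∈ I', inner ℝ y o = (-1 : ℝ) → inner ℝ z o = (-1 : ℝ) →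
      y = z := by
    intro o ho y hy z hz hyo hzo
    obtain ⟨t, _, _, ht⟩ := hnb o ho
    have h1 : y = t := by
      by_contra hc; rw [ht y hy hc] at hyo; norm_num at hyo
    have h2 : z = t := by
      by_contra hc; rw [ht z hz hc] at hzo; norm_num at hzo
    rw [h1, h2]
  have hJadj : ∀ {J}, J ⊆ I' → ∀ o ∈ O, ∀ y ∈ J, inner ℝ y o = (-1 : ℝ) →
      inner ℝ (total J) o = (-1 : ℝ) := by
    intro J hJ o ho y hy hyo
    rw [total, sum_inner, Finset.sum_eq_single_of_mem y hy, hyo]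
    intro z hz hzy
    obtain ⟨t, htI, hto, ht⟩ := hnb o ho
    have := huniq o ho y (hJ hy) t htI hyo hto
    exact ht z (hJ hz) (this ▸ hzy)
  -- if `Γ` fixes `I'`, the orbit `O` will do; otherwise the orbit `O1` found for `I'` will do
  rcases ih _ hlt I' hI'D rfl hI's h2' with htriv | ⟨x1, hx1, hO1I, hO13, hx1f, hfaith, hJ⟩
  · by_cases hfix : ∀ g ∈ Γ, g x = x
    · left
      intro y hy
      rcases hmemI y hy with h1 | h1
      · exact htriv y h1
      · rw [hfixO hfix y h1]; exact hfix
    · right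
      push Not at hfix
      refine ⟨x, hx, hOI, hO3, hfix, ?_, .inr ⟨I', Finset.sdiff_subset, ?_, h2', hadj⟩⟩
      · intro g hg hgO y hy
        rcases hmemI y hy with h1 | h1
        exacts [htriv y h1 g hg, hgO y h1]
      · refine fun y hy => ⟨htriv y, fun hyf => (hmemI y hy).resolve_right fun hc => ?_⟩
        obtain ⟨g, hg, hgy⟩ := not_fixed_of_mem_orbitIn hfix hc
        exact hgy (hyf g hg)
  set O1 := orbitIn Γ D x1
  have hO1D : O1 ⊆ D := hO1I.trans hI'D
  have hO1f : ∀ o ∈ O1, ∃ g ∈ Γ, g o ≠ o := fun o ho => not_fixed_of_mem_orbitIn hx1f ho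
  right
  refine ⟨x1, Finset.sdiff_subset hx1, hO1I.trans Finset.sdiff_subset, hO13, hx1f, ?_⟩
  by_cases hfix : ∀ g ∈ Γ, g x = x
  · obtain ⟨y, hy, hyx, hy0⟩ := hnb x hxO
    have hyf : ∀ g ∈ Γ, g y = y := by
      intro g hg
      refine huniq x hxO _ (hI's g hg y hy) y hy ?_ hyx
      conv_lhs => rw [← hfix g hg]
      rw [g.inner_map_map, hyx]
    refine ⟨?_, ?_⟩
    · intro g hg hgO y hy
      rcases hmemI y hy with h1 | h1
      · exact hfaith g hg hgO y h1
      · rw [hfixO hfix y h1]; exact hfix g hg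
    · rcases hJ with hJ | ⟨J, hJI, hJf, hJ2, hJadj1⟩
      · obtain ⟨g, hg, hgy⟩ := hJ y hy
        exact absurd (hyf g hg) hgy
      · right
        have hxJ : x ∉ J := fun hc => hnotI' x hxO (hJI hc)
        have hyJ : y ∈ J := (hJf y hy).2 hyf
        refine ⟨insert x J, Finset.insert_subset hx (hJI.trans Finset.sdiff_subset), ?_,
          h.inner_total_insert (hI hx) hxJ hJ2 (hJadj hJI x hxO y hyJ hyx), ?_⟩
        · intro z hz
          rw [Finset.mem_insert]
          constructor
          · rintro (rfl | h1)
            exacts [hfix, (hJf z (hJI h1)).1 h1]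
          · intro hzf
            rcases hmemI z hz with h1 | h1
            exacts [.inr ((hJf z h1).2 hzf), .inl (hfixO hfix z h1)]
        · intro o ho
          have hoy : o ≠ y := by
            rintro rfl
            obtain ⟨g, hg, hgo⟩ := hO1f o ho
            exact hgo (hyf g hg)
          have h5 := hJadj1 o ho
          rw [total] at h5 ⊢
          rw [Finset.sum_insert hxJ, inner_add_left, h5, real_inner_comm,
            hy0 o (hO1I ho) hoy, zero_add]
  · push Not at hfix
    have hOf : ∀ o ∈ O, ∃ g ∈ Γ, g o ≠ o := fun o ho => not_fixed_of_mem_orbitIn hfix ho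
    refine ⟨?_, ?_⟩
    · intro g hg hgO
      have hgI' := hfaith g hg hgO
      intro o ho
      rcases hmemI o ho with h1 | h1
      · exact hgI' o h1
      by_contra hgo
      obtain ⟨y, hy, hyo, hy0⟩ := hnb o h1
      have hgoO : g o ∈ O := hOs g hg o h1
      have hygo : inner ℝ y (g o) = (-1 : ℝ) := by
        conv_lhs => rw [← hgI' y hy]
        rw [g.inner_map_map, hyo]
      by_cases hyf : ∀ k ∈ Γ, k y = y
      · -- `O1` and two vertices of `O` are attached to the set of fixed vertices
        rcases hJ with hJ | ⟨J, hJI, hJf, hJ2, hJadj1⟩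
        · obtain ⟨k, hk, hky⟩ := hJ y hy
          exact hky (hyf k hk)
        have hyJ : y ∈ J := (hJf y hy).2 hyf
        obtain ⟨k, hk, hkx⟩ := hx1f
        have hx1O : x1 ∈ O1 := self_mem_orbitIn (hI'D hx1)
        have hkO : k x1 ∈ O1 := isStable_orbitIn hD x1 k hk x1 hx1O
        have hno : ∀ o ∈ O1, o ∉ O := fun o ho hc => hnotI' o hc (hO1I ho)
        have h4 := h.card_le_three hJ2 (h.total_pos (hJI.trans hI'D) ⟨y, hyJ⟩)
          (N := {x1, k x1, o, g o}) (by
            intro z hz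
            simp only [Finset.mem_insert, Finset.mem_singleton] at hz
            rcases hz with rfl | rfl | rfl | rfl
            exacts [hO1D hx1O, hO1D hkO, hOD h1, hOD hgoO]) (by
            intro z hz
            simp only [Finset.mem_insert, Finset.mem_singleton] at hz
            rcases hz with rfl | rfl | rfl | rfl
            exacts [(hJadj1 _ hx1O).le, (hJadj1 _ hkO).le, (hJadj hJI _ h1 y hyJ hyo).le,
              (hJadj hJI _ hgoO y hyJ hygo).le])
        have e1 : x1 ≠ k x1 := hkx.symm
        have e2 : x1 ≠ o := by rintro rfl; exact hno _ hx1O h1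
        have e3 : x1 ≠ g o := by intro hc; exact hno _ hx1O (hc ▸ hgoO)
        have e4 : k x1 ≠ o := by intro hc; exact hno _ hkO (hc ▸ h1)
        have e5 : k x1 ≠ g o := by intro hc; exact hno _ hkO (hc ▸ hgoO)
        have e6 : o ≠ g o := Ne.symm hgo
        rw [Finset.card_insert_of_notMem (by simp [e1, e2, e3]),
          Finset.card_insert_of_notMem (by simp [e4, e5]),
          Finset.card_insert_of_notMem (by simp [e6]), Finset.card_singleton] at h4
        omega
      · -- two vertices of `O` are attached to each of two vertices of `I'`
        push Not at hyf
        obtain ⟨k, hk, hky⟩ := hyf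
        have hkyI := hI's k hk y hy
        have hko := hOs k hk o h1
        have hkgo := hOs k hk _ hgoO
        have a1 : inner ℝ (k y) (k o) = (-1 : ℝ) := by rw [k.inner_map_map, hyo]
        have a2 : inner ℝ (k y) (k (g o)) = (-1 : ℝ) := by rw [k.inner_map_map, hygo]
        have e1 : o ≠ g o := Ne.symm hgo
        have e2 : o ≠ k o := by
          intro hc; exact hky (huniq _ hko _ hkyI y hy a1 (hc ▸ hyo))
        have e3 : o ≠ k (g o) := by
          intro hc; exact hky (huniq _ hkgo _ hkyI y hy a2 (hc ▸ hyo))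
        have e4 : g o ≠ k o := by
          intro hc; exact hky (huniq _ hko _ hkyI y hy a1 (hc ▸ hygo))
        have e5 : g o ≠ k (g o) := by
          intro hc; exact hky (huniq _ hkgo _ hkyI y hy a2 (by rw [← hc]; exact hygo))
        have e6 : k o ≠ k (g o) := fun hc => e1 (k.injective hc)
        have h4 : ({o, g o, k o, k (g o)} : Finset E) ⊆ O := by
          intro z hz
          simp only [Finset.mem_insert, Finset.mem_singleton] at hz
          rcases hz with rfl | rfl | rfl | rfl
          exacts [h1, hgoO, hko, hkgo]
        have h5 := Finset.card_le_card h4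
        rw [Finset.card_insert_of_notMem (by simp [e1, e2, e3]),
          Finset.card_insert_of_notMem (by simp [e4, e5]),
          Finset.card_insert_of_notMem (by simp [e6]), Finset.card_singleton] at h5
        omega
    · rcases hJ with hJ | ⟨J, hJI, hJf, hJ2, hJadj1⟩
      · left
        intro y hy
        rcases hmemI y hy with h1 | h1
        exacts [hJ y h1, hOf y h1]
      · refine .inr ⟨J, hJI.trans Finset.sdiff_subset, fun y hy => ?_, hJ2, hJadj1⟩
        rcases hmemI y hy with h1 | h1
        · exact hJf y h1
        · refine ⟨fun hc => absurd (hJI hc) (hnotI' y h1), fun hc => ?_⟩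
          obtain ⟨g, hg, hgy⟩ := hOf y h1
          exact absurd (hc g hg) hgy

/-- A group of automorphisms of a connected simply laced diagram acts faithfully on one of its
orbits, and this orbit has at most three elements. -/
theorem exists_faithful_orbit (hirr : IsIrreducible (D : Set E)) :
    ∃ x ∈ D, (orbitIn Γ D x).card ≤ 3 ∧
      ∀ g ∈ Γ, (∀ o ∈ orbitIn Γ D x, g o = o) → ∀ y ∈ D, g y = y := by
  rcases h.exists_faithful_orbit_aux hD _ D subset_rfl rfl hD (h.inner_total_eq_two hirr) with
    htriv | ⟨x, hx, _, h3, _, hf, _⟩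
  · obtain ⟨x, hx⟩ := hirr.1
    refine ⟨x, hx, ?_, fun g hg _ y hy => htriv y hy g hg⟩
    have : orbitIn Γ D x ⊆ {x} := by
      intro y hy
      obtain ⟨_, g, hg, rfl⟩ := mem_orbitIn.1 hy
      simpa using htriv x hx g hg
    exact (Finset.card_le_card this).trans (by simp)
  · exact ⟨x, hx, h3, hf⟩

end IsSimpleSystem

end Diagram

/-! ### Cosets of the Weyl group of an irreducible root system -/

section OuterAutomorphisms

variable {E : Type*} [NormedAddCommGroup E] [InnerProductSpace ℝ E]

/-- The isometries which permute the positive roots. For the roots of `L` this is the stabilizer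
of the Weyl vector, and it is a complement of the Weyl group in the group of all isometries which
permute the roots. -/
def diagramGroup (R : Set E) (φ : E →ₗ[ℝ] ℝ) : Subgroup (E ≃ₗᵢ[ℝ] E) where
  carrier := {g | g '' posRoots R φ = posRoots R φ}
  one_mem' := by simp
  mul_mem' := by
    intro a b ha hb
    simp only [Set.mem_ofPred_eq] at ha hb ⊢
    rw [LinearIsometryEquiv.coe_mul, Set.image_comp, hb, ha]
  inv_mem' := by
    intro a ha
    simp only [Set.mem_ofPred_eq] at ha ⊢
    conv_lhs => rw [← ha]
    rw [← Set.image_comp, ← LinearIsometryEquiv.coe_mul, inv_mul_cancel]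
    simp

theorem mem_diagramGroup {R : Set E} {φ : E →ₗ[ℝ] ℝ} (h : IsRegular R φ) {g : E ≃ₗᵢ[ℝ] E} :
    g ∈ diagramGroup R φ ↔ ∀ α ∈ posRoots R φ, g α ∈ posRoots R φ := by
  constructor
  · rintro (hg : g '' posRoots R φ = posRoots R φ) α hα
    rw [← hg]
    exact ⟨α, hα, rfl⟩
  · intro hg
    exact Set.eq_of_subset_of_ncard_le (by rintro _ ⟨α, hα, rfl⟩; exact hg α hα)
      (Set.ncard_image_of_injective _ g.injective).ge (h.finite.subset fun x hx => hx.1)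

theorem map_mem_of_mem_diagramGroup {R : Set E} {φ : E →ₗ[ℝ] ℝ} (h : IsRegular R φ)
    {g : E ≃ₗᵢ[ℝ] E} (hg : g ∈ diagramGroup R φ) : ∀ α ∈ R, g α ∈ R := by
  intro α hα
  rcases h.pos_or_neg hα with h1 | h1
  · exact ((mem_diagramGroup h).1 hg α h1).1
  · have := h.neg_mem ((mem_diagramGroup h).1 hg _ h1).1
    simpa using this

theorem perm_fin_pow_eq_one {k : ℕ} (hk : k ≤ 3) (σ : Equiv.Perm (Fin k)) :
    σ ^ 1 = 1 ∨ σ ^ 2 = 1 ∨ σ ^ 3 = 1 := by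
  revert σ
  interval_cases k <;> decide

/-- Two permutations of at most three letters which have the same order are equal, or inverse to
each other, or are transpositions; two transpositions `σ` and `τ` are conjugate by `σ * τ`. The
orders being at most `3`, they are compared through the first and second powers. -/
theorem perm_fin_conj {k : ℕ} (hk : k ≤ 3) (σ τ : Equiv.Perm (Fin k))
    (h1 : σ ^ 1 = 1 ↔ τ ^ 1 = 1) (h2 : σ ^ 2 = 1 ↔ τ ^ 2 = 1) :
    τ = σ ∨ τ = σ⁻¹ ∨ τ = (σ * τ) * σ * (σ * τ)⁻¹ := by
  revert σ τ
  interval_cases k <;> decide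

variable {R : Set E} {φ : E →ₗ[ℝ] ℝ}

/-- The group of automorphisms of an irreducible diagram embeds in a symmetric group on at most
three letters. -/
theorem IsRegular.exists_diagramGroup_hom (h : IsRegular R φ) (hirr : IsIrreducible R)
    (hspan : Submodule.span ℝ R = ⊤) :
    ∃ k ≤ 3, ∃ f : diagramGroup R φ →* Equiv.Perm (Fin k), Function.Injective f := by
  have hfin : (simpleRoots R φ).Finite := h.finite.subset fun x hx => hx.1.1
  have hcoe : (hfin.toFinset : Set E) = simpleRoots R φ := hfin.coe_toFinset
  have hmem : ∀ {x}, x ∈ hfin.toFinset ↔ x ∈ simpleRoots R φ := hfin.mem_toFinset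
  have hS : IsSimpleSystem hfin.toFinset φ :=
    { norm_two := fun α hα => h.norm_two α (hmem.1 hα).1.1
      integral := fun α hα β hβ => h.integral α (hmem.1 hα).1.1 β (hmem.1 hβ).1.1
      nonpos := fun α hα β hβ hne => h.simple_inner_nonpos (hmem.1 hα) (hmem.1 hβ) hne
      pos := fun α hα => (hmem.1 hα).1.2 }
  have hst : IsStable (diagramGroup R φ) hfin.toFinset := fun g hg x hx =>
    hmem.2 (h.map_simple ((mem_diagramGroup h).1 hg) x (hmem.1 hx))
  obtain ⟨x, hx, h3, hf⟩ := hS.exists_faithful_orbit hst (by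
    rw [hcoe]; exact hirr.simpleRoots h)
  set O := orbitIn (diagramGroup R φ) hfin.toFinset x
  have hO := isStable_orbitIn hst x
  let act : MulAction (diagramGroup R φ) O :=
    { smul := fun g y => ⟨g.1 y.1, hO g.1 g.2 y.1 y.2⟩
      one_smul := fun y => rfl
      mul_smul := fun a b y => rfl }
  refine ⟨O.card, h3, (O.equivFin.permCongrHom.toMonoidHom).comp
    (MulAction.toPermHom (diagramGroup R φ) O), ?_⟩
  rw [injective_iff_map_eq_one]
  intro g hg
  have hg' : MulAction.toPermHom (diagramGroup R φ) O g = 1 := by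
    apply O.equivFin.permCongrHom.injective
    rw [map_one]
    exact hg
  have h4 : ∀ o ∈ O, g.1 o = o := fun o ho => by
    have h5 := Equiv.ext_iff.1 hg' ⟨o, ho⟩
    exact congrArg Subtype.val h5
  have h5 := hf g.1 g.2 h4
  ext y
  have hy : y ∈ Submodule.span ℝ (simpleRoots R φ) := by
    have hle : Submodule.span ℝ R ≤ Submodule.span ℝ (simpleRoots R φ) :=
      Submodule.span_le.2 fun a ha => h.mem_span_simple ha
    rw [hspan] at hle
    exact hle trivial
  change g.1 y = y
  induction hy using Submodule.span_induction with
  | mem y hy => exact h5 y (hmem.2 hy)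
  | zero => simp
  | add y z _ _ hy hz => rw [map_add, hy, hz]
  | smul a y _ hy => rw [map_smul, hy]

/-- The automorphisms of an irreducible diagram have order `1`, `2` or `3`. -/
theorem IsRegular.orderOf_mem (h : IsRegular R φ) (hirr : IsIrreducible R)
    (hspan : Submodule.span ℝ R = ⊤) {g : E ≃ₗᵢ[ℝ] E} (hg : g ∈ diagramGroup R φ) :
    orderOf g = 1 ∨ orderOf g = 2 ∨ orderOf g = 3 := by
  obtain ⟨k, hk, f, hf⟩ := h.exists_diagramGroup_hom hirr hspan
  have hord : orderOf g = orderOf (f ⟨g, hg⟩) := by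
    rw [orderOf_injective f hf]; exact (Subgroup.orderOf_mk g hg).symm
  rw [hord]
  have h1 : orderOf (f ⟨g, hg⟩) ∣ 1 ∨ orderOf (f ⟨g, hg⟩) ∣ 2 ∨ orderOf (f ⟨g, hg⟩) ∣ 3 := by
    simp only [orderOf_dvd_iff_pow_eq_one]
    exact perm_fin_pow_eq_one hk _
  rcases h1 with h1 | h1 | h1
  · exact .inl (Nat.dvd_one.1 h1)
  · rcases (Nat.dvd_prime Nat.prime_two).1 h1 with h2 | h2 <;> simp [h2]
  · rcases (Nat.dvd_prime Nat.prime_three).1 h1 with h2 | h2 <;> simp [h2]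

/-- Two automorphisms of the same order of an irreducible diagram are conjugate or inverse to each
other. -/
theorem IsRegular.conj_or_inv (h : IsRegular R φ) (hirr : IsIrreducible R)
    (hspan : Submodule.span ℝ R = ⊤) {g g' : E ≃ₗᵢ[ℝ] E} (hg : g ∈ diagramGroup R φ)
    (hg' : g' ∈ diagramGroup R φ) (hord : orderOf g = orderOf g') :
    g' = g⁻¹ ∨ ∃ k ∈ diagramGroup R φ, g' = k * g * k⁻¹ := by
  obtain ⟨k, hk, f, hf⟩ := h.exists_diagramGroup_hom hirr hspan
  have hpow : ∀ n : ℕ, f ⟨g, hg⟩ ^ n = 1 ↔ f ⟨g', hg'⟩ ^ n = 1 := by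
    intro n
    rw [← map_pow, ← map_pow, map_eq_one_iff f hf, map_eq_one_iff f hf,
      ← orderOf_dvd_iff_pow_eq_one, ← orderOf_dvd_iff_pow_eq_one, Subgroup.orderOf_mk,
      Subgroup.orderOf_mk, hord]
  rcases perm_fin_conj hk _ _ (hpow 1) (hpow 2) with h1 | h1 | h1
  · exact .inr ⟨1, one_mem _, by simpa using congrArg Subtype.val (hf h1)⟩
  · rw [← map_inv] at h1
    exact .inl (congrArg Subtype.val (hf h1))
  · rw [← map_mul, ← map_mul, ← map_inv, ← map_mul] at h1
    exact .inr ⟨g * g', mul_mem hg hg', congrArg Subtype.val (hf h1)⟩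

section Masses

variable [FiniteDimensional ℝ E]

/-- The characteristic polynomial of an isometry. -/
def isomCharpoly (g : E ≃ₗᵢ[ℝ] E) : ℝ[X] :=
  LinearMap.charpoly (g.toLinearEquiv : E →ₗ[ℝ] E)

theorem isomCharpoly_conj (k g : E ≃ₗᵢ[ℝ] E) :
    isomCharpoly (k * g * k⁻¹) = isomCharpoly g := by
  rw [isomCharpoly, isomCharpoly, ← LinearEquiv.charpoly_conj k.toLinearEquiv
    (g.toLinearEquiv : E →ₗ[ℝ] E)]
  rfl

theorem isomCharpoly_inv (g : E ≃ₗᵢ[ℝ] E) : isomCharpoly g⁻¹ = isomCharpoly g := by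
  -- the inverse of an isometry is its adjoint, and a matrix and its transpose have the same
  -- characteristic polynomial
  let b := stdOrthonormalBasis ℝ E
  rw [isomCharpoly, isomCharpoly, ← LinearMap.charpoly_toMatrix _ b.toBasis,
    ← LinearMap.charpoly_toMatrix (g.toLinearEquiv : E →ₗ[ℝ] E) b.toBasis,
    ← Matrix.charpoly_transpose]
  congr 1
  ext i j
  rw [Matrix.transpose_apply, LinearMap.toMatrix_apply, LinearMap.toMatrix_apply]
  simp only [OrthonormalBasis.coe_toBasis, OrthonormalBasis.coe_toBasis_repr_apply,
    OrthonormalBasis.repr_apply_apply]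
  rw [real_inner_comm]
  change inner ℝ (g⁻¹ (b i)) (b j) = (inner ℝ (b i) (g (b j)) : ℝ)
  rw [← g.inner_map_map (g⁻¹ (b i))]
  congr 1
  exact g.apply_symm_apply _

theorem mass_congr {S T : Set (E ≃ₗᵢ[ℝ] E)} (F : (E ≃ₗᵢ[ℝ] E) ≃ (E ≃ₗᵢ[ℝ] E))
    (hF : ∀ g, F g ∈ T ↔ g ∈ S) (hc : ∀ g, isomCharpoly (F g) = isomCharpoly g) :
    mass S = mass T := by
  funext P
  have h1 : T = F '' S := by
    ext g
    rw [F.image_eq_preimage_symm, Set.mem_preimage, ← hF, F.apply_symm_apply]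
  have h2 : {g | g ∈ T ∧ LinearMap.charpoly (g.toLinearEquiv : E →ₗ[ℝ] E) = P} =
      F '' {g | g ∈ S ∧ LinearMap.charpoly (g.toLinearEquiv : E →ₗ[ℝ] E) = P} := by
    ext g
    rw [F.image_eq_preimage_symm]
    change g ∈ T ∧ isomCharpoly g = P ↔ F.symm g ∈ S ∧ isomCharpoly (F.symm g) = P
    rw [← hF, ← hc (F.symm g), F.apply_symm_apply]
  rw [mass, mass, h2, h1, Set.ncard_image_of_injective _ F.injective,
    Set.ncard_image_of_injective _ F.injective]

end Masses

theorem weylGroup_conj_mem {L : Submodule ℤ E} {γ w : E ≃ₗᵢ[ℝ] E} (hγ : γ ∈ orthogonalGroup L)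
    (hw : w ∈ weylGroup L) : γ * w * γ⁻¹ ∈ weylGroup L := by
  have key : weylGroup L ≤ (weylGroup L).comap (MulAut.conj γ).toMonoidHom := by
    conv_lhs => rw [weylGroup]
    rw [Subgroup.closure_le]
    rintro _ ⟨α, ⟨hα, h2⟩, rfl⟩
    change γ * refl α * γ⁻¹ ∈ weylGroup L
    rw [refl_conj γ h2]
    refine Subgroup.subset_closure ⟨γ α, ⟨?_, ?_⟩, rfl⟩
    · have h4 : γ '' (L : Set E) = L := hγ
      have h3 : γ α ∈ γ '' (L : Set E) := ⟨α, hα, rfl⟩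
      rwa [h4] at h3
    · rw [γ.inner_map_map, h2]
  exact key hw

theorem weylGroup_conj_mem_iff {L : Submodule ℤ E} {γ w : E ≃ₗᵢ[ℝ] E}
    (hγ : γ ∈ orthogonalGroup L) : γ * w * γ⁻¹ ∈ weylGroup L ↔ w ∈ weylGroup L := by
  refine ⟨fun h => ?_, weylGroup_conj_mem hγ⟩
  have := weylGroup_conj_mem (inv_mem hγ) h
  simpa [mul_assoc] using this

theorem mem_weylCoset {L : Submodule ℤ E} {σ g : E ≃ₗᵢ[ℝ] E} :
    g ∈ weylCoset σ L ↔ σ⁻¹ * g ∈ weylGroup L := by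
  constructor
  · rintro ⟨w, hw, rfl⟩; simpa using hw
  · intro h; exact ⟨_, h, by simp⟩

theorem map_roots {L : Submodule ℤ E} {γ : E ≃ₗᵢ[ℝ] E} (hγ : γ ∈ orthogonalGroup L) :
    ∀ α ∈ roots L, γ α ∈ roots L := by
  rintro α ⟨hα, h2⟩
  refine ⟨?_, by rw [γ.inner_map_map, h2]⟩
  have h4 : γ '' (L : Set E) = L := hγ
  have h3 : γ α ∈ γ '' (L : Set E) := ⟨α, hα, rfl⟩
  rwa [h4] at h3

/-- The isometries which permute the roots belong to the orthogonal group of the root lattice. -/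
theorem diagramGroup_le_orthogonalGroup (h : IsRegular R φ) :
    diagramGroup R φ ≤ orthogonalGroup (rootLattice R) := by
  have key : ∀ g ∈ diagramGroup R φ, ∀ x ∈ rootLattice R, g x ∈ rootLattice R := by
    intro g hg x hx
    induction hx using Submodule.span_induction with
    | mem x hx => exact Submodule.subset_span (map_mem_of_mem_diagramGroup h hg x hx)
    | zero => simp
    | add y z _ _ hy hz => rw [map_add]; exact add_mem hy hz
    | smul a y _ hy =>
      rw [map_zsmul]
      exact Submodule.smul_mem _ a hy
  intro g hg
  refine Set.Subset.antisymm (by rintro _ ⟨x, hx, rfl⟩; exact key g hg x hx) fun x hx => ?_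
  exact ⟨g⁻¹ x, key _ (inv_mem hg) x hx, g.apply_symm_apply x⟩

theorem weylGroup_rootLattice (hR : roots (rootLattice R) = R) :
    weylGroup (rootLattice R) = reflGroup R := by
  rw [weylGroup, hR, reflGroup]

/-- The automorphisms of the diagram embed in the outer group, since the only one which belongs to
the Weyl group is the identity. -/
theorem orderOf_mk_outerGroup (h : IsRegular R φ) (hR : roots (rootLattice R) = R)
    {σ : E ≃ₗᵢ[ℝ] E} (hσ : σ ∈ diagramGroup R φ) :
    orderOf (QuotientGroup.mk ⟨σ, diagramGroup_le_orthogonalGroup h hσ⟩ :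
      outerGroup (rootLattice R)) = orderOf σ := by
  rw [orderOf_eq_orderOf_iff]
  intro n
  rw [← QuotientGroup.mk_pow, QuotientGroup.eq_one_iff, Subgroup.mem_subgroupOf]
  change σ ^ n ∈ weylGroup (rootLattice R) ↔ _
  rw [weylGroup_rootLattice hR]
  refine ⟨fun hw => h.eq_one_of_pos hw ((mem_diagramGroup h).1 (pow_mem hσ n)), fun h1 => ?_⟩
  rw [h1]
  exact one_mem _

/-- The masses of a coset `τ W(R)` of an irreducible root system depend only on the order of the
image of `τ` in the outer group. -/
theorem mass_weylCoset_eq [FiniteDimensional ℝ E] (h : IsRegular R φ) (hirr : IsIrreducible R)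
    (hspan : Submodule.span ℝ R = ⊤) (hR : roots (rootLattice R) = R) [Finite (reflGroup R)]
    {σ : E ≃ₗᵢ[ℝ] E} (hσ : σ ∈ diagramGroup R φ) (τ : orthogonalGroup (rootLattice R))
    (hord : orderOf (QuotientGroup.mk τ : outerGroup (rootLattice R)) = orderOf σ) :
    mass (weylCoset (τ : E ≃ₗᵢ[ℝ] E) (rootLattice R)) = mass (weylCoset σ (rootLattice R)) := by
  obtain ⟨τ, hτ⟩ := τ
  have hτR : ∀ α ∈ R, τ α ∈ R := by
    have := map_roots hτ
    rwa [hR] at this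
  -- one may assume that `τ` permutes the positive roots
  obtain ⟨w, hw, hpos⟩ := h.exists_mul_pos hτR
  have hw' : w ∈ weylGroup (rootLattice R) := by rwa [weylGroup_rootLattice hR]
  have hτw := (mem_diagramGroup h).2 hpos
  have hO := diagramGroup_le_orthogonalGroup h
  have hmk : (QuotientGroup.mk ⟨τ, hτ⟩ : outerGroup (rootLattice R)) =
      QuotientGroup.mk ⟨τ * w, hO hτw⟩ := by
    rw [QuotientGroup.eq, Subgroup.mem_subgroupOf]
    change τ⁻¹ * (τ * w) ∈ _
    rwa [inv_mul_cancel_left]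
  rw [hmk, orderOf_mk_outerGroup h hR hτw] at hord
  have hcoset : weylCoset τ (rootLattice R) = weylCoset (τ * w) (rootLattice R) := by
    ext g
    rw [mem_weylCoset, mem_weylCoset, mul_inv_rev, mul_assoc,
      Subgroup.mul_mem_cancel_left _ (inv_mem hw')]
  change mass (weylCoset τ _) = _
  rw [hcoset]
  rcases h.conj_or_inv hirr hspan hσ hτw hord.symm with h1 | ⟨k, hk, h1⟩
  · rw [h1]
    refine mass_congr (Equiv.inv _) (fun g => ?_) isomCharpoly_inv
    rw [mem_weylCoset, mem_weylCoset, Equiv.inv_apply, ← weylGroup_conj_mem_iff (hO hσ),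
      ← inv_mem_iff]
    simp
  · rw [h1]
    refine mass_congr (MulAut.conj k⁻¹).toEquiv (fun g => ?_) fun g => ?_
    · rw [mem_weylCoset, mem_weylCoset, ← weylGroup_conj_mem_iff (hO hk)]
      simp [mul_assoc]
    · simpa using isomCharpoly_conj k⁻¹ g

end OuterAutomorphisms

/-! ### Characteristic polynomials of cyclic block matrices -/

section CyclicBlocks

/-- The determinant of `t - C`, where `C` is the companion matrix of `X ^ (m + 1) - y`. -/
theorem det_sub_companion {S : Type*} [CommRing S] (m : ℕ) (t y : S) :
    (Matrix.of fun i j : Fin (m + 1) => (if i = j then t else 0) -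
      (if (i : ℕ) = j + 1 then 1 else 0) - (if i = 0 ∧ j = Fin.last m then y else 0)).det =
      t ^ (m + 1) - y := by
  set M : Matrix (Fin (m + 1)) (Fin (m + 1)) S := Matrix.of fun i j : Fin (m + 1) =>
    (if i = j then t else 0) - (if (i : ℕ) = j + 1 then 1 else 0) -
      (if i = 0 ∧ j = Fin.last m then y else 0) with hM
  have hM' : ∀ i j, M i j = (if i = j then t else 0) - (if (i : ℕ) = j + 1 then 1 else 0) -
      (if i = 0 ∧ j = Fin.last m then y else 0) := fun _ _ => rfl
  have h0 : (M.submatrix Fin.succ (Fin.succAbove 0)).det = t ^ m := by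
    rw [Matrix.det_of_isLowerTriangular]
    · simp [hM', Matrix.submatrix_apply]
    · intro i j hij
      have hij : (i : ℕ) < j := hij
      have h1 : i.succ ≠ j.succ := by rw [Ne, Fin.ext_iff, Fin.val_succ, Fin.val_succ]; omega
      have h2 : (i.succ : ℕ) ≠ j.succ + 1 := by rw [Fin.val_succ, Fin.val_succ]; omega
      have h3 : i.succ ≠ 0 := Fin.succ_ne_zero i
      rw [Matrix.submatrix_apply, Fin.succAbove_zero, hM', if_neg h1, if_neg h2,
        if_neg fun hc => h3 hc.1]
      simp
  have hl : (M.submatrix Fin.succ (Fin.succAbove (Fin.last m))).det = (-1) ^ m := by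
    rw [Matrix.det_of_isUpperTriangular]
    · have h1 : ∀ i : Fin m, M i.succ ((Fin.last m).succAbove i) = -1 := by
        intro i
        have e1 : i.succ ≠ i.castSucc := by
          rw [Ne, Fin.ext_iff, Fin.val_succ, Fin.val_castSucc]; omega
        rw [Fin.succAbove_last, hM', if_neg e1, if_pos (by simp),
          if_neg fun hc => Fin.succ_ne_zero i hc.1]
        simp
      simp only [Matrix.submatrix_apply, h1]
      simp
    · intro i j hij
      have hij : (j : ℕ) < i := hij
      have h1 : i.succ ≠ j.castSucc := by
        rw [Ne, Fin.ext_iff, Fin.val_succ, Fin.val_castSucc]; omega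
      have h2 : (i.succ : ℕ) ≠ j.castSucc + 1 := by rw [Fin.val_succ, Fin.val_castSucc]; omega
      rw [Matrix.submatrix_apply, Fin.succAbove_last, hM', if_neg h1, if_neg h2,
        if_neg fun hc => Fin.succ_ne_zero i hc.1]
      simp
  have hrow : ∀ j, M 0 j = (if j = 0 then t else 0) - (if j = Fin.last m then y else 0) := by
    intro j
    simp [hM, eq_comm]
  rw [Matrix.det_succ_row_zero]
  simp only [hrow, mul_sub, sub_mul, Finset.sum_sub_distrib, mul_ite, mul_zero, ite_mul, zero_mul,
    Finset.sum_ite_eq', Finset.mem_univ, if_true]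
  rw [h0, hl]
  have h1 : (-1 : S) ^ m * (-1) ^ m = 1 := by rw [← mul_pow]; simp
  simp only [Fin.val_zero, pow_zero, one_mul, Fin.val_last]
  linear_combination (-y) * h1

variable {F : Type*} [CommRing F] {κ : Type*} [Fintype κ] [DecidableEq κ]

/-- The matrix of an endomorphism which permutes `m + 1` copies of a module cyclically, the return
map to the first copy having matrix `A`. -/
def cyclicMatrix (m : ℕ) (A : Matrix κ κ F) : Matrix (Fin (m + 1) × κ) (Fin (m + 1) × κ) F :=
  Matrix.of fun p q => (if (p.1 : ℕ) = q.1 + 1 then (1 : Matrix κ κ F) p.2 q.2 else 0) +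
    (if p.1 = 0 ∧ q.1 = Fin.last m then A p.2 q.2 else 0)

/-- The determinant of `t - C` is computed by Silvester's theorem on block matrices with commuting
blocks: first over the ring generated by the return map, where `C` is a companion matrix. -/
theorem charpoly_cyclicMatrix (m : ℕ) (A : Matrix κ κ F) :
    (cyclicMatrix m A).charpoly = expand F (m + 1) A.charpoly := by
  let f : F[X][X] →+* Matrix κ κ F[X] := (aeval (A.map C) : F[X][X] →ₐ[F[X]] Matrix κ κ F[X])
  have hfC : ∀ p : F[X], f (C p) = algebraMap F[X] (Matrix κ κ F[X]) p := fun p => aeval_C _ p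
  have hfX : f X = A.map C := aeval_X _
  have h := Matrix.det_det (M := Matrix.of fun i j : Fin (m + 1) =>
    (if i = j then (C X : F[X][X]) else 0) - (if (i : ℕ) = j + 1 then 1 else 0) -
      (if i = 0 ∧ j = Fin.last m then X else 0)) f
  rw [det_sub_companion, map_sub, map_pow, hfC, hfX] at h
  have h1 : algebraMap F[X] (Matrix κ κ F[X]) X ^ (m + 1) - A.map C =
      (Matrix.charmatrix A).map (expand F (m + 1)) := by
    rw [← map_pow]
    ext1 a b
    rw [Matrix.sub_apply, Matrix.map_apply, Matrix.map_apply, Matrix.charmatrix_apply,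
      Matrix.algebraMap_matrix_apply, Matrix.diagonal_apply]
    split_ifs <;> simp
  rw [h1] at h
  have h2 : ((Matrix.charmatrix A).map (expand F (m + 1))).det =
      expand F (m + 1) A.charpoly := by
    rw [Matrix.charpoly, AlgHom.map_det]; rfl
  rw [← h2, h, Matrix.charpoly]
  congr 1
  ext1 p q
  obtain ⟨i, a⟩ := p
  obtain ⟨j, b⟩ := q
  change _ = f (_ - _ - _) a b
  rw [Matrix.charmatrix_apply, map_sub, map_sub, Matrix.sub_apply, Matrix.sub_apply,
    cyclicMatrix, Matrix.of_apply, Matrix.diagonal_apply]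
  have e1 : f (if i = j then (C X : F[X][X]) else 0) a b =
      if (i, a) = (j, b) then (X : F[X]) else 0 := by
    rw [apply_ite f, hfC, map_zero]
    by_cases hij : i = j <;> by_cases hab : a = b <;>
      simp [hij, hab, Matrix.algebraMap_matrix_apply]
  have e2 : f (if (i : ℕ) = j + 1 then (1 : F[X][X]) else 0) a b =
      C (if (i : ℕ) = j + 1 then (1 : Matrix κ κ F) a b else 0) := by
    rw [apply_ite f, map_one, map_zero]
    by_cases hij : (i : ℕ) = j + 1 <;> by_cases hab : a = b <;>
      simp [hij, hab, Matrix.one_apply]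
  have e3 : f (if i = 0 ∧ j = Fin.last m then (X : F[X][X]) else 0) a b =
      C (if i = 0 ∧ j = Fin.last m then A a b else 0) := by
    rw [apply_ite f, hfX, map_zero]
    by_cases hij : i = 0 ∧ j = Fin.last m <;> simp [hij]
  rw [e1, e2, e3, map_add, sub_sub]

theorem charpoly_blockDiagonal' {ι : Type*} [Fintype ι] [DecidableEq ι] {n : ι → Type*}
    [∀ i, Fintype (n i)] [∀ i, DecidableEq (n i)] (d : ∀ i, Matrix (n i) (n i) F) :
    (Matrix.blockDiagonal' d).charpoly = ∏ i, (d i).charpoly := by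
  let _ : LinearOrder ι := LinearOrder.lift' (Fintype.equivFin ι) (Fintype.equivFin ι).injective
  have htri : (Matrix.charmatrix (Matrix.blockDiagonal' d)).BlockTriangular
      (Sigma.fst : (Σ i, n i) → ι) := by
    rw [Matrix.charmatrix_blockTriangular_iff]
    rintro ⟨i, a⟩ ⟨j, b⟩ hij
    exact Matrix.blockDiagonal'_apply_ne d a b (ne_of_gt hij)
  have h := htri.det_fintype
  rw [Matrix.charpoly, h]
  refine Finset.prod_congr rfl fun i _ => ?_
  rw [← Matrix.charmatrix_toSquareBlock, ← Matrix.charpoly,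
    ← Matrix.charpoly_reindex (Equiv.sigmaSubtype i)]
  congr 1
  ext a b
  exact Matrix.blockDiagonal'_apply_eq d i a b

section Isometries

variable {V : Type*} [NormedAddCommGroup V] [InnerProductSpace ℝ V] [FiniteDimensional ℝ V]

/-- The characteristic polynomial of an isometry `g` for which the ambient space is the orthogonal
sum of the subspaces `g ^ i (U_s)`, `0 ≤ i ≤ m_s`, with `U_s` stable under `g ^ (m_s + 1)`, and of
a subspace `K^⊥`. Each `U_s` is given by an isometric embedding `f s`. -/
theorem isomCharpoly_eq_prod {ι : Type*} [Fintype ι] [DecidableEq ι] {r m : ι → ℕ}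
    (f : ∀ s, Eucl (r s) →ₗᵢ[ℝ] V) (g : V ≃ₗᵢ[ℝ] V) (u : ∀ s, Eucl (r s) →ₗ[ℝ] Eucl (r s))
    (hu : ∀ s x, (g ^ (m s + 1)) (f s x) = f s (u s x))
    (horth : ∀ s s' i i', i ≤ m s → i' ≤ m s' → (s ≠ s' ∨ i ≠ i') → ∀ x y,
      inner ℝ ((g ^ i) (f s x)) ((g ^ i') (f s' y)) = (0 : ℝ))
    (K : Submodule ℝ V) (hmem : ∀ s i x, (g ^ i) (f s x) ∈ K)
    (hspan : ∀ U : Submodule ℝ V, (∀ s i x, i ≤ m s → (g ^ i) (f s x) ∈ U) → K ≤ U)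
    {c : ℕ} (b : Module.Basis (Fin c) ℝ Kᗮ) (A : Matrix (Fin c) (Fin c) ℝ)
    (hA : ∀ i, g (b i : V) = ∑ k, A k i • (b k : V)) :
    isomCharpoly g = (∏ s, expand ℝ (m s + 1) (u s).charpoly) * A.charpoly := by
  classical
  let e : ∀ s, OrthonormalBasis (Fin (r s)) ℝ (Eucl (r s)) := fun s => EuclideanSpace.basisFun _ ℝ
  -- the basis made of the `g ^ i (e_a)`, for the canonical bases of the `U_s`, and of that of `K^⊥`
  let v : (Σ s, Fin (m s + 1) × Fin (r s)) → V := fun p => (g ^ (p.2.1 : ℕ)) (f p.1 (e p.1 p.2.2))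
  have hv : Orthonormal ℝ v := by
    constructor
    · rintro ⟨s, i, a⟩
      simp [v]
    · rintro ⟨s, i, a⟩ ⟨s', i', a'⟩ hne
      by_cases hs : s = s' ∧ (i : ℕ) = i'
      · obtain ⟨rfl, hi⟩ := hs
        obtain rfl := Fin.ext hi
        have ha : a ≠ a' := by rintro rfl; exact hne rfl
        change inner ℝ ((g ^ (i : ℕ)) (f s (e s a))) ((g ^ (i : ℕ)) (f s (e s a'))) = (0 : ℝ)
        rw [LinearIsometryEquiv.inner_map_map, LinearIsometry.inner_map_map]
        exact (e s).orthonormal.2 ha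
      · refine horth s s' i i' (by omega) (by omega) ?_ _ _
        by_contra! hc
        exact hs hc
  have hvK : Submodule.span ℝ (Set.range v) = K := by
    apply le_antisymm
    · rw [Submodule.span_le]
      rintro _ ⟨⟨s, i, a⟩, rfl⟩
      exact hmem s i _
    · refine hspan _ fun s i x hi => ?_
      rw [← (e s).sum_repr x, map_sum, map_sum]
      refine sum_mem fun a _ => ?_
      rw [map_smul, map_smul]
      exact Submodule.smul_mem _ _ (Submodule.subset_span ⟨⟨s, ⟨i, by omega⟩, a⟩, rfl⟩)
  let w : Fin c → V := fun i => b i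
  have hw : LinearIndependent ℝ w := b.linearIndependent.map' Kᗮ.subtype (Submodule.ker_subtype _)
  have hwK : Submodule.span ℝ (Set.range w) = Kᗮ := by
    have : Set.range w = Kᗮ.subtype '' Set.range b := by
      rw [← Set.range_comp]; rfl
    rw [this, Submodule.span_image, b.span_eq, Submodule.map_top, Submodule.range_subtype]
  have hli : LinearIndependent ℝ (Sum.elim v w) := by
    refine hv.linearIndependent.sum_type hw ?_
    rw [hvK, hwK]
    exact K.orthogonal_disjoint
  have htop : ⊤ ≤ Submodule.span ℝ (Set.range (Sum.elim v w)) := by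
    rw [Set.Sum.elim_range, Submodule.span_union, hvK, hwK,
      Submodule.sup_orthogonal_of_hasOrthogonalProjection]
  let B := Module.Basis.mk hli htop
  let D : Matrix (Σ s, Fin (m s + 1) × Fin (r s)) (Σ s, Fin (m s + 1) × Fin (r s)) ℝ :=
    Matrix.blockDiagonal' fun s =>
      cyclicMatrix (m s) (LinearMap.toMatrix (e s).toBasis (e s).toBasis (u s))
  have hg : (g.toLinearEquiv : V →ₗ[ℝ] V) = (Matrix.fromBlocks D 0 0 A).toLin B B := by
    refine B.ext fun p => ?_
    rw [Matrix.toLin_self, Fintype.sum_sum_type]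
    rcases p with ⟨s, i, a⟩ | k
    · simp only [Matrix.fromBlocks_apply₁₁, Matrix.fromBlocks_apply₂₁, Matrix.zero_apply, zero_smul,
        Finset.sum_const_zero, add_zero]
      have hB : ∀ q, B (Sum.inl q) = v q := fun q => by simp [B]
      simp only [hB]
      rw [Fintype.sum_sigma, Finset.sum_eq_single s]
      · simp only [D, Matrix.blockDiagonal'_apply_eq]
        rw [Fintype.sum_prod_type]
        have hstep : g ((g ^ (i : ℕ)) (f s (e s a))) = (g ^ ((i : ℕ) + 1)) (f s (e s a)) := by
          rw [pow_succ']; rfl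
        refine hstep.trans ?_
        by_cases hi : i = Fin.last (m s)
        · -- the last copy of `U_s` is sent back to the first one by the return map
          rw [Finset.sum_eq_single 0]
          · rw [hi, Fin.val_last, hu, ← (e s).toBasis.sum_repr (u s (e s a)), map_sum]
            refine Finset.sum_congr rfl fun a' _ => ?_
            simp [v, cyclicMatrix, LinearMap.toMatrix_apply]
          · intro j _ hj
            refine Finset.sum_eq_zero fun a' _ => ?_
            have h1 : (j : ℕ) ≠ m s + 1 := by omega
            simp [cyclicMatrix, hi, hj, h1]
          · simp
        · have hlt : (i : ℕ) + 1 < m s + 1 := by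
            have := Fin.val_lt_last hi
            omega
          rw [Finset.sum_eq_single ⟨(i : ℕ) + 1, hlt⟩, Finset.sum_eq_single a]
          · simp [v, cyclicMatrix, hi]
          · intro a' _ ha'
            simp [cyclicMatrix, hi, ha']
          · simp
          · intro j _ hj
            refine Finset.sum_eq_zero fun a' _ => ?_
            have h1 : (j : ℕ) ≠ i + 1 := fun hc => hj (Fin.ext hc)
            simp [cyclicMatrix, hi, h1]
          · simp
      · intro s' _ hs'
        refine Finset.sum_eq_zero fun q _ => ?_
        simp only [D]
        rw [Matrix.blockDiagonal'_apply_ne _ _ _ hs', zero_smul]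
      · simp
    · simp only [Matrix.fromBlocks_apply₁₂, Matrix.fromBlocks_apply₂₂, Matrix.zero_apply, zero_smul,
        Finset.sum_const_zero, zero_add]
      have hB : ∀ q, B (Sum.inr q) = w q := fun q => by simp [B]
      simp only [hB]
      exact hA k
  rw [isomCharpoly, hg, Matrix.charpoly_toLin, Matrix.charpoly_fromBlocks_zero₁₂,
    charpoly_blockDiagonal']
  congr 1
  refine Finset.prod_congr rfl fun s _ => ?_
  rw [charpoly_cyclicMatrix, LinearMap.charpoly_toMatrix]

end Isometries

end CyclicBlocks

/-! ### Products of cyclotomic polynomials -/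

section Cyclotomic

/-- A monic divisor of a product of cyclotomic polynomials is a product of cyclotomic
polynomials. -/
theorem monic_dvd_prod_cyclotomic (s : Multiset ℕ) (hs : ∀ m ∈ s, 0 < m) :
    ∀ q : ℤ[X], q.Monic → q ∣ (s.map fun m => cyclotomic m ℤ).prod →
      ∃ t : Multiset ℕ, (∀ m ∈ t, 0 < m) ∧ q = (t.map fun m => cyclotomic m ℤ).prod := by
  induction s using Multiset.induction_on with
  | empty =>
    intro q hq hdvd
    refine ⟨0, by simp, ?_⟩
    rw [Multiset.map_zero, Multiset.prod_zero] at hdvd ⊢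
    exact hq.eq_one_of_isUnit (isUnit_of_dvd_one hdvd)
  | cons a s ih =>
    intro q hq hdvd
    have hs' : ∀ m ∈ s, 0 < m := fun m hm => hs m (Multiset.mem_cons_of_mem hm)
    rw [Multiset.map_cons, Multiset.prod_cons] at hdvd
    have hp : Prime (cyclotomic a ℤ) :=
      (cyclotomic.irreducible (hs a (Multiset.mem_cons_self a s))).prime
    rcases hp.left_dvd_or_dvd_right_of_dvd_mul hdvd with h1 | h1
    · obtain ⟨q', rfl⟩ := h1
      have hq' : q'.Monic := (cyclotomic.monic a ℤ).of_mul_monic_left hq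
      obtain ⟨t, ht, rfl⟩ := ih hs' q' hq' ((mul_dvd_mul_iff_left hp.ne_zero).1 hdvd)
      refine ⟨a ::ₘ t, ?_, by simp⟩
      intro m hm
      rcases Multiset.mem_cons.1 hm with rfl | h2
      exacts [hs m (Multiset.mem_cons_self m s), ht m h2]
    · exact ih hs' q hq h1

theorem Car.monic {n : ℕ} {P : ℤ[X]} (hP : P ∈ Car n) : P.Monic := by
  obtain ⟨_, s, _, rfl⟩ := hP
  exact monic_multiset_prod_of_monic _ _ fun m _ => cyclotomic.monic m ℤ

/-- The characteristic polynomial of an integral matrix of finite order is a product of cyclotomic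
polynomials: it divides the determinant of `X ^ N - M ^ N = X ^ N - 1`. -/
theorem charpoly_mem_Car {k : ℕ} (M : Matrix (Fin k) (Fin k) ℤ) {N : ℕ} (hN : 0 < N)
    (hM : M ^ N = 1) : M.charpoly ∈ Car k := by
  refine ⟨by simp [Matrix.charpoly_natDegree_eq_dim], ?_⟩
  refine monic_dvd_prod_cyclotomic (k • N.divisors.val) ?_ _ M.charpoly_monic ?_
  · intro m hm
    have := Multiset.mem_of_mem_nsmul hm
    exact Nat.pos_of_mem_divisors this
  have h1 : ((k • N.divisors.val).map fun m => cyclotomic m ℤ).prod = (X ^ N - 1 : ℤ[X]) ^ k := by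
    rw [Multiset.map_nsmul, Multiset.prod_nsmul, ← prod_cyclotomic_eq_X_pow_sub_one hN]
    rfl
  rw [h1]
  have hcomm : Commute (Matrix.scalar (Fin k) (X : ℤ[X])) (M.map C) :=
    Matrix.scalar_commute _ (fun r => Commute.all _ _) _
  have h2 := hcomm.sub_dvd_pow_sub_pow N
  have h3 : (M.map C : Matrix (Fin k) (Fin k) ℤ[X]) ^ N = 1 := by
    rw [← Matrix.map_pow, hM]; simp
  have h4 : Matrix.scalar (Fin k) (X : ℤ[X]) ^ N - (M.map C) ^ N =
      Matrix.scalar (Fin k) (X ^ N - 1 : ℤ[X]) := by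
    rw [h3, map_sub, map_pow, map_one]
  obtain ⟨D, hD⟩ := h2
  rw [h4] at hD
  refine ⟨D.det, ?_⟩
  have h5 := congrArg Matrix.det hD
  rw [Matrix.det_mul] at h5
  simpa [Matrix.charpoly, Matrix.charmatrix] using h5

/-- The characteristic polynomial of an isometry of finite order of a lattice is a product of
cyclotomic polynomials. -/
theorem exists_mem_Car {V : Type*} [NormedAddCommGroup V] [InnerProductSpace ℝ V]
    [FiniteDimensional ℝ V] (L : Submodule ℤ V) [DiscreteTopology L] [IsZLattice ℝ L]
    {g : V ≃ₗᵢ[ℝ] V} (hg : g ∈ orthogonalGroup L) (hfin : IsOfFinOrder g) :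
    ∃ P ∈ Car (Module.finrank ℝ V), P.map (Int.castRingHom ℝ) = isomCharpoly g := by
  have hgL : ∀ x ∈ L, g x ∈ L := by
    intro x hx
    have h4 : g '' (L : Set V) = L := hg
    have h3 : g x ∈ g '' (L : Set V) := ⟨x, hx, rfl⟩
    rwa [h4] at h3
  have := ZLattice.module_free ℝ L
  have := ZLattice.module_finite ℝ L
  let b : Module.Basis (Fin (Module.finrank ℝ V)) ℤ L :=
    Module.finBasisOfFinrankEq ℤ L (ZLattice.rank ℝ L)
  let B := b.ofZLatticeBasis ℝ L
  let G : L →ₗ[ℤ] L := ((g.toLinearEquiv : V →ₗ[ℝ] V).restrictScalars ℤ).restrict hgL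
  let M := LinearMap.toMatrix b b G
  obtain ⟨N, hN, hgN⟩ := isOfFinOrder_iff_pow_eq_one.1 hfin
  have hGpow : ∀ k (x : L), ((G ^ k) x : V) = (g ^ k) x := by
    intro k
    induction k with
    | zero => intro x; rfl
    | succ k ih => intro x; rw [pow_succ', pow_succ']; exact congrArg g (ih x)
  have hMN : M ^ N = 1 := by
    have hG : G ^ N = 1 := by
      ext x
      rw [hGpow, hgN]; rfl
    change LinearMap.toMatrix b b G ^ N = 1
    rw [LinearMap.toMatrix_pow, hG, LinearMap.toMatrix_one]
  refine ⟨M.charpoly, charpoly_mem_Car M hN hMN, ?_⟩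
  rw [isomCharpoly, ← Matrix.charpoly_map, ← LinearMap.charpoly_toMatrix _ B]
  congr 1
  ext i j
  rw [LinearMap.toMatrix_apply, Matrix.map_apply]
  change _ = B.repr (g (B j)) i
  have h1 : g (B j) = (G (b j) : V) := by
    rw [b.ofZLatticeBasis_apply ℝ L]; rfl
  rw [h1, b.ofZLatticeBasis_repr_apply ℝ L, ← LinearMap.toMatrix_apply]
  rfl

end Cyclotomic

/-! ### Finiteness of the orthogonal group of a lattice -/

section LatticeFiniteness

variable {V : Type*} [NormedAddCommGroup V] [InnerProductSpace ℝ V]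

theorem map_mem_of_mem_orthogonalGroup {L : Submodule ℤ V} {g : V ≃ₗᵢ[ℝ] V}
    (hg : g ∈ orthogonalGroup L) : ∀ x ∈ L, g x ∈ L := by
  intro x hx
  have h4 : g '' (L : Set V) = L := hg
  have h3 : g x ∈ g '' (L : Set V) := ⟨x, hx, rfl⟩
  rwa [h4] at h3

theorem mem_orthogonalGroup_of_forall {L : Submodule ℤ V} {g : V ≃ₗᵢ[ℝ] V}
    (h1 : ∀ x ∈ L, g x ∈ L) (h2 : ∀ x ∈ L, g⁻¹ x ∈ L) : g ∈ orthogonalGroup L := by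
  refine Set.Subset.antisymm (by rintro _ ⟨x, hx, rfl⟩; exact h1 x hx) fun x hx => ?_
  exact ⟨g⁻¹ x, h2 x hx, g.apply_symm_apply x⟩

theorem weylGroup_le_orthogonalGroup {L : Submodule ℤ V} (hL : IsIntegralLattice L) :
    weylGroup L ≤ orthogonalGroup L := by
  rw [weylGroup, Subgroup.closure_le]
  rintro _ ⟨α, ⟨hα, h2⟩, rfl⟩
  have key : ∀ x ∈ L, refl α x ∈ L := by
    intro x hx
    obtain ⟨k, hk⟩ := hL α hα x hx
    rw [refl_apply h2, hk, Int.cast_smul_eq_zsmul]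
    exact sub_mem hx (L.smul_mem k hα)
  exact mem_orthogonalGroup_of_forall key (by rwa [refl_inv])

/-- An isometry which fixes a lattice pointwise is the identity. -/
theorem eq_one_of_forall_mem_lattice [FiniteDimensional ℝ V] {L : Submodule ℤ V}
    [DiscreteTopology L] [IsZLattice ℝ L] {g : V ≃ₗᵢ[ℝ] V} (hg : ∀ x ∈ L, g x = x) : g = 1 := by
  ext y
  have hy : y ∈ Submodule.span ℝ (L : Set V) := by
    rw [IsZLattice.span_top]; trivial
  change g y = y
  induction hy using Submodule.span_induction with
  | mem y hy => exact hg y hy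
  | zero => simp
  | add y z _ _ hy hz => rw [map_add, hy, hz]
  | smul a y _ hy => rw [map_smul, hy]

variable [FiniteDimensional ℝ V] (L : Submodule ℤ V) [DiscreteTopology L] [IsZLattice ℝ L]

theorem finite_lattice_norm_le (c : ℝ) : {x | x ∈ L ∧ ‖x‖ ≤ c}.Finite := by
  have := ZLattice.module_free ℝ L
  have := ZLattice.module_finite ℝ L
  let b := Module.Free.chooseBasis ℤ L
  have h1 := ZSpan.setFinite_inter (b.ofZLatticeBasis ℝ L) (s := Metric.closedBall 0 c)
    Metric.isBounded_closedBall
  refine h1.subset ?_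
  rintro x ⟨hx, hc⟩
  refine ⟨by simpa using hc, ?_⟩
  rw [b.ofZLatticeBasis_span ℝ L]
  exact hx

/-- The orthogonal group of a lattice is finite, because an isometry is determined by the images
of the members of a basis, and there are finitely many vectors of a given length. -/
theorem finite_orthogonalGroup : Finite (orthogonalGroup L) := by
  have := ZLattice.module_free ℝ L
  have := ZLattice.module_finite ℝ L
  let b : Module.Basis (Fin (Module.finrank ℝ V)) ℤ L :=
    Module.finBasisOfFinrankEq ℤ L (ZLattice.rank ℝ L)
  have hfin : ∀ i, Finite {x | x ∈ L ∧ ‖x‖ ≤ ‖(b i : V)‖} := fun i =>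
    (finite_lattice_norm_le L _).to_subtype
  let F : orthogonalGroup L → ∀ i, {x | x ∈ L ∧ ‖x‖ ≤ ‖(b i : V)‖} := fun g i =>
    ⟨g.1 (b i), map_mem_of_mem_orthogonalGroup g.2 _ (b i).2, by rw [g.1.norm_map]⟩
  refine Finite.of_injective F fun g g' hgg' => ?_
  have h1 : ∀ i, g.1 (b i) = g'.1 (b i) := fun i =>
    congrArg Subtype.val (congrFun hgg' i)
  apply Subtype.ext
  apply LinearIsometryEquiv.toLinearEquiv_injective
  refine (b.ofZLatticeBasis ℝ L).ext' fun i => ?_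
  rw [b.ofZLatticeBasis_apply ℝ L]
  exact h1 i

theorem finite_roots : (roots L).Finite := by
  refine (finite_lattice_norm_le L (Real.sqrt 2)).subset ?_
  rintro α ⟨hα, h2⟩
  refine ⟨hα, ?_⟩
  rw [real_inner_self_eq_norm_sq] at h2
  exact (Real.sqrt_eq_iff_mul_self_eq (by norm_num) (norm_nonneg α)).2 (by rw [← h2]; ring) |>.ge

theorem isRootSet_roots (hL : IsIntegralLattice L) : IsRootSet (roots L) where
  finite := finite_roots L
  norm_two := fun _ hα => hα.2
  integral := fun α hα β hβ => hL α hα.1 β hβ.1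
  refl_mem := fun α hα => map_roots
    (weylGroup_le_orthogonalGroup hL (Subgroup.subset_closure ⟨α, hα, rfl⟩))

end LatticeFiniteness

/-! ### The canonical vectors of a lattice -/

section CanonicalVectors

variable {V : Type*} [NormedAddCommGroup V] [InnerProductSpace ℝ V]

theorem map_minimalVectors {L : Submodule ℤ V} {g : V ≃ₗᵢ[ℝ] V} (hg : g ∈ orthogonalGroup L) :
    ∀ x ∈ minimalVectors L, g x ∈ minimalVectors L := by
  rintro x ⟨hx, h0, hmin⟩
  refine ⟨map_mem_of_mem_orthogonalGroup hg x hx, by simpa using h0, fun y hy hy0 => ?_⟩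
  rw [g.norm_map]
  exact hmin y hy hy0

theorem orthogonalGroup_le_orthogonalOfMinimal (L : Submodule ℤ V) :
    orthogonalGroup L ≤ orthogonalGroup (orthogonalOfMinimal L) := by
  have key : ∀ g ∈ orthogonalGroup L, ∀ x ∈ orthogonalOfMinimal L,
      g x ∈ orthogonalOfMinimal L := by
    rintro g hg x ⟨hx, hx'⟩
    refine ⟨map_mem_of_mem_orthogonalGroup hg x hx, fun v hv => ?_⟩
    rw [← g.apply_symm_apply v, g.inner_map_map]
    exact hx' _ (map_minimalVectors (inv_mem hg) v hv)
  exact fun g hg => mem_orthogonalGroup_of_forall (key g hg) (key _ (inv_mem hg))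

theorem orthogonalGroup_le_iterate (L : Submodule ℤ V) (k : ℕ) :
    orthogonalGroup L ≤ orthogonalGroup (orthogonalOfMinimal^[k] L) := by
  induction k with
  | zero => exact le_rfl
  | succ k ih =>
    rw [Function.iterate_succ_apply']
    exact ih.trans (orthogonalGroup_le_orthogonalOfMinimal _)

theorem map_canonicalVectors {L : Submodule ℤ V} {g : V ≃ₗᵢ[ℝ] V} (hg : g ∈ orthogonalGroup L) :
    ∀ x ∈ canonicalVectors L, g x ∈ canonicalVectors L := by
  intro x hx
  obtain ⟨k, hk⟩ := Set.mem_iUnion.1 hx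
  exact Set.mem_iUnion.2 ⟨k, map_minimalVectors (orthogonalGroup_le_iterate L k hg) x hk⟩

theorem iterate_orthogonalOfMinimal_anti (L : Submodule ℤ V) :
    Antitone fun k => orthogonalOfMinimal^[k] L := by
  refine antitone_nat_of_succ_le fun k => ?_
  rw [Function.iterate_succ_apply']
  exact fun x hx => hx.1

/-- A nonzero sublattice has minimal vectors. -/
theorem minimalVectors_nonempty [FiniteDimensional ℝ V] (L : Submodule ℤ V) [DiscreteTopology L]
    [IsZLattice ℝ L] {M : Submodule ℤ V} (hML : M ≤ L) {z : V} (hz : z ∈ M) (hz0 : z ≠ 0) :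
    (minimalVectors M).Nonempty := by
  have hfin : {x | x ∈ M ∧ x ≠ 0 ∧ ‖x‖ ≤ ‖z‖}.Finite :=
    (finite_lattice_norm_le L ‖z‖).subset fun x hx => ⟨hML hx.1, hx.2.2⟩
  obtain ⟨v, hv, hmin⟩ := hfin.exists_minimalFor (fun x => ‖x‖) _ ⟨z, hz, hz0, le_rfl⟩
  refine ⟨v, hv.1, hv.2.1, fun y hy hy0 => ?_⟩
  rcases le_total ‖y‖ ‖z‖ with h1 | h1
  · rcases le_total ‖v‖ ‖y‖ with h2 | h2
    exacts [h2, hmin ⟨hy, hy0, h1⟩ h2]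
  · exact hv.2.2.trans h1

/-- A lattice vector orthogonal to all the canonical vectors vanishes: otherwise none of the
successive orthogonals would be zero, and minimal vectors of these would form an infinite
orthogonal family. -/
theorem eq_zero_of_orthogonal_canonicalVectors [FiniteDimensional ℝ V] (L : Submodule ℤ V)
    [DiscreteTopology L] [IsZLattice ℝ L] {z : V} (hz : z ∈ L)
    (horth : ∀ v ∈ canonicalVectors L, inner ℝ v z = (0 : ℝ)) : z = 0 := by
  by_contra hz0
  have hmem : ∀ k, z ∈ orthogonalOfMinimal^[k] L := by
    intro k
    induction k with
    | zero => exact hz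
    | succ k ih =>
      rw [Function.iterate_succ_apply']
      exact ⟨ih, fun v hv => horth v (Set.mem_iUnion.2 ⟨k, hv⟩)⟩
  have hne : ∀ k, (minimalVectors (orthogonalOfMinimal^[k] L)).Nonempty := fun k =>
    minimalVectors_nonempty L (iterate_orthogonalOfMinimal_anti L (Nat.zero_le k)) (hmem k) hz0
  choose v hv using hne
  have hlt : ∀ i j, i < j → inner ℝ (v i) (v j) = (0 : ℝ) := by
    intro i j hij
    have h1 := iterate_orthogonalOfMinimal_anti L (Nat.succ_le_of_lt hij) (hv j).1
    simp only [Function.iterate_succ_apply'] at h1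
    exact h1.2 _ (hv i)
  have hli : LinearIndependent ℝ v := by
    refine linearIndependent_of_ne_zero_of_inner_eq_zero (fun k => (hv k).2.1) fun i j hij => ?_
    rcases lt_or_gt_of_ne hij with h1 | h1
    · exact hlt i j h1
    · rw [real_inner_comm]; exact hlt j i h1
  have hfin : Finite ℕ := hli.finite
  exact not_finite_iff_infinite.2 inferInstance hfin

/-- The orthogonal group acts faithfully on the canonical vectors: if `γ` fixes them, then `γ x - x`
is orthogonal to all of them for every `x ∈ L`. -/
theorem eq_one_of_forall_canonicalVectors [FiniteDimensional ℝ V] (L : Submodule ℤ V)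
    [DiscreteTopology L] [IsZLattice ℝ L] {γ : V ≃ₗᵢ[ℝ] V} (hγ : γ ∈ orthogonalGroup L)
    (hfix : ∀ x ∈ canonicalVectors L, γ x = x) : γ = 1 := by
  refine eq_one_of_forall_mem_lattice (L := L) fun x hx => ?_
  rw [← sub_eq_zero]
  refine eq_zero_of_orthogonal_canonicalVectors L
    (sub_mem (map_mem_of_mem_orthogonalGroup hγ x hx) hx) fun v hv => ?_
  rw [inner_sub_right]
  nth_rewrite 1 [← hfix v hv]
  rw [γ.inner_map_map, sub_self]

end CanonicalVectors

/-! ### Irreducible components and isometric embeddings -/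

section Components

variable {V : Type*} [NormedAddCommGroup V] [InnerProductSpace ℝ V]

theorem isIrreducible_of_mem {R S : Set V} (hS : S ∈ irreducibleComponents R) :
    IsIrreducible S := ⟨hS.2.1, hS.2.2.2⟩

theorem mem_component_of_inner_ne_zero {R S : Set V}
    (hS : S ∈ irreducibleComponents R) {α β : V} (hα : α ∈ S) (hβ : β ∈ R)
    (hne : inner ℝ α β ≠ (0 : ℝ)) : β ∈ S := by
  by_contra hc
  exact hne (hS.2.2.1 α hα β ⟨hβ, hc⟩)

theorem IsRootSet.component {R S : Set V} (h : IsRootSet R) (hS : S ∈ irreducibleComponents R) :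
    IsRootSet S where
  finite := h.finite.subset hS.1
  norm_two := fun α hα => h.norm_two α (hS.1 hα)
  integral := fun α hα β hβ => h.integral α (hS.1 hα) β (hS.1 hβ)
  refl_mem := by
    intro α hα β hβ
    by_cases h0 : inner ℝ α β = (0 : ℝ)
    · rwa [refl_apply (h.norm_two α (hS.1 hα)), h0, zero_smul, sub_zero]
    · refine mem_component_of_inner_ne_zero hS hα (h.refl_mem α (hS.1 hα) β (hS.1 hβ)) ?_
      rw [refl_apply (h.norm_two α (hS.1 hα)), inner_sub_right, inner_smul_right,
        h.norm_two α (hS.1 hα)]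
      intro hc
      apply h0
      linarith

variable {U : Type*} [NormedAddCommGroup U] [InnerProductSpace ℝ U]

theorem refl_map (f : U →ₗᵢ[ℝ] V) {α : U} (hα : inner ℝ α α = (2 : ℝ)) (x : U) :
    f (refl α x) = refl (f α) (f x) := by
  rw [refl_apply hα, refl_apply (by rwa [f.inner_map_map]), map_sub, map_smul, f.inner_map_map]

theorem IsRootSet.comap {S : Set V} (h : IsRootSet S) (f : U →ₗᵢ[ℝ] V) {T : Set U}
    (hT : f '' T = S) : IsRootSet T := by
  have hmem : ∀ {x}, x ∈ T ↔ f x ∈ S := by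
    intro x; rw [← hT, f.injective.mem_set_image]
  have h2 : ∀ α ∈ T, inner ℝ α α = (2 : ℝ) := fun α hα => by
    rw [← f.inner_map_map]; exact h.norm_two _ (hmem.1 hα)
  exact
  { finite := Set.Finite.of_finite_image (hT ▸ h.finite) f.injective.injOn
    norm_two := h2
    integral := fun α hα β hβ => by
      rw [← f.inner_map_map]; exact h.integral _ (hmem.1 hα) _ (hmem.1 hβ)
    refl_mem := fun α hα β hβ => by
      rw [hmem, refl_map f (h2 α hα)]
      exact h.refl_mem _ (hmem.1 hα) _ (hmem.1 hβ) }

theorem IsIrreducible.comap {S : Set V} (h : IsIrreducible S) (f : U →ₗᵢ[ℝ] V) {T : Set U}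
    (hT : f '' T = S) : IsIrreducible T := by
  subst hT
  refine ⟨Set.image_nonempty.1 h.1, fun A hA hne horth => ?_⟩
  refine f.injective.image_injective (h.2 (f '' A) (Set.image_mono hA) (hne.image f) ?_)
  rintro _ ⟨a, ha, rfl⟩ _ ⟨⟨b, hb, rfl⟩, hb'⟩
  rw [f.inner_map_map]
  exact horth a ha b ⟨hb, fun hc => hb' ⟨b, hc, rfl⟩⟩

theorem span_model_eq_top {S : Set V} [FiniteDimensional ℝ U] (f : U →ₗᵢ[ℝ] V) {T : Set U}
    (hT : f '' T = S) (hrank : Module.finrank ℝ U = rank S) : Submodule.span ℝ T = ⊤ := by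
  apply Submodule.eq_top_of_finrank_eq
  rw [hrank, rank, ← hT, show (f '' T) = (f.toLinearMap '' T) from rfl, ← Submodule.map_span]
  exact (Submodule.equivMapOfInjective f.toLinearMap f.injective _).finrank_eq

end Components

/-! ### The stabilizer of the Weyl vector as a group of permutations -/

section Runs

variable {n : ℕ} {L : Submodule ℤ (Eucl n)}

theorem RunB1.exists_isRegular (x : RunB1 L) (hR : IsRootSet (roots L)) :
    ∃ φ, IsRegular (roots L) φ ∧ (x.posRoots : Set (Eucl n)) = CharMass.posRoots (roots L) φ := by
  obtain ⟨φ, h1, h2⟩ := x.isPositive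
  exact ⟨φ, { toIsRootSet := hR, ne_zero := h1 }, h2⟩

/-- The stabilizer of the Weyl vector consists of the elements of `O(L)` which permute the positive
roots. -/
theorem mem_orthogonalStabilizer_iff {ρ : Eucl n} {P : Finset (Eucl n)}
    {φ : Eucl n →ₗ[ℝ] ℝ} (h : IsRegular (roots L) φ)
    (hP : (P : Set (Eucl n)) = posRoots (roots L) φ) (hρ : ρ = weylVector P)
    {γ : Eucl n ≃ₗᵢ[ℝ] Eucl n} :
    γ ∈ orthogonalStabilizer L ρ ↔ γ ∈ orthogonalGroup L ∧ γ ∈ diagramGroup (roots L) φ := by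
  subst hρ
  refine and_congr_right fun hγ => ?_
  rw [mem_diagramGroup h, h.apply_weylVector_eq_iff hP (map_roots hγ)]

variable [DiscreteTopology L] [IsZLattice ℝ L]

theorem nonempty_runB1 (hL : IsIntegralLattice L) : Nonempty (RunB1 L) := by
  have hR := isRootSet_roots L hL
  have := hR.finite.to_subtype
  obtain ⟨φ, hφ⟩ := Module.exists_dual_forall_apply_ne_zero (K := ℝ)
    (fun α : roots L => (α : Eucl n)) fun α => hR.ne_zero' α.2
  have hfin : {α | α ∈ roots L ∧ 0 < φ α}.Finite := hR.finite.subset fun x hx => hx.1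
  exact ⟨⟨hfin.toFinset, φ, fun α hα => hφ ⟨α, hα⟩, hfin.coe_toFinset⟩⟩

omit [DiscreteTopology L] [IsZLattice ℝ L] in
theorem orthogonalStabilizer_le (ρ : Eucl n) : orthogonalStabilizer L ρ ≤ orthogonalGroup L :=
  fun _ h => h.1

theorem finite_orthogonalStabilizer (ρ : Eucl n) : Finite (orthogonalStabilizer L ρ) := by
  have := finite_orthogonalGroup L
  exact Finite.of_injective _ (Subgroup.inclusion_injective (orthogonalStabilizer_le ρ))

theorem RunB1.exists_runB2 (x : RunB1 L) : ∃ y : RunB2 L, y.toRunB1 = x := by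
  have := finite_orthogonalStabilizer (L := L) x.ρ
  have hfin : (orthogonalStabilizer L x.ρ : Set (Eucl n ≃ₗᵢ[ℝ] Eucl n)).Finite :=
    Set.toFinite _
  exact ⟨⟨x, hfin.toFinset, by rw [hfin.coe_toFinset, Subgroup.closure_eq]⟩, rfl⟩

omit [DiscreteTopology L] [IsZLattice ℝ L] in
/-- The permutations in the group of step B3 are those induced by the elements of `O(L)_ρ`. -/
theorem RunB2.exists_of_mem_permGroup (x : RunB2 L) {p : Equiv.Perm (canonicalVectors L)}
    (hp : p ∈ x.permGroup) :
    ∃ γ ∈ orthogonalStabilizer L x.ρ, ∀ v, (p v : Eucl n) = γ v := by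
  induction hp using Subgroup.closure_induction with
  | mem p hp =>
    obtain ⟨g, hg, h⟩ := hp
    refine ⟨g, ?_, h⟩
    rw [← x.closure_gens]
    exact Subgroup.subset_closure hg
  | one => exact ⟨1, one_mem _, fun v => rfl⟩
  | mul p q _ _ hp hq =>
    obtain ⟨g, hg, h⟩ := hp
    obtain ⟨g', hg', h'⟩ := hq
    refine ⟨g * g', mul_mem hg hg', fun v => ?_⟩
    rw [Equiv.Perm.mul_apply, h, h']; rfl
  | inv p _ hp =>
    obtain ⟨g, hg, h⟩ := hp
    refine ⟨g⁻¹, inv_mem hg, fun v => ?_⟩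
    have h1 := h (p⁻¹ v)
    rw [show p (p⁻¹ v) = v from p.apply_symm_apply v] at h1
    rw [h1]
    exact (g.symm_apply_apply _).symm

/-- The permutation of the canonical vectors induced by an element of `O(L)`. -/
def canonicalPerm {γ : Eucl n ≃ₗᵢ[ℝ] Eucl n} (hγ : γ ∈ orthogonalGroup L) :
    Equiv.Perm (canonicalVectors L) where
  toFun v := ⟨γ v, map_canonicalVectors hγ v v.2⟩
  invFun v := ⟨γ⁻¹ v, map_canonicalVectors (inv_mem hγ) v v.2⟩
  left_inv v := Subtype.ext (γ.symm_apply_apply v)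
  right_inv v := Subtype.ext (γ.apply_symm_apply v)

omit [DiscreteTopology L] [IsZLattice ℝ L] in
theorem RunB2.canonicalPerm_mem (x : RunB2 L) {γ : Eucl n ≃ₗᵢ[ℝ] Eucl n}
    (hγ : γ ∈ orthogonalStabilizer L x.ρ) :
    canonicalPerm (orthogonalStabilizer_le _ hγ) ∈ x.permGroup := by
  have key : ∀ g ∈ Subgroup.closure (x.gens : Set (Eucl n ≃ₗᵢ[ℝ] Eucl n)),
      ∃ p ∈ x.permGroup, ∀ v, (p v : Eucl n) = g v := by
    intro g hg
    induction hg using Subgroup.closure_induction with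
    | mem g hg =>
      have hg' : g ∈ orthogonalStabilizer L x.ρ := by
        rw [← x.closure_gens]; exact Subgroup.subset_closure hg
      exact ⟨canonicalPerm (orthogonalStabilizer_le _ hg'),
        Subgroup.subset_closure ⟨g, hg, fun v => rfl⟩, fun v => rfl⟩
    | one => exact ⟨1, one_mem _, fun v => rfl⟩
    | mul g g' _ _ hg hg' =>
      obtain ⟨p, hp, h⟩ := hg
      obtain ⟨q, hq, h'⟩ := hg'
      refine ⟨p * q, mul_mem hp hq, fun v => ?_⟩
      rw [Equiv.Perm.mul_apply, h, h']; rfl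
    | inv g _ hg =>
      obtain ⟨p, hp, h⟩ := hg
      refine ⟨p⁻¹, inv_mem hp, fun v => ?_⟩
      have h1 := h (p⁻¹ v)
      rw [show p (p⁻¹ v) = v from p.apply_symm_apply v] at h1
      rw [h1]
      exact (g.symm_apply_apply _).symm
  obtain ⟨p, hp, h⟩ := key γ (by rwa [x.closure_gens])
  have : canonicalPerm (orthogonalStabilizer_le _ hγ) = p := by
    ext1 v
    exact Subtype.ext (h v).symm
  rwa [this]

/-- The group of permutations of step B3 is a faithful image of `O(L)_ρ`. -/
def RunB2.permGroupEquiv (x : RunB2 L) : orthogonalStabilizer L x.ρ ≃* x.permGroup :=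
  MulEquiv.ofBijective
    (MonoidHom.mk' (fun γ => ⟨canonicalPerm (orthogonalStabilizer_le _ γ.2),
      x.canonicalPerm_mem γ.2⟩) fun _ _ => rfl) (by
    constructor
    · rw [injective_iff_map_eq_one]
      intro γ hγ
      refine Subtype.ext (eq_one_of_forall_canonicalVectors L (orthogonalStabilizer_le _ γ.2) ?_)
      intro v hv
      have h1 := Equiv.ext_iff.1 (congrArg Subtype.val hγ) ⟨v, hv⟩
      exact congrArg Subtype.val h1
    · rintro ⟨p, hp⟩
      obtain ⟨γ, hγ, h⟩ := x.exists_of_mem_permGroup hp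
      refine ⟨⟨γ, hγ⟩, Subtype.ext ?_⟩
      ext1 v
      exact Subtype.ext (h v).symm)

theorem RunB2.permGroupEquiv_apply (x : RunB2 L) (γ : orthogonalStabilizer L x.ρ)
    (v : canonicalVectors L) :
    (((x.permGroupEquiv γ : Equiv.Perm (canonicalVectors L)) v : canonicalVectors L) : Eucl n) =
      γ.1 v := rfl

theorem RunB2.exists_runB4 (x : RunB2 L) : ∃ y : RunB4 L, y.toRunB2 = x := by
  have := finite_orthogonalStabilizer (L := L) x.ρ
  have : Finite x.permGroup := Finite.of_equiv _ x.permGroupEquiv.toEquiv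
  have : Finite (ConjClasses x.permGroup) := Finite.of_surjective _ ConjClasses.mk_surjective
  obtain ⟨k, ⟨e⟩⟩ := Finite.exists_equiv_fin (ConjClasses x.permGroup)
  have hr : ∀ j, ConjClasses.mk (Quotient.out (e.symm j)) = e.symm j := fun j => Quotient.out_eq _
  refine ⟨{ toRunB2 := x
            numClasses := k
            r := fun j => Quotient.out (e.symm j)
            r_bijective := ?_
            m := _
            m_eq := fun j => rfl
            γ := fun j => (x.permGroupEquiv.symm (Quotient.out (e.symm j)) : _)
            γ_mem := fun j => (x.permGroupEquiv.symm _).2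
            γ_eq := fun j v => ?_ }, rfl⟩
  · simp only [hr]
    exact e.symm.bijective
  · rw [← x.permGroupEquiv_apply, MulEquiv.apply_symm_apply]

theorem RunB4.exists_runB5 (x : RunB4 L) (hL : IsIntegralLattice L) :
    ∃ y : RunB5 L, y.toRunB4 = x := by
  have hR := isRootSet_roots L hL
  have hfin : (irreducibleComponents (roots L)).Finite :=
    hR.finite.finite_subsets.subset fun S hS => hS.1
  let f : ∀ S : Set (Eucl n), Eucl (rank S) →ₗᵢ[ℝ] Eucl n := fun S =>
    (Submodule.span ℝ S).subtypeₗᵢ.comp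
      (stdOrthonormalBasis ℝ (Submodule.span ℝ S)).repr.symm.toLinearIsometry
  have hf : ∀ S, f S '' (f S ⁻¹' S) = S := by
    intro S
    refine Set.image_preimage_eq_of_subset fun α hα => ?_
    refine ⟨(stdOrthonormalBasis ℝ (Submodule.span ℝ S)).repr
      ⟨α, Submodule.subset_span hα⟩, ?_⟩
    change (((stdOrthonormalBasis ℝ (Submodule.span ℝ S)).repr.symm _ :
      Submodule.span ℝ S) : Eucl n) = α
    rw [LinearIsometryEquiv.symm_apply_apply]
  refine ⟨{ toRunB4 := x
            irr := hfin.toFinset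
            irr_eq := hfin.coe_toFinset
            model := fun S => f S ⁻¹' S
            model_ade := fun S hS => ?_
            model_iso := fun S _ => ⟨f S, hf S⟩
            corank := _
            basis := Module.finBasis ℝ _ }, rfl⟩
  have h1 := (hR.component (hfin.mem_toFinset.1 hS)).comap (f S) (hf S)
  exact
  { finite := h1.finite
    span_eq_top := span_model_eq_top (f S) (hf S) (by simp)
    norm_two := h1.norm_two
    integral := h1.integral
    refl_mem := h1.refl_mem }

end Runs

/-! ### Decomposition of a root system into irreducible components -/

section ComponentDecomposition

variable {V : Type*} [NormedAddCommGroup V] [InnerProductSpace ℝ V]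

theorem exists_component {R : Set V} (hfin : R.Finite) {α : V} (hα : α ∈ R) :
    ∃ S ∈ irreducibleComponents R, α ∈ S := by
  have hF : {T | T ⊆ R ∧ α ∈ T ∧ ∀ a ∈ T, ∀ b ∈ R \ T, inner ℝ a b = (0 : ℝ)}.Finite :=
    hfin.finite_subsets.subset fun T hT => hT.1
  -- the component of `α` is the smallest set containing `α` and orthogonal to its complement
  obtain ⟨T, hT⟩ := hF.exists_minimal ⟨R, subset_rfl, hα, by simp⟩
  obtain ⟨hTR, hαT, horth⟩ := hT.prop
  refine ⟨T, ⟨hTR, ⟨α, hαT⟩, horth, fun T' hT' hne ho => ?_⟩, hαT⟩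
  by_cases hα' : α ∈ T'
  · refine hT'.antisymm (hT.le_of_le ⟨hT'.trans hTR, hα', fun a ha b hb => ?_⟩ hT')
    by_cases hbT : b ∈ T
    exacts [ho a ha b ⟨hbT, hb.2⟩, horth a (hT' ha) b ⟨hb.1, hbT⟩]
  · exfalso
    have hle : T ⊆ T \ T' := hT.le_of_le ⟨Set.sdiff_subset.trans hTR, ⟨hαT, hα'⟩,
      fun a ha b hb => by
        by_cases hbT : b ∈ T
        · have hbT' : b ∈ T' := by
            by_contra hc; exact hb.2 ⟨hbT, hc⟩
          rw [real_inner_comm]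
          exact ho b hbT' a ha
        · exact horth a ha.1 b ⟨hb.1, hbT⟩⟩ Set.sdiff_subset
    obtain ⟨c, hc⟩ := hne
    exact (hle (hT' hc)).2 hc

theorem component_subset_of_inter {R S S' : Set V} (hS : S ∈ irreducibleComponents R)
    (hS' : S' ∈ irreducibleComponents R) (hne : (S ∩ S').Nonempty) : S ⊆ S' := by
  have := hS.2.2.2 (S ∩ S') Set.inter_subset_left hne fun a ha b hb =>
    hS'.2.2.1 a ha.2 b ⟨hS.1 hb.1, fun hc => hb.2 ⟨hb.1, hc⟩⟩
  rw [← this]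
  exact Set.inter_subset_right

theorem component_eq_of_mem {R S S' : Set V} (hS : S ∈ irreducibleComponents R)
    (hS' : S' ∈ irreducibleComponents R) {α : V} (h : α ∈ S) (h' : α ∈ S') : S = S' :=
  (component_subset_of_inter hS hS' ⟨α, h, h'⟩).antisymm
    (component_subset_of_inter hS' hS ⟨α, h', h⟩)

theorem inner_eq_zero_of_ne {R S S' : Set V} (hS : S ∈ irreducibleComponents R)
    (hS' : S' ∈ irreducibleComponents R) (hne : S ≠ S') {x y : V}
    (hx : x ∈ Submodule.span ℝ S) (hy : y ∈ Submodule.span ℝ S') : inner ℝ x y = (0 : ℝ) := by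
  have : Submodule.span ℝ S ⟂ Submodule.span ℝ S' := by
    rw [Submodule.isOrtho_span]
    intro a ha b hb
    by_contra hc
    exact hne (component_eq_of_mem hS hS' (mem_component_of_inner_ne_zero hS ha (hS'.1 hb) hc) hb)
  exact this.inner_eq hx hy

theorem image_component {R S : Set V} {γ : V ≃ₗᵢ[ℝ] V} (hγ : γ '' R = R)
    (hS : S ∈ irreducibleComponents R) : γ '' S ∈ irreducibleComponents R := by
  refine ⟨by rw [← hγ]; exact Set.image_mono hS.1, hS.2.1.image γ, ?_, fun T hT hne ho => ?_⟩
  · rintro _ ⟨a, ha, rfl⟩ b ⟨hb, hb'⟩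
    rw [← hγ] at hb
    obtain ⟨b, hb, rfl⟩ := hb
    rw [γ.inner_map_map]
    exact hS.2.2.1 a ha b ⟨hb, fun hc => hb' ⟨b, hc, rfl⟩⟩
  · obtain ⟨T, rfl⟩ : ∃ T', γ '' T' = T := ⟨γ ⁻¹' T, Set.image_preimage_eq T γ.surjective⟩
    rw [Set.image_subset_image_iff γ.injective] at hT
    rw [hS.2.2.2 T hT (Set.image_nonempty.1 hne) fun a ha b hb => ?_]
    rw [← γ.inner_map_map]
    exact ho _ ⟨a, ha, rfl⟩ _ ⟨⟨b, hb.1, rfl⟩, by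
      rintro ⟨c, hc, hcb⟩; exact hb.2 (γ.injective hcb ▸ hc)⟩

theorem image_eq_of_finite {R : Set V} (hfin : R.Finite) {γ : V ≃ₗᵢ[ℝ] V}
    (hγ : ∀ α ∈ R, γ α ∈ R) : γ '' R = R :=
  Set.eq_of_subset_of_ncard_le (by rintro _ ⟨α, hα, rfl⟩; exact hγ α hα)
    (Set.ncard_image_of_injective _ γ.injective).ge hfin

/-- The Weyl group stabilizes every irreducible component. -/
theorem reflGroup_image_component {R S : Set V} (h : IsRootSet R)
    (hS : S ∈ irreducibleComponents R) {w : V ≃ₗᵢ[ℝ] V} (hw : w ∈ reflGroup R) : w '' S = S := by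
  refine image_eq_of_finite (h.component hS).finite ?_
  have key : ∀ β ∈ R, ∀ α ∈ S, refl β α ∈ S := by
    intro β hβ α hα
    by_cases h0 : inner ℝ α β = (0 : ℝ)
    · rwa [refl_apply (h.norm_two β hβ), real_inner_comm, h0, zero_smul, sub_zero]
    · exact (h.component hS).refl_mem β (mem_component_of_inner_ne_zero hS hα hβ h0) α hα
  induction hw using Subgroup.closure_induction'' with
  | mem x hx => obtain ⟨β, hβ, rfl⟩ := hx; exact key β hβ
  | inv_mem x hx => obtain ⟨β, hβ, rfl⟩ := hx; rw [refl_inv]; exact key β hβ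
  | one => exact fun α hα => hα
  | mul x y _ _ hx hy => exact fun α hα => hx _ (hy _ hα)

theorem reflGroup_apply_of_orthogonal {R : Set V} (h : ∀ α ∈ R, inner ℝ α α = (2 : ℝ))
    {w : V ≃ₗᵢ[ℝ] V} (hw : w ∈ reflGroup R) {y : V} (hy : ∀ α ∈ R, inner ℝ α y = (0 : ℝ)) :
    w y = y := by
  have key : ∀ α ∈ R, refl α y = y := by
    intro α hα
    rw [refl_apply (h α hα), hy α hα, zero_smul, sub_zero]
  induction hw using Subgroup.closure_induction'' with
  | mem x hx => obtain ⟨β, hβ, rfl⟩ := hx; exact key β hβ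
  | inv_mem x hx => obtain ⟨β, hβ, rfl⟩ := hx; rw [refl_inv]; exact key β hβ
  | one => rfl
  | mul x z _ _ hx hz => rw [LinearIsometryEquiv.coe_mul, Function.comp_apply, hz, hx]

/-- Multiplying `γ` by an element of the Weyl group does not change the way its powers permute the
irreducible components. -/
theorem pow_mul_image_component {R S : Set V} (h : IsRootSet R) {γ w : V ≃ₗᵢ[ℝ] V}
    (hγ : γ '' R = R) (hw : w ∈ reflGroup R) (hS : S ∈ irreducibleComponents R) (i : ℕ) :
    ((γ * w) ^ i) '' S = (γ ^ i) '' S ∧ (γ ^ i) '' S ∈ irreducibleComponents R := by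
  induction i with
  | zero => simpa using hS
  | succ i ih =>
    obtain ⟨h1, h2⟩ := ih
    rw [pow_succ', pow_succ' γ, LinearIsometryEquiv.coe_mul, Set.image_comp, h1,
      LinearIsometryEquiv.coe_mul, Set.image_comp, reflGroup_image_component h h2 hw,
      LinearIsometryEquiv.coe_mul γ, Set.image_comp]
    exact ⟨rfl, image_component hγ h2⟩

end ComponentDecomposition

/-! ### Isometries induced on a component -/

section Models

variable {V : Type*} [NormedAddCommGroup V] [InnerProductSpace ℝ V]
  {U : Type*} [NormedAddCommGroup U] [InnerProductSpace ℝ U]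
  {R S : Set V} {T : Set U} {f : U →ₗᵢ[ℝ] V}

theorem mem_span_of_model (hT : f '' T = S) (hspan : Submodule.span ℝ T = ⊤) (x : U) :
    f x ∈ Submodule.span ℝ S := by
  rw [← hT, show (f '' T) = (f.toLinearMap '' T) from rfl, ← Submodule.map_span, hspan]
  exact ⟨x, trivial, rfl⟩

theorem mem_range_of_mem_span (hT : f '' T = S) {y : V} (hy : y ∈ Submodule.span ℝ S) :
    ∃ x, f x = y := by
  rw [← hT, show (f '' T) = (f.toLinearMap '' T) from rfl, ← Submodule.map_span] at hy
  exact hy.imp fun x hx => hx.2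

/-- An element of the Weyl group of `R` acts on a component as an element of the Weyl group of this
component. -/
theorem exists_restrict (h : IsRootSet R) (hS : S ∈ irreducibleComponents R) (hT : f '' T = S)
    (hspan : Submodule.span ℝ T = ⊤) {w : V ≃ₗᵢ[ℝ] V} (hw : w ∈ reflGroup R) :
    ∃ u ∈ reflGroup T, ∀ x, f (u x) = w (f x) := by
  have hTr := (h.component hS).comap f hT
  have key : ∀ β ∈ R, ∃ u ∈ reflGroup T, ∀ x, f (u x) = refl β (f x) := by
    intro β hβ
    by_cases hβS : β ∈ S
    · rw [← hT] at hβS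
      obtain ⟨b, hb, rfl⟩ := hβS
      exact ⟨refl b, Subgroup.subset_closure ⟨b, hb, rfl⟩, refl_map f (hTr.norm_two b hb)⟩
    · refine ⟨1, one_mem _, fun x => ?_⟩
      have h0 : inner ℝ β (f x) = (0 : ℝ) := by
        have hx := mem_span_of_model hT hspan x
        generalize f x = y at hx
        induction hx using Submodule.span_induction with
        | mem y hy => rw [real_inner_comm]; exact hS.2.2.1 y hy β ⟨hβ, hβS⟩
        | zero => simp
        | add y z _ _ hy hz => rw [inner_add_right, hy, hz, add_zero]
        | smul a y _ hy => rw [inner_smul_right, hy, mul_zero]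
      rw [refl_apply (h.norm_two β hβ), h0, zero_smul, sub_zero]
      rfl
  induction hw using Subgroup.closure_induction'' with
  | mem x hx => obtain ⟨β, hβ, rfl⟩ := hx; exact key β hβ
  | inv_mem x hx => obtain ⟨β, hβ, rfl⟩ := hx; rw [refl_inv]; exact key β hβ
  | one => exact ⟨1, one_mem _, fun x => rfl⟩
  | mul w w' _ _ hw hw' =>
    obtain ⟨u, hu, h1⟩ := hw
    obtain ⟨u', hu', h1'⟩ := hw'
    refine ⟨u * u', mul_mem hu hu', fun x => ?_⟩
    rw [LinearIsometryEquiv.coe_mul, Function.comp_apply, h1, h1']; rfl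

/-- An element of the Weyl group of a component extends to an element of the Weyl group of `R`
which acts trivially on the orthogonal of this component. -/
theorem exists_extend (h : IsRootSet R) (hSR : S ⊆ R) (hT : f '' T = S)
    {u : U ≃ₗᵢ[ℝ] U} (hu : u ∈ reflGroup T) :
    ∃ w ∈ reflGroup R, (∀ x, w (f x) = f (u x)) ∧
      ∀ y, (∀ α ∈ S, inner ℝ α y = (0 : ℝ)) → w y = y := by
  have h2 : ∀ b ∈ T, f b ∈ R := fun b hb => hSR (hT ▸ ⟨b, hb, rfl⟩)
  have key : ∀ b ∈ T, ∃ w ∈ reflGroup R, (∀ x, w (f x) = f (refl b x)) ∧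
      ∀ y, (∀ α ∈ S, inner ℝ α y = (0 : ℝ)) → w y = y := by
    intro b hb
    refine ⟨refl (f b), Subgroup.subset_closure ⟨f b, h2 b hb, rfl⟩, fun x => ?_, fun y hy => ?_⟩
    · have : inner ℝ b b = (2 : ℝ) := by rw [← f.inner_map_map]; exact h.norm_two _ (h2 b hb)
      exact (refl_map f this x).symm
    · rw [refl_apply (h.norm_two _ (h2 b hb)), hy (f b) (hT ▸ ⟨b, hb, rfl⟩), zero_smul, sub_zero]
  induction hu using Subgroup.closure_induction'' with
  | mem x hx => obtain ⟨b, hb, rfl⟩ := hx; exact key b hb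
  | inv_mem x hx => obtain ⟨b, hb, rfl⟩ := hx; rw [refl_inv]; exact key b hb
  | one => exact ⟨1, one_mem _, fun x => rfl, fun y _ => rfl⟩
  | mul u u' _ _ hu hu' =>
    obtain ⟨w, hw, h1, h2⟩ := hu
    obtain ⟨w', hw', h1', h2'⟩ := hu'
    refine ⟨w * w', mul_mem hw hw', fun x => ?_, fun y hy => ?_⟩
    · rw [LinearIsometryEquiv.coe_mul, Function.comp_apply, h1', h1]; rfl
    · rw [LinearIsometryEquiv.coe_mul, Function.comp_apply, h2' y hy, h2 y hy]

theorem finite_reflGroup_of_model (h : IsRootSet R) (hSR : S ⊆ R) (hT : f '' T = S)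
    [Finite (reflGroup R)] : Finite (reflGroup T) := by
  choose e he using fun u : reflGroup T => exists_extend h hSR hT u.2
  refine Finite.of_injective (fun u => (⟨e u, (he u).1⟩ : reflGroup R)) fun u u' huu' => ?_
  have h1 : e u = e u' := congrArg Subtype.val huu'
  apply Subtype.ext
  ext x
  apply f.injective
  rw [← (he u).2.1, h1, (he u').2.1]

/-- An isometry which stabilizes a component induces an isometry of its model. -/
theorem exists_pull [FiniteDimensional ℝ U] (hT : f '' T = S) (hspan : Submodule.span ℝ T = ⊤)
    {g : V ≃ₗᵢ[ℝ] V} (hg : g '' S = S) : ∃ u : U ≃ₗᵢ[ℝ] U, ∀ x, f (u x) = g (f x) := by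
  have hmem : ∀ x, ∃ z, f z = g (f x) := by
    intro x
    apply mem_range_of_mem_span hT
    have h1 : g (f x) ∈ Submodule.map (g.toLinearEquiv : V →ₗ[ℝ] V) (Submodule.span ℝ S) :=
      ⟨f x, mem_span_of_model hT hspan x, rfl⟩
    rw [Submodule.map_span] at h1
    have h2 : (g.toLinearEquiv : V →ₗ[ℝ] V) '' S = S := hg
    rwa [h2] at h1
  choose F hF using hmem
  let FL : U →ₗᵢ[ℝ] U :=
    { toFun := F
      map_add' := fun x y => f.injective (by simp only [hF, map_add])
      map_smul' := fun a x => f.injective (by simp only [hF, map_smul, RingHom.id_apply])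
      norm_map' := fun x => by
        change ‖F x‖ = ‖x‖
        rw [← f.norm_map, hF, g.norm_map, f.norm_map] }
  exact ⟨FL.toLinearIsometryEquiv rfl, hF⟩

theorem pull_pow {g : V ≃ₗᵢ[ℝ] V} {u : U ≃ₗᵢ[ℝ] U} (hu : ∀ x, f (u x) = g (f x)) (k : ℕ) (x : U) :
    f ((u ^ k) x) = (g ^ k) (f x) := by
  induction k generalizing x with
  | zero => rfl
  | succ k ih =>
    rw [pow_succ, pow_succ, LinearIsometryEquiv.coe_mul, LinearIsometryEquiv.coe_mul,
      Function.comp_apply, Function.comp_apply, ih, hu]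

theorem pull_eq_one_iff (hT : f '' T = S) (hspan : Submodule.span ℝ T = ⊤) {g : V ≃ₗᵢ[ℝ] V}
    {u : U ≃ₗᵢ[ℝ] U} (hu : ∀ x, f (u x) = g (f x)) : u = 1 ↔ ∀ α ∈ S, g α = α := by
  constructor
  · rintro rfl α hα
    rw [← hT] at hα
    obtain ⟨b, _, rfl⟩ := hα
    exact (hu b).symm
  · intro hg
    ext x
    have hx : x ∈ Submodule.span ℝ T := by rw [hspan]; trivial
    change u x = x
    induction hx using Submodule.span_induction with
    | mem x hx => exact f.injective (by rw [hu, hg _ (hT ▸ ⟨x, hx, rfl⟩)])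
    | zero => simp
    | add y z _ _ hy hz => rw [map_add, hy, hz]
    | smul a y _ hy => rw [map_smul, hy]

theorem orderOf_pull (hT : f '' T = S) (hspan : Submodule.span ℝ T = ⊤) {g : V ≃ₗᵢ[ℝ] V}
    {u : U ≃ₗᵢ[ℝ] U} (hu : ∀ x, f (u x) = g (f x)) {d : ℕ} (hd : IsPermOrder g S d) :
    orderOf u = d := by
  have hiff : ∀ e : ℕ, u ^ e = 1 ↔ ∀ α ∈ S, (g ^ e) α = α := fun e =>
    pull_eq_one_iff hT hspan (pull_pow hu e)
  rw [orderOf_eq_iff hd.2.1.1]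
  refine ⟨(hiff d).2 hd.2.1.2, fun m hm h0 hc => ?_⟩
  have := hd.2.2 ⟨h0, (hiff m).1 hc⟩
  omega

theorem isRegular_model {φ : V →ₗ[ℝ] ℝ} (h : IsRegular R φ) (hS : S ∈ irreducibleComponents R)
    (hT : f '' T = S) : IsRegular T (φ ∘ₗ f.toLinearMap) where
  toIsRootSet := (h.component hS).comap f hT
  ne_zero := fun α hα => h.ne_zero _ (hS.1 (hT ▸ ⟨α, hα, rfl⟩))

theorem pull_mem_diagramGroup {φ : V →ₗ[ℝ] ℝ} (h : IsRegular R φ)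
    (hS : S ∈ irreducibleComponents R) (hT : f '' T = S) {g : V ≃ₗᵢ[ℝ] V}
    (hg : g ∈ diagramGroup R φ) (hgS : g '' S = S) {u : U ≃ₗᵢ[ℝ] U}
    (hu : ∀ x, f (u x) = g (f x)) : u ∈ diagramGroup T (φ ∘ₗ f.toLinearMap) := by
  rw [mem_diagramGroup (isRegular_model h hS hT)]
  rintro α ⟨hα, hpos⟩
  have h1 : f α ∈ S := hT ▸ ⟨α, hα, rfl⟩
  refine ⟨?_, ?_⟩
  · rw [← f.injective.mem_set_image, hT, hu, ← hgS]
    exact ⟨f α, h1, rfl⟩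
  · change 0 < φ (f (u α))
    rw [hu]
    exact ((mem_diagramGroup h).1 hg (f α) ⟨hS.1 h1, hpos⟩).2

section RootLattice

variable {L : Submodule ℤ V}

theorem rootLattice_model_le (hSL : S ⊆ L) (hT : f '' T = S) :
    ∀ x ∈ rootLattice T, f x ∈ L := by
  intro x hx
  induction hx using Submodule.span_induction with
  | mem x hx => exact hSL (hT ▸ ⟨x, hx, rfl⟩)
  | zero => simp
  | add y z _ _ hy hz => rw [map_add]; exact add_mem hy hz
  | smul a y _ hy =>
    rw [← Int.cast_smul_eq_zsmul ℝ, map_smul, Int.cast_smul_eq_zsmul]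
    exact L.smul_mem a hy

/-- A component of the roots of `L` is the set of all roots of the lattice it generates. -/
theorem roots_rootLattice_model (hS : S ∈ irreducibleComponents (roots L)) (hT : f '' T = S)
    (hspan : Submodule.span ℝ T = ⊤) : roots (rootLattice T) = T := by
  apply Set.Subset.antisymm
  · rintro α ⟨hα, h2⟩
    rw [← f.inner_map_map] at h2
    have hR : f α ∈ roots L :=
      ⟨rootLattice_model_le (fun x hx => (hS.1 hx).1) hT α hα, h2⟩
    rw [← f.injective.mem_set_image, hT]
    by_contra hc
    have h0 : ∀ y ∈ Submodule.span ℝ S, inner ℝ y (f α) = (0 : ℝ) := by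
      intro y hy
      induction hy using Submodule.span_induction with
      | mem y hy => exact hS.2.2.1 y hy _ ⟨hR, hc⟩
      | zero => simp
      | add y z _ _ hy hz => rw [inner_add_left, hy, hz, add_zero]
      | smul a y _ hy => rw [inner_smul_left, hy, mul_zero]
    rw [h0 _ (mem_span_of_model hT hspan α)] at h2
    norm_num at h2
  · intro α hα
    refine ⟨Submodule.subset_span hα, ?_⟩
    rw [← f.inner_map_map]
    exact (hS.1 (hT ▸ ⟨α, hα, rfl⟩)).2

theorem discreteTopology_rootLattice_model [DiscreteTopology L] (hSL : S ⊆ L) (hT : f '' T = S) :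
    DiscreteTopology (rootLattice T) := by
  let F : rootLattice T → L := fun x => ⟨f x, rootLattice_model_le hSL hT x x.2⟩
  refine DiscreteTopology.of_continuous_injective (f := F) ?_ ?_
  · exact (f.continuous.comp continuous_subtype_val).subtype_mk _
  · exact fun x y hxy => Subtype.ext (f.injective (congrArg Subtype.val hxy))

theorem isZLattice_rootLattice [DiscreteTopology (rootLattice T)]
    (hspan : Submodule.span ℝ T = ⊤) : IsZLattice ℝ (rootLattice T) where
  span_top := by
    rw [rootLattice, Submodule.span_span_of_tower, hspan]

end RootLattice

end Models

/-! ### Orbits of components -/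

section Orbits

variable {V : Type*} [NormedAddCommGroup V] [InnerProductSpace ℝ V]

/-- The `γ`-orbit of `S` consists of the `l` distinct sets `γ ^ i (S)`, `0 ≤ i < l`, where `l` is
its size. -/
theorem orbitSize_spec {γ : V ≃ₗᵢ[ℝ] V} (hγ : IsOfFinOrder γ) (S : Set V) :
    0 < orbitSize γ S ∧ (γ ^ orbitSize γ S) '' S = S ∧
      (∀ i j, i < orbitSize γ S → j < orbitSize γ S → (γ ^ i) '' S = (γ ^ j) '' S → i = j) ∧
      ∀ k : ℤ, ∃ i < orbitSize γ S, (γ ^ k) '' S = (γ ^ i) '' S := by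
  set p := Function.minimalPeriod (fun T : Set V => γ '' T) S with hp
  have hit : ∀ k : ℕ, (fun T : Set V => γ '' T)^[k] S = (γ ^ k) '' S := by
    intro k
    induction k with
    | zero => simp
    | succ k ih =>
      rw [Function.iterate_succ_apply', ih, pow_succ', LinearIsometryEquiv.coe_mul, Set.image_comp]
  obtain ⟨N, hN, hγN⟩ := isOfFinOrder_iff_pow_eq_one.1 hγ
  have hp0 : 0 < p := by
    refine Function.IsPeriodicPt.minimalPeriod_pos hN ?_
    rw [Function.IsPeriodicPt, Function.IsFixedPt, hit, hγN]
    simp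
  have hz : ∀ k : ℤ, ∃ i < p, (γ ^ k) '' S = (γ ^ i) '' S := by
    intro k
    have h1 : γ ^ k = γ ^ (k % N).toNat := by
      have h2 : ((k % N).toNat : ℤ) = k % N := Int.toNat_of_nonneg (Int.emod_nonneg _ (by omega))
      rw [← zpow_natCast, h2]
      conv_lhs => rw [← Int.emod_add_mul_ediv k N, zpow_add, zpow_mul, zpow_natCast, hγN]
      simp
    refine ⟨(k % N).toNat % p, Nat.mod_lt _ hp0, ?_⟩
    rw [h1, ← hit, ← hit, Function.iterate_mod_minimalPeriod_eq]
  have hinj : ∀ i j, i < p → j < p → (γ ^ i) '' S = (γ ^ j) '' S → i = j := by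
    intro i j hi hj hij
    rw [← hit, ← hit] at hij
    exact Function.iterate_injOn_Iio_minimalPeriod hi hj hij
  have hset : {T : Set V | ∃ i : ℤ, T = (γ ^ i) '' S} =
      (fun i : ℕ => (γ ^ i) '' S) '' Set.Iio p := by
    ext T
    constructor
    · rintro ⟨k, rfl⟩
      obtain ⟨i, hi, h1⟩ := hz k
      exact ⟨i, hi, h1.symm⟩
    · rintro ⟨i, _, rfl⟩
      exact ⟨i, by rw [zpow_natCast]⟩
  have hsize : orbitSize γ S = p := by
    have hio : Set.InjOn (fun i : ℕ => (γ ^ i) '' S) (Set.Iio p) :=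
      fun i hi j hj hij => hinj i j hi hj hij
    rw [orbitSize, hset, hio.ncard_image]
    have : Set.Iio p = (Finset.range p : Set ℕ) := by ext; simp
    rw [this, Set.ncard_coe_finset, Finset.card_range]
  rw [hsize]
  refine ⟨hp0, ?_, hinj, hz⟩
  rw [← hit, hp, Function.iterate_minimalPeriod]

end Orbits

/-! ### Characteristic polynomials in a coset of the Weyl group -/

section WeylCosetCharpoly

variable {V : Type*} [NormedAddCommGroup V] [InnerProductSpace ℝ V]

/-- `reps` is a set of representatives of the orbits of `γ` on the irreducible components of
`R`. -/
structure IsOrbitReps (R : Set V) (γ : V ≃ₗᵢ[ℝ] V) (reps : Finset (Set V)) : Prop where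
  component : ∀ S ∈ reps, S ∈ irreducibleComponents R
  unique : ∀ S ∈ irreducibleComponents R, ∃! T, T ∈ reps ∧ ∃ i : ℤ, S = (γ ^ i) '' T

variable {R : Set V} {γ : V ≃ₗᵢ[ℝ] V} {reps : Finset (Set V)}

theorem IsOrbitReps.eq_of_image_eq (h : IsOrbitReps R γ reps) {S S' : Set V} (hS : S ∈ reps)
    (hS' : S' ∈ reps) {i i' : ℕ} (heq : (γ ^ i) '' S = (γ ^ i') '' S') : S = S' := by
  obtain ⟨T, _, hT⟩ := h.unique S (h.component S hS)
  have h1 : S = T := hT S ⟨hS, 0, by simp⟩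
  have h2 : S' = T := by
    refine hT S' ⟨hS', -(i : ℤ) + (i' : ℤ), ?_⟩
    rw [zpow_add, LinearIsometryEquiv.coe_mul, Set.image_comp, zpow_natCast, ← heq,
      ← Set.image_comp, ← LinearIsometryEquiv.coe_mul, zpow_neg, zpow_natCast, inv_mul_cancel]
    simp
  rw [h1, h2]

/-- The subspace spanned by the roots is the orthogonal sum of the orbits of the spans of the
representatives, hence the characteristic polynomial of an element of `γ W(R)`. -/
theorem isomCharpoly_mul_weyl [FiniteDimensional ℝ V] (h : IsRootSet R) (hγ : γ '' R = R)
    (hfin : IsOfFinOrder γ) (hreps : IsOrbitReps R γ reps)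
    (f : ∀ S : reps, Eucl (rank S.1) →ₗᵢ[ℝ] V) (T : ∀ S : reps, Set (Eucl (rank S.1)))
    (hT : ∀ S, f S '' T S = S.1) {c : ℕ} (b : Module.Basis (Fin c) ℝ (Submodule.span ℝ R)ᗮ)
    (A : Matrix (Fin c) (Fin c) ℝ) (hA : ∀ i, γ (b i : V) = ∑ k, A k i • (b k : V))
    {w : V ≃ₗᵢ[ℝ] V} (hw : w ∈ reflGroup R)
    (u : ∀ S : reps, Eucl (rank S.1) ≃ₗᵢ[ℝ] Eucl (rank S.1))
    (hu : ∀ S x, f S (u S x) = ((γ * w) ^ orbitSize γ S.1) (f S x)) :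
    isomCharpoly (γ * w) =
      (∏ S : reps, expand ℝ (orbitSize γ S.1) (isomCharpoly (u S))) * A.charpoly := by
  classical
  have hspanT : ∀ S, Submodule.span ℝ (T S) = ⊤ := fun S =>
    span_model_eq_top (f S) (hT S) (by simp)
  obtain ⟨m, hm⟩ : ∃ m : reps → ℕ, ∀ S, m S + 1 = orbitSize γ S.1 :=
    ⟨fun S => orbitSize γ S.1 - 1, fun S => Nat.sub_add_cancel (orbitSize_spec hfin S.1).1⟩
  have hpow : ∀ (S : reps) (i : ℕ), ⇑((γ * w) ^ i) '' S.1 = ⇑(γ ^ i) '' S.1 ∧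
      ⇑(γ ^ i) '' S.1 ∈ irreducibleComponents R := fun S i =>
    pow_mul_image_component h hγ hw (hreps.component S.1 S.2) i
  have himg : ∀ (S : reps) (i : ℕ) (x : Eucl (rank S.1)),
      ((γ * w) ^ i) (f S x) ∈ Submodule.span ℝ (⇑(γ ^ i) '' S.1) := by
    intro S i x
    have h1 : ((γ * w) ^ i) (f S x) ∈
        Submodule.map (((γ * w) ^ i).toLinearEquiv : V →ₗ[ℝ] V) (Submodule.span ℝ S.1) :=
      ⟨f S x, mem_span_of_model (hT S) (hspanT S) x, rfl⟩
    rw [Submodule.map_span] at h1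
    have h2 : (((γ * w) ^ i).toLinearEquiv : V →ₗ[ℝ] V) '' S.1 =
        ((γ ^ i : V ≃ₗᵢ[ℝ] V) : V → V) '' S.1 := (hpow S i).1
    rwa [h2] at h1
  have horth : ∀ (S S' : reps) (i i' : ℕ), i ≤ m S → i' ≤ m S' → (S ≠ S' ∨ i ≠ i') → ∀ x y,
      inner ℝ (((γ * w) ^ i) (f S x)) (((γ * w) ^ i') (f S' y)) = (0 : ℝ) := by
    intro S S' i i' hi hi' hne x y
    refine inner_eq_zero_of_ne (hpow S i).2 (hpow S' i').2 (fun heq => ?_) (himg S i x)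
      (himg S' i' y)
    have h1 : S = S' := Subtype.ext (hreps.eq_of_image_eq S.2 S'.2 heq)
    subst h1
    have h2 := hm S
    rcases hne with hne | hne
    · exact hne rfl
    · exact hne ((orbitSize_spec hfin S.1).2.2.1 i i' (by omega) (by omega) heq)
  have hspan : ∀ U : Submodule ℝ V,
      (∀ S i x, i ≤ m S → ((γ * w) ^ i) (f S x) ∈ U) → Submodule.span ℝ R ≤ U := by
    intro U hU
    rw [Submodule.span_le]
    intro α hα
    obtain ⟨S', hS', hαS'⟩ := exists_component h.finite hα
    obtain ⟨S, ⟨hS, k, hk⟩, _⟩ := hreps.unique S' hS'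
    obtain ⟨i, hi, hki⟩ := (orbitSize_spec hfin S).2.2.2 k
    rw [hk, hki, ← (hpow ⟨S, hS⟩ i).1] at hαS'
    obtain ⟨β, hβ, rfl⟩ := hαS'
    obtain ⟨x, rfl⟩ := mem_range_of_mem_span (hT ⟨S, hS⟩) (Submodule.subset_span hβ)
    have h2 := hm ⟨S, hS⟩
    exact hU ⟨S, hS⟩ i x (by change m ⟨S, hS⟩ + 1 = orbitSize γ S at h2; omega)
  have hA' : ∀ i, (γ * w) (b i : V) = ∑ k, A k i • (b k : V) := by
    intro i
    rw [LinearIsometryEquiv.coe_mul, Function.comp_apply,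
      reflGroup_apply_of_orthogonal h.norm_two hw, hA]
    exact fun α hα => (Submodule.mem_orthogonal _ _).1 (b i).2 α (Submodule.subset_span hα)
  have key := isomCharpoly_eq_prod f (γ * w)
    (fun S => ((u S).toLinearEquiv : Eucl (rank S.1) →ₗ[ℝ] Eucl (rank S.1)))
    (fun S x => by rw [hm]; exact (hu S x).symm) horth (Submodule.span ℝ R)
    (fun S i x => Submodule.span_mono (hpow S i).2.1 (himg S i x)) hspan b A hA'
  rw [key]
  congr 1
  refine Finset.prod_congr rfl fun S _ => ?_
  rw [hm]
  rfl

theorem exists_orbitReps {irr : Finset (Set V)}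
    (hirr : (irr : Set (Set V)) = irreducibleComponents R) (hγ : γ '' R = R)
    (hfin : IsOfFinOrder γ) :
    ∃ reps ⊆ irr, IsOrbitReps R γ reps := by
  classical
  have hmem : ∀ {S}, S ∈ irr ↔ S ∈ irreducibleComponents R := by
    intro S; rw [← hirr]; rfl
  have hcomp : ∀ (i : ℕ) S, S ∈ irreducibleComponents R →
      (γ ^ i) '' S ∈ irreducibleComponents R := by
    intro i S hS
    induction i with
    | zero => simpa using hS
    | succ i ih =>
      rw [pow_succ', LinearIsometryEquiv.coe_mul, Set.image_comp]
      exact image_component hγ ih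
  let r : Setoid (Set V) :=
    { r := fun S S' => ∃ i : ℤ, S' = (γ ^ i) '' S
      iseqv :=
        { refl := fun S => ⟨0, by simp⟩
          symm := by
            rintro S S' ⟨i, rfl⟩
            refine ⟨-i, ?_⟩
            rw [← Set.image_comp, ← LinearIsometryEquiv.coe_mul, ← zpow_add]
            simp
          trans := by
            rintro S S' S'' ⟨i, rfl⟩ ⟨k, rfl⟩
            refine ⟨k + i, ?_⟩
            rw [← Set.image_comp, ← LinearIsometryEquiv.coe_mul, ← zpow_add] } }
  have hout : ∀ S : Set V, ∃ i : ℤ, S = (γ ^ i) '' (Quotient.out (Quotient.mk r S)) :=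
    fun S => Quotient.exact (Quotient.out_eq (Quotient.mk r S))
  have hsub : irr.image (fun S => Quotient.out (Quotient.mk r S)) ⊆ irr := by
    intro S' hS'
    obtain ⟨S, hS, rfl⟩ := Finset.mem_image.1 hS'
    obtain ⟨i, hi⟩ := r.symm (hout S)
    obtain ⟨k, _, hk⟩ := (orbitSize_spec hfin S).2.2.2 i
    rw [hmem, hi, hk]
    exact hcomp k S (hmem.1 hS)
  refine ⟨_, hsub, fun S hS => hmem.1 (hsub hS), fun S hS => ?_⟩
  refine ⟨_, ⟨Finset.mem_image_of_mem _ (hmem.2 hS), hout S⟩, ?_⟩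
  rintro S' ⟨hS', hi⟩
  obtain ⟨S'', _, rfl⟩ := Finset.mem_image.1 hS'
  have h1 : Quotient.mk r (Quotient.out (Quotient.mk r S'')) = Quotient.mk r S :=
    Quotient.sound hi
  rw [Quotient.out_eq] at h1
  exact congrArg Quotient.out h1

/-- The order of the permutation of a component induced by an isometry is the order of the isometry
induced on the model of the component. -/
theorem isPermOrder_of_pull {U : Type*} [NormedAddCommGroup U] [InnerProductSpace ℝ U] {S : Set V}
    {T : Set U} {f : U →ₗᵢ[ℝ] V} (hT : f '' T = S) (hspan : Submodule.span ℝ T = ⊤)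
    {g : V ≃ₗᵢ[ℝ] V} (hgS : g '' S = S) {u : U ≃ₗᵢ[ℝ] U} (hu : ∀ x, f (u x) = g (f x))
    (hfin : 0 < orderOf u) : IsPermOrder g S (orderOf u) := by
  have hiff : ∀ e : ℕ, u ^ e = 1 ↔ ∀ α ∈ S, (g ^ e) α = α := fun e =>
    pull_eq_one_iff hT hspan (pull_pow hu e)
  refine ⟨hgS, ⟨hfin, (hiff _).1 (pow_orderOf_eq_one u)⟩, fun e he => ?_⟩
  exact orderOf_le_of_pow_eq_one he.1 ((hiff e).2 he.2)

/-- The cofactor of a monic integral polynomial in an integral polynomial is integral. -/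
theorem exists_map_eq_of_map_eq_mul {P Q : ℤ[X]} (hQ : Q.Monic) {C : ℝ[X]}
    (h : P.map (Int.castRingHom ℝ) = Q.map (Int.castRingHom ℝ) * C) :
    ∃ D : ℤ[X], D.map (Int.castRingHom ℝ) = C := by
  refine ⟨P /ₘ Q, ?_⟩
  rw [map_divByMonic _ hQ, h, mul_divByMonic_cancel_left _ (hQ.map _)]

end WeylCosetCharpoly

/-! ### Orders and representatives for the components -/

section LaterRuns

variable {n : ℕ} {L : Submodule ℤ (Eucl n)} [DiscreteTopology L] [IsZLattice ℝ L]

theorem RunB4.γ_spec (x : RunB4 L) {φ : Eucl n →ₗ[ℝ] ℝ} (h : IsRegular (roots L) φ)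
    (hP : (x.posRoots : Set (Eucl n)) = CharMass.posRoots (roots L) φ) (j : Fin x.numClasses) :
    x.γ j ∈ orthogonalGroup L ∧ x.γ j ∈ diagramGroup (roots L) φ ∧ x.γ j '' roots L = roots L ∧
      IsOfFinOrder (x.γ j) := by
  obtain ⟨h1, h2⟩ := (mem_orthogonalStabilizer_iff h hP rfl).1 (x.γ_mem j)
  have := finite_orthogonalGroup L
  refine ⟨h1, h2, image_eq_of_finite h.finite (map_mem_of_mem_diagramGroup h h2), ?_⟩
  exact (orthogonalGroup L).subtype.isOfFinOrder (x := ⟨x.γ j, h1⟩)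
    (isOfFinOrder_of_finite _)

omit [IsZLattice ℝ L] in
theorem exists_mem_Car_model {S : Set (Eucl n)}
    (hS : S ∈ irreducibleComponents (roots L)) {f : Eucl (rank S) →ₗᵢ[ℝ] Eucl n}
    {T : Set (Eucl (rank S))} (hT : f '' T = S) {u : Eucl (rank S) ≃ₗᵢ[ℝ] Eucl (rank S)}
    (hu : u ∈ orthogonalGroup (rootLattice T)) :
    ∃ P ∈ Car (rank S), P.map (Int.castRingHom ℝ) = isomCharpoly u := by
  have hspan := span_model_eq_top f hT (by simp)
  have hSL : S ⊆ L := fun α hα => (hS.1 hα).1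
  have := discreteTopology_rootLattice_model hSL hT
  have := isZLattice_rootLattice hspan
  have := finite_orthogonalGroup (rootLattice T)
  have hfin : IsOfFinOrder u :=
    (orthogonalGroup (rootLattice T)).subtype.isOfFinOrder (x := ⟨u, hu⟩)
      (isOfFinOrder_of_finite _)
  have := exists_mem_Car (rootLattice T) hu hfin
  rwa [finrank_euclideanSpace_fin] at this

omit [DiscreteTopology L] [IsZLattice ℝ L] in
/-- What step B6 finds for one element `γ` of `O(L)_ρ` and one component `S`: the power of `γ`
which stabilizes `S` induces a diagram automorphism of the model of `S`. -/
theorem exists_pull_orbit {φ : Eucl n →ₗ[ℝ] ℝ} (h : IsRegular (roots L) φ)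
    {S : Set (Eucl n)} (hS : S ∈ irreducibleComponents (roots L)) {γ : Eucl n ≃ₗᵢ[ℝ] Eucl n}
    (hγ : γ ∈ diagramGroup (roots L) φ) (hfin : IsOfFinOrder γ)
    {f : Eucl (rank S) →ₗᵢ[ℝ] Eucl n} {T : Set (Eucl (rank S))} (hT : f '' T = S) :
    ∃ u ∈ diagramGroup T (φ ∘ₗ f.toLinearMap), ∀ x, f (u x) = (γ ^ orbitSize γ S) (f x) := by
  have hspan := span_model_eq_top f hT (by simp)
  have hgS := (orbitSize_spec hfin S).2.1
  obtain ⟨u, hu⟩ := exists_pull hT hspan hgS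
  exact ⟨u, pull_mem_diagramGroup h hS hT (pow_mem hγ _) hgS hu, hu⟩

theorem RunB5.exists_runB6 (x : RunB5 L) (hL : IsIntegralLattice L) :
    ∃ y : RunB6 L, y.toRunB5 = x := by
  classical
  have hR := isRootSet_roots L hL
  obtain ⟨φ, h, hP⟩ := x.exists_isRegular hR
  have hγ := x.γ_spec h hP
  have hmem : ∀ {S}, S ∈ x.irr ↔ S ∈ irreducibleComponents (roots L) := by
    intro S; rw [← x.irr_eq]; rfl
  have hA : ∀ j, ∃ A : Matrix (Fin x.corank) (Fin x.corank) ℝ,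
      ∀ i, x.γ j (x.basis i : Eucl n) = ∑ k, A k i • (x.basis k : Eucl n) := by
    intro j
    have hK : ∀ y ∈ (Submodule.span ℝ (roots L))ᗮ, x.γ j y ∈ (Submodule.span ℝ (roots L))ᗮ := by
      intro y hy
      have h1 : Submodule.span ℝ (roots L) =
          Submodule.map ((x.γ j).toLinearEquiv : Eucl n →ₗ[ℝ] Eucl n)
            (Submodule.span ℝ (roots L)) := by
        rw [Submodule.map_span]
        congr 1
        exact (hγ j).2.2.1.symm
      rw [Submodule.mem_orthogonal] at hy ⊢
      intro z hz
      rw [h1] at hz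
      obtain ⟨z, hz, rfl⟩ := hz
      change inner ℝ (x.γ j z) (x.γ j y) = (0 : ℝ)
      rw [(x.γ j).inner_map_map]
      exact hy z hz
    refine ⟨fun k i => x.basis.repr ⟨x.γ j (x.basis i), hK _ (x.basis i).2⟩ k, fun i => ?_⟩
    have h2 := congrArg Subtype.val
      (x.basis.sum_repr ⟨x.γ j (x.basis i), hK _ (x.basis i).2⟩)
    refine h2.symm.trans ?_
    rw [AddSubmonoidClass.coe_finsetSum]
    rfl
  choose A hA using hA
  choose reps hsub hreps using fun j => exists_orbitReps x.irr_eq (hγ j).2.2.1 (hγ j).2.2.2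
  have hpull : ∀ j (S : reps j), ∃ (f : Eucl (rank S.1) →ₗᵢ[ℝ] Eucl n),
      f '' x.model S.1 = S.1 ∧ ∃ u ∈ diagramGroup (x.model S.1) (φ ∘ₗ f.toLinearMap),
        ∀ y, f (u y) = (x.γ j ^ orbitSize (x.γ j) S.1) (f y) := by
    intro j S
    obtain ⟨f, hf⟩ := x.model_iso S.1 (hsub j S.2)
    exact ⟨f, hf, exists_pull_orbit h ((hreps j).component _ S.2) (hγ j).2.1 (hγ j).2.2.2 hf⟩
  choose f hf u hu hfu using hpull
  have hspan : ∀ j (S : reps j), Submodule.span ℝ (x.model S.1) = ⊤ := fun j S =>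
    span_model_eq_top (f j S) (hf j S) (by simp)
  have hd : ∀ j (S : reps j), IsPermOrder (x.γ j ^ orbitSize (x.γ j) S.1) S.1 (orderOf (u j S)) ∧
      (orderOf (u j S) = 1 ∨ orderOf (u j S) = 2 ∨ orderOf (u j S) = 3) := by
    intro j S
    have hS := (hreps j).component _ S.2
    have h1 := (isRegular_model h hS (hf j S)).orderOf_mem
      ((isIrreducible_of_mem hS).comap (f j S) (hf j S)) (hspan j S) (hu j S)
    exact ⟨isPermOrder_of_pull (hf j S) (hspan j S) (orbitSize_spec (hγ j).2.2.2 S.1).2.1 (hfu j S)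
      (by omega), h1⟩
  -- integrality of the characteristic polynomial on `R^⊥`: it is a cofactor in that of `γ_j`
  have hPperp : ∀ j, ∃ D : ℤ[X], D.map (Int.castRingHom ℝ) = (A j).charpoly := by
    intro j
    have h1 := isomCharpoly_mul_weyl hR (hγ j).2.2.1 (hγ j).2.2.2 (hreps j) (f j)
      (fun S => x.model S.1) (hf j) x.basis (A j) (hA j) (one_mem _) (u j)
      (by simpa only [mul_one] using hfu j)
    rw [mul_one] at h1
    obtain ⟨P, _, hPmap⟩ := exists_mem_Car L (hγ j).1 (hγ j).2.2.2
    choose Q hQ hQmap using fun S : reps j => exists_mem_Car_model ((hreps j).component _ S.2)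
      (hf j S) (diagramGroup_le_orthogonalGroup
        (isRegular_model h ((hreps j).component _ S.2) (hf j S)) (hu j S))
    refine exists_map_eq_of_map_eq_mul (P := P)
      (Q := ∏ S : reps j, expand ℤ (orbitSize (x.γ j) S.1) (Q S)) ?_ ?_
    · exact monic_prod_of_monic _ _ fun S _ =>
        (Car.monic (hQ S)).expand (orbitSize_spec (hγ j).2.2.2 S.1).1
    · rw [hPmap, h1, Polynomial.map_prod]
      congr 1
      refine Finset.prod_congr rfl fun S _ => ?_
      rw [map_expand, hQmap]
  choose Pperp hPperp using hPperp
  refine ⟨{ toRunB5 := x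
            A := A
            A_eq := hA
            Pperp := Pperp
            Pperp_eq := hPperp
            irrReps := reps
            irrReps_subset := hsub
            irrReps_unique := fun j S hS => (hreps j).unique S (hmem.1 hS)
            l := fun j S => orbitSize (x.γ j) S
            l_eq := fun _ _ _ => rfl
            d := fun j S => if hS : S ∈ reps j then orderOf (u j ⟨S, hS⟩) else 1
            d_isOrder := fun j S hS => ?_
            d_mem := fun j S hS => ?_ }, rfl⟩
  · rw [dif_pos hS]; exact (hd j ⟨S, hS⟩).1
  · rw [dif_pos hS]; exact (hd j ⟨S, hS⟩).2

omit [DiscreteTopology L] [IsZLattice ℝ L] in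
theorem RunB6.isOrbitReps (x : RunB6 L) (j : Fin x.numClasses) :
    IsOrbitReps (roots L) (x.γ j) (x.irrReps j) := by
  have hmem : ∀ {S}, S ∈ x.irr ↔ S ∈ irreducibleComponents (roots L) := by
    intro S; rw [← x.irr_eq]; rfl
  exact ⟨fun S hS => hmem.1 (x.irrReps_subset j hS), fun S hS => x.irrReps_unique j S (hmem.2 hS)⟩

theorem RunB6.exists_runB7 (x : RunB6 L) (hL : IsIntegralLattice L) :
    ∃ y : RunB7 L, y.toRunB6 = x := by
  classical
  have hR := isRootSet_roots L hL
  obtain ⟨φ, h, hP⟩ := x.exists_isRegular hR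
  have hγ := x.γ_spec h hP
  have hex : ∀ j, ∀ S ∈ x.irrReps j, ∃ τ : orthogonalGroup (rootLattice (x.model S)),
      orderOf (QuotientGroup.mk τ : outerGroup (rootLattice (x.model S))) = x.d j S := by
    intro j S hSj
    have hS := (x.isOrbitReps j).component S hSj
    obtain ⟨f, hf⟩ := x.model_iso S (x.irrReps_subset j hSj)
    have hspan := span_model_eq_top f hf (by simp)
    obtain ⟨u, hu, hfu⟩ := exists_pull_orbit h hS (hγ j).2.1 (hγ j).2.2.2 hf
    refine ⟨_, (orderOf_mk_outerGroup (isRegular_model h hS hf)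
      (roots_rootLattice_model hS hf hspan) hu).trans ?_⟩
    have hd := x.d_isOrder j S hSj
    rw [x.l_eq j S hSj] at hd
    exact orderOf_pull hf hspan hfu hd
  refine ⟨{ toRunB6 := x
            τ := fun S d => if hτ : ∃ τ : orthogonalGroup (rootLattice (x.model S)),
              orderOf (QuotientGroup.mk τ : outerGroup (rootLattice (x.model S))) = d
              then hτ.choose else 1
            τ_order := fun j S hSj => ?_
            irrMass := fun S d => carMass (weylCoset ((if hτ : ∃ τ : orthogonalGroup
                (rootLattice (x.model S)),
                  orderOf (QuotientGroup.mk τ : outerGroup (rootLattice (x.model S))) = d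
              then hτ.choose else 1 : orthogonalGroup (rootLattice (x.model S))) :
                Eucl (rank S) ≃ₗᵢ[ℝ] Eucl (rank S)) (rootLattice (x.model S)))
            irrMass_eq := fun _ _ _ => rfl }, rfl⟩
  rw [dif_pos (hex j S hSj)]
  exact (hex j S hSj).choose_spec

end LaterRuns

/-! ### Counting lemmas -/

section Counting

/-- If all fibres of `c : A → Y` have the same size, then `c` preserves proportions. -/
theorem card_mul_card_of_fibres {A Y : Type*} [Finite A] [Finite Y] (c : A → Y)
    (hc : ∀ y y', Nat.card {a // c a = y} ≤ Nat.card {a // c a = y'}) (p : Y → Prop) :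
    Nat.card {a // p (c a)} * Nat.card Y = Nat.card A * Nat.card {y // p y} := by
  classical
  have := Fintype.ofFinite A
  have := Fintype.ofFinite Y
  rcases isEmpty_or_nonempty Y with hY | ⟨⟨y₀⟩⟩
  · have : IsEmpty A := ⟨fun a => hY.false (c a)⟩
    simp
  have hk : ∀ y, Nat.card {a // c a = y} = Nat.card {a // c a = y₀} :=
    fun y => le_antisymm (hc _ _) (hc _ _)
  have h1 : ∀ q : Y → Prop, Nat.card {a // q (c a)} =
      Nat.card {y // q y} * Nat.card {a // c a = y₀} := by
    intro q
    rw [Nat.card_eq_fintype_card, Fintype.card_subtype, Finset.card_eq_sum_card_fiberwise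
      (f := c) (t := Finset.univ.filter q) (by intro a ha; simpa using ha),
      Nat.card_eq_fintype_card (α := {y // q y}), Fintype.card_subtype,
      ← smul_eq_mul, ← Finset.sum_const]
    refine Finset.sum_congr rfl fun y hy => ?_
    rw [← hk y, Nat.card_eq_fintype_card, Fintype.card_subtype, Finset.filter_filter]
    congr 1
    ext a
    have hy' : q y := by simpa using hy
    simp only [Finset.mem_filter, Finset.mem_univ, true_and]
    exact ⟨fun h => h.2, fun h => ⟨by rwa [h], h⟩⟩
  have h2 := h1 fun _ => True
  rw [Nat.card_congr (Equiv.subtypeUnivEquiv fun _ => trivial),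
    Nat.card_congr (Equiv.subtypeUnivEquiv fun _ => trivial)] at h2
  rw [h1 p, h2]
  ring

/-- The distribution of a family of independent elements, each of which is uniformly distributed
in a finite set: the masses of the families are the products of the masses of their members. -/
theorem finsum_prod_card {ι : Type*} [Fintype ι] {Y K : ι → Type*} [∀ i, Finite (Y i)]
    (e : ∀ i, Y i → K i) (p : (∀ i, K i) → Prop) :
    ∑ᶠ f : {f : ∀ i, K i // p f},
      ∏ i, ((Nat.card {y // e i y = f.1 i} : ℚ) / Nat.card (Y i)) =
    (Nat.card {y : ∀ i, Y i // p fun i => e i (y i)} : ℚ) / Nat.card (∀ i, Y i) := by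
  classical
  have := fun i => Fintype.ofFinite (Y i)
  have h1 : ∀ f : ∀ i, K i, ∏ i, ((Nat.card {y // e i y = f i} : ℚ) / Nat.card (Y i)) =
      (Nat.card {y : ∀ i, Y i // ∀ i, e i (y i) = f i} : ℚ) / Nat.card (∀ i, Y i) := by
    intro f
    rw [Finset.prod_div_distrib, Nat.card_pi,
      Nat.card_congr (Equiv.subtypePiEquivPi (p := fun i y => e i y = f i)), Nat.card_pi]
    push_cast
    rfl
  simp only [h1]
  let E : {y : ∀ i, Y i // p fun i => e i (y i)} → {f : ∀ i, K i // p f} :=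
    fun y => ⟨fun i => e i (y.1 i), y.2⟩
  rw [finsum_eq_sum_of_support_subset (s := Finset.univ.image E), ← Finset.sum_div,
    ← Nat.cast_sum]
  · congr 2
    rw [Nat.card_eq_fintype_card (α := {y : ∀ i, Y i // p fun i => e i (y i)}),
      ← Finset.card_univ, Finset.card_eq_sum_card_fiberwise (f := E) (t := Finset.univ.image E)
      (fun y _ => by simp)]
    refine Finset.sum_congr rfl fun f _ => ?_
    rw [← Fintype.card_subtype, ← Nat.card_eq_fintype_card]
    refine Nat.card_congr
      { toFun := fun y => ⟨⟨y.1, ?_⟩, ?_⟩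
        invFun := fun y => ⟨y.1.1, fun i => congrFun (congrArg Subtype.val y.2) i⟩
        left_inv := fun y => rfl
        right_inv := fun y => rfl }
    · have : (fun i => e i (y.1 i)) = f.1 := funext y.2
      rw [this]
      exact f.2
    · exact Subtype.ext (funext y.2)
  · intro f hf
    rw [Function.mem_support] at hf
    have hne : Nat.card {y : ∀ i, Y i // ∀ i, e i (y i) = f.1 i} ≠ 0 := by
      intro h0
      rw [h0] at hf
      simp at hf
    obtain ⟨⟨y, hy⟩⟩ := (Nat.card_ne_zero.1 hne).1
    have hy' : (fun i => e i (y i)) = f.1 := funext hy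
    simp only [Finset.coe_image, Finset.coe_univ, Set.image_univ, Set.mem_range]
    exact ⟨⟨y, by rw [hy']; exact f.2⟩, Subtype.ext hy'⟩

/-- The sum of a class function on a finite group, from representatives of the conjugacy
classes. -/
theorem sum_eq_sum_conjClasses {K : Type*} [Group K] [Fintype K] {N : ℕ} {r : Fin N → K}
    (hr : Function.Bijective fun j => ConjClasses.mk (r j)) (F : K → ℚ)
    (hF : ∀ k g, F (k * g * k⁻¹) = F g) :
    ∑ k, F k = ∑ j, ((ConjClasses.mk (r j)).carrier.ncard : ℚ) * F (r j) := by
  classical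
  have := Fintype.ofFinite (ConjClasses K)
  rw [← Finset.sum_fiberwise Finset.univ ConjClasses.mk F, ← (Equiv.ofBijective _ hr).sum_comp]
  refine Finset.sum_congr rfl fun j _ => ?_
  rw [Equiv.ofBijective_apply, Set.ncard_eq_toFinset_card', ← nsmul_eq_mul, ← Finset.sum_const]
  have hfib : ∀ k, ConjClasses.mk k = ConjClasses.mk (r j) ↔
      k ∈ (ConjClasses.mk (r j)).carrier := fun k => ConjClasses.mem_carrier_iff_mk_eq.symm
  refine Finset.sum_congr ?_ fun k hk => ?_
  · ext k
    simp [hfib]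
  · rw [Set.mem_toFinset, ← hfib, ConjClasses.mk_eq_mk_iff_isConj, isConj_comm, isConj_iff] at hk
    obtain ⟨c, rfl⟩ := hk
    exact hF c _

variable {V : Type*} [NormedAddCommGroup V] [InnerProductSpace ℝ V] [FiniteDimensional ℝ V]

omit [FiniteDimensional ℝ V] in
theorem ncard_setOf_mul {K : Subgroup (V ≃ₗᵢ[ℝ] V)} (σ : V ≃ₗᵢ[ℝ] V) (p : (V ≃ₗᵢ[ℝ] V) → Prop) :
    {g | (∃ w ∈ K, g = σ * w) ∧ p g}.ncard = Nat.card {w : K // p (σ * w)} := by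
  rw [← Nat.card_coe_set_eq]
  exact Nat.card_congr
    { toFun := fun g => ⟨⟨σ⁻¹ * g.1, by
        obtain ⟨⟨w, hw, h⟩, _⟩ := g.2
        rwa [h, inv_mul_cancel_left]⟩, by
        change p (σ * (σ⁻¹ * g.1))
        rw [mul_inv_cancel_left]
        exact g.2.2⟩
      invFun := fun w => ⟨σ * w.1, ⟨w.1, w.1.2, rfl⟩, w.2⟩
      left_inv := fun g => Subtype.ext (mul_inv_cancel_left σ g.1)
      right_inv := fun w => Subtype.ext (Subtype.ext (inv_mul_cancel_left σ (w.1 : V ≃ₗᵢ[ℝ] V))) }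

theorem mass_weylCoset {L : Submodule ℤ V} {K : Subgroup (V ≃ₗᵢ[ℝ] V)} (hK : weylGroup L = K)
    (σ : V ≃ₗᵢ[ℝ] V) (P : ℝ[X]) :
    mass (weylCoset σ L) P =
      (Nat.card {w : K // isomCharpoly (σ * w.1) = P} : ℚ) / Nat.card K := by
  subst hK
  have h1 := ncard_setOf_mul (K := weylGroup L) σ fun g => isomCharpoly g = P
  have h2 := ncard_setOf_mul (K := weylGroup L) σ fun _ => True
  rw [Nat.card_congr (Equiv.subtypeUnivEquiv fun _ => trivial)] at h2
  simp only [and_true] at h2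
  rw [mass, weylCoset, h2, ← h1]
  rfl

end Counting

/-! ### Equidistribution in a coset of the Weyl group -/

section WeylCosetMass

variable {V : Type*} [NormedAddCommGroup V] [InnerProductSpace ℝ V] {R : Set V}
  {γ : V ≃ₗᵢ[ℝ] V} {reps : Finset (Set V)}

theorem reflGroup_conj_mem (h : IsRootSet R) (hγ : γ '' R = R) {w : V ≃ₗᵢ[ℝ] V}
    (hw : w ∈ reflGroup R) : γ⁻¹ * w * γ ∈ reflGroup R := by
  have hmap : ∀ α ∈ R, γ⁻¹ α ∈ R := by
    intro α hα
    rw [← hγ] at hα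
    obtain ⟨β, hβ, rfl⟩ := hα
    rwa [show γ⁻¹ (γ β) = β from γ.symm_apply_apply β]
  have key : reflGroup R ≤ (reflGroup R).comap (MulAut.conj γ⁻¹).toMonoidHom := by
    conv_lhs => rw [reflGroup]
    rw [Subgroup.closure_le]
    rintro _ ⟨α, hα, rfl⟩
    change γ⁻¹ * refl α * γ⁻¹⁻¹ ∈ reflGroup R
    rw [refl_conj γ⁻¹ (h.norm_two α hα)]
    exact Subgroup.subset_closure ⟨_, hmap α hα, rfl⟩
  have := key hw
  change γ⁻¹ * w * γ⁻¹⁻¹ ∈ reflGroup R at this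
  rwa [inv_inv] at this

theorem exists_mul_pow_eq (h : IsRootSet R) (hγ : γ '' R = R) {w : V ≃ₗᵢ[ℝ] V}
    (hw : w ∈ reflGroup R) (k : ℕ) : ∃ w' ∈ reflGroup R, (γ * w) ^ k = γ ^ k * w' := by
  induction k with
  | zero => exact ⟨1, one_mem _, by simp⟩
  | succ k ih =>
    obtain ⟨w', hw', heq⟩ := ih
    refine ⟨γ⁻¹ * w' * γ * w, mul_mem (reflGroup_conj_mem h hγ hw') hw, ?_⟩
    rw [pow_succ, heq, pow_succ]
    group

variable {f : ∀ S : reps, Eucl (rank S.1) →ₗᵢ[ℝ] V} {T : ∀ S : reps, Set (Eucl (rank S.1))}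

/-- Elements of the Weyl groups of some of the components, acting simultaneously. -/
theorem exists_extend_family (h : IsRootSet R) (hreps : ∀ S ∈ reps, S ∈ irreducibleComponents R)
    (hT : ∀ S, f S '' T S = S.1) (v : ∀ S : reps, reflGroup (T S)) :
    ∃ w ∈ reflGroup R, (∀ S x, w (f S x) = f S ((v S).1 x)) ∧
      ∀ S' ∈ irreducibleComponents R, S' ∉ reps → ∀ y ∈ Submodule.span ℝ S', w y = y := by
  classical
  suffices hs : ∀ s : Finset reps, ∃ w ∈ reflGroup R,
      (∀ S ∈ s, ∀ x, w (f S x) = f S ((v S).1 x)) ∧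
      ∀ S' ∈ irreducibleComponents R, (∀ S ∈ s, S' ≠ S.1) →
        ∀ y ∈ Submodule.span ℝ S', w y = y by
    obtain ⟨w, hw, h1, h2⟩ := hs Finset.univ
    refine ⟨w, hw, fun S => h1 S (Finset.mem_univ _), fun S' hS' hn => h2 S' hS' ?_⟩
    rintro S _ rfl
    exact hn S.2
  intro s
  induction s using Finset.induction_on with
  | empty => exact ⟨1, one_mem _, by simp, fun _ _ _ _ _ => rfl⟩
  | insert S₀ s hS₀ ih =>
    obtain ⟨w, hw, h1, h2⟩ := ih
    have hc := hreps S₀.1 S₀.2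
    obtain ⟨w₀, hw₀, h3, h4⟩ := exists_extend h hc.1 (hT S₀) (v S₀).2
    have hspan : ∀ S x, f S x ∈ Submodule.span ℝ S.1 := fun S =>
      mem_span_of_model (hT S) (span_model_eq_top (f S) (hT S) (by simp))
    have h5 : ∀ S' ∈ irreducibleComponents R, S' ≠ S₀.1 → ∀ y ∈ Submodule.span ℝ S',
        w₀ y = y := fun S' hS' hne y hy => h4 y fun α hα =>
      inner_eq_zero_of_ne hc hS' hne.symm (Submodule.subset_span hα) hy
    refine ⟨w₀ * w, mul_mem hw₀ hw, ?_, ?_⟩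
    · intro S hS x
      rw [LinearIsometryEquiv.coe_mul, Function.comp_apply]
      rcases Finset.mem_insert.1 hS with rfl | hS
      · rw [h2 S.1 hc ?_ _ (hspan S x), h3]
        intro S' hS' heq
        exact hS₀ (Subtype.ext heq ▸ hS')
      · rw [h1 S hS, h5 S.1 (hreps _ S.2) ?_ _ (hspan S _)]
        intro heq
        exact hS₀ (Subtype.ext heq ▸ hS)
    · intro S' hS' hne y hy
      rw [LinearIsometryEquiv.coe_mul, Function.comp_apply,
        h2 S' hS' (fun S hS => hne S (Finset.mem_insert_of_mem hS)) y hy,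
        h5 S' hS' (hne S₀ (Finset.mem_insert_self _ _)) y hy]

/-- Changing `w` by elements of the Weyl groups of the representatives of the orbits changes each
`(γ w) ^ l` on the representative by the same element: the other components of the orbit do not
see it. -/
theorem pow_mul_extend (h : IsRootSet R) (hγ : γ '' R = R) (hfin : IsOfFinOrder γ)
    (hreps : IsOrbitReps R γ reps) (hT : ∀ S, f S '' T S = S.1) {w w' : V ≃ₗᵢ[ℝ] V}
    (hw : w ∈ reflGroup R) {v : ∀ S : reps, reflGroup (T S)}
    (h1 : ∀ S x, w' (f S x) = f S ((v S).1 x))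
    (h2 : ∀ S' ∈ irreducibleComponents R, S' ∉ reps → ∀ y ∈ Submodule.span ℝ S', w' y = y)
    (S : reps) (x : Eucl (rank S.1)) :
    ((γ * (w * w')) ^ orbitSize γ S.1) (f S x) =
      ((γ * w) ^ orbitSize γ S.1) (f S ((v S).1 x)) := by
  have hspec := orbitSize_spec hfin S.1
  have key : ∀ i < orbitSize γ S.1, ((γ * (w * w')) ^ (i + 1)) (f S x) =
      ((γ * w) ^ (i + 1)) (f S ((v S).1 x)) := by
    intro i
    induction i with
    | zero =>
      intro _
      rw [zero_add, pow_one, pow_one, ← mul_assoc, LinearIsometryEquiv.coe_mul,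
        Function.comp_apply, h1]
    | succ i ih =>
      intro hi
      rw [pow_succ', LinearIsometryEquiv.coe_mul, Function.comp_apply, ih (by omega),
        pow_succ' _ (i + 1), LinearIsometryEquiv.coe_mul (γ * w), Function.comp_apply,
        ← mul_assoc, LinearIsometryEquiv.coe_mul (γ * w), Function.comp_apply]
      congr 1
      have hpow := pow_mul_image_component h hγ hw (hreps.component S.1 S.2) (i + 1)
      refine h2 _ hpow.2 (fun hmem => ?_) _ ?_
      · have h3 : S.1 = (γ ^ (i + 1)) '' S.1 :=
          hreps.eq_of_image_eq S.2 hmem (i := i + 1) (i' := 0) (by simp)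
        have := hspec.2.2.1 (i + 1) 0 hi hspec.1 (by rw [← h3]; simp)
        omega
      · rw [← hpow.1]
        have h4 : f S ((v S).1 x) ∈ Submodule.span ℝ S.1 :=
          mem_span_of_model (hT S) (span_model_eq_top (f S) (hT S) (by simp)) _
        have h5 := Submodule.mem_map_of_mem
          (f := (((γ * w) ^ (i + 1)).toLinearEquiv : V →ₗ[ℝ] V)) h4
        rw [Submodule.map_span] at h5
        exact h5
  have := key (orbitSize γ S.1 - 1) (by omega)
  rwa [Nat.sub_add_cancel hspec.1] at this

/-- The product formula, in terms of numbers of elements: when `w` is uniformly distributed in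
`W(R)`, the elements induced by the `(γ w) ^ l` on the representatives `S` of the orbits of `γ` are
independent and uniformly distributed in the cosets of the groups `W(S)` that contain those induced
by the `γ ^ l`. -/
theorem card_weyl_mul_card [FiniteDimensional ℝ V] [Finite (reflGroup R)] (h : IsRootSet R)
    (hγ : γ '' R = R) (hfin : IsOfFinOrder γ) (hreps : IsOrbitReps R γ reps)
    (hT : ∀ S, f S '' T S = S.1) {c : ℕ} (b : Module.Basis (Fin c) ℝ (Submodule.span ℝ R)ᗮ)
    (A : Matrix (Fin c) (Fin c) ℝ) (hA : ∀ i, γ (b i : V) = ∑ k, A k i • (b k : V))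
    {σ : ∀ S : reps, Eucl (rank S.1) ≃ₗᵢ[ℝ] Eucl (rank S.1)}
    (hσ : ∀ S x, f S (σ S x) = (γ ^ orbitSize γ S.1) (f S x)) (P : ℝ[X]) :
    Nat.card {w : reflGroup R // isomCharpoly (γ * w.1) = P} *
        Nat.card (∀ S, reflGroup (T S)) =
      Nat.card (reflGroup R) * Nat.card {y : ∀ S, reflGroup (T S) //
        (∏ S : reps, expand ℝ (orbitSize γ S.1) (isomCharpoly (σ S * (y S).1))) *
          A.charpoly = P} := by
  have hspan : ∀ S, Submodule.span ℝ (T S) = ⊤ := fun S =>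
    span_model_eq_top (f S) (hT S) (by simp)
  have hfinT : ∀ S, Finite (reflGroup (T S)) := fun S =>
    finite_reflGroup_of_model h (hreps.component S.1 S.2).1 (hT S)
  have hex : ∀ (w : reflGroup R) (S : reps), ∃ v : reflGroup (T S),
      ∀ x, f S ((σ S * v.1) x) = ((γ * w.1) ^ orbitSize γ S.1) (f S x) := by
    intro w S
    obtain ⟨w', hw', heq⟩ := exists_mul_pow_eq h hγ w.2 (orbitSize γ S.1)
    obtain ⟨v, hv, hvw⟩ := exists_restrict h (hreps.component S.1 S.2) (hT S) (hspan S) hw'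
    refine ⟨⟨v, hv⟩, fun x => ?_⟩
    rw [heq, LinearIsometryEquiv.coe_mul, LinearIsometryEquiv.coe_mul, Function.comp_apply,
      Function.comp_apply, hσ, hvw]
  choose C hC using hex
  have huniq : ∀ (w : reflGroup R) (y : ∀ S, reflGroup (T S)),
      (∀ S x, f S ((σ S * (y S).1) x) = ((γ * w.1) ^ orbitSize γ S.1) (f S x)) → C w = y := by
    intro w y hy
    funext S
    have : σ S * (C w S).1 = σ S * (y S).1 := by
      ext1 x
      exact (f S).injective ((hC w S x).trans (hy S x).symm)
    exact Subtype.ext (mul_left_cancel this)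
  rw [← card_mul_card_of_fibres C ?_]
  · congr 1
    refine Nat.card_congr (Equiv.subtypeEquivRight fun w => ?_)
    rw [isomCharpoly_mul_weyl h hγ hfin hreps f T hT b A hA w.2 _ (hC w)]
  · intro y y'
    obtain ⟨w', hw', h1, h2⟩ := exists_extend_family h hreps.component hT
      fun S => (y S)⁻¹ * y' S
    refine Nat.card_le_card_of_injective
      (fun w : {w // C w = y} => (⟨w.1 * ⟨w', hw'⟩, ?_⟩ : {w // C w = y'})) ?_
    · refine huniq _ _ fun S x => ?_
      have h3 := pow_mul_extend h hγ hfin hreps hT w.1.2 h1 h2 S x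
      refine Eq.trans ?_ h3.symm
      have h4 := hC w.1 S (((y S)⁻¹ * y' S).1 x)
      rw [w.2] at h4
      rw [← h4]
      congr 1
      change _ = (σ S * (y S).1) (((y S).1⁻¹ * (y' S).1) x)
      rw [← Function.comp_apply (f := ⇑(σ S * (y S).1)), ← LinearIsometryEquiv.coe_mul, mul_assoc,
        mul_inv_cancel_left]
    · intro w₁ w₂ heq
      have := congrArg (fun w => w.1) heq
      exact Subtype.ext (mul_right_cancel this)

end WeylCosetMass

/-! ### The masses of the orthogonal group -/

section Output

variable {n : ℕ} {L : Submodule ℤ (Eucl n)} [DiscreteTopology L] [IsZLattice ℝ L]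

theorem finite_weylGroup (hL : IsIntegralLattice L) : Finite (weylGroup L) :=
  have := finite_orthogonalGroup L
  Finite.of_injective _ (Subgroup.inclusion_injective (weylGroup_le_orthogonalGroup hL))

omit [DiscreteTopology L] [IsZLattice ℝ L] in
theorem isIntegralLattice_rootLattice_model (hL : IsIntegralLattice L) {S : Set (Eucl n)}
    (hSL : S ⊆ L) {k : ℕ} {f : Eucl k →ₗᵢ[ℝ] Eucl n} {T : Set (Eucl k)} (hT : f '' T = S) :
    IsIntegralLattice (rootLattice T) := by
  intro x hx y hy
  rw [← f.inner_map_map]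
  exact hL _ (rootLattice_model_le hSL hT x hx) _ (rootLattice_model_le hSL hT y hy)

theorem map_intCast_injective : Function.Injective (map (Int.castRingHom ℝ)) :=
  map_injective _ Int.cast_injective

omit [DiscreteTopology L] [IsZLattice ℝ L] in
/-- A divisor `Q` of a product of cyclotomic polynomials, complementary to the characteristic
polynomial of `γ_j` on the orthogonal of the roots, has the degree and the form required of the
argument of the masses of `γ_j W(R)`. -/
theorem RunB6.mem_Car_of_mul_eq (x : RunB6 L) (j : Fin x.numClasses) {P Q : ℤ[X]} (hP : P ∈ Car n)
    (hQ : Q.Monic) (h : Q * x.Pperp j = P) : Q ∈ Car (rank (roots L)) := by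
  have hmonic : (x.Pperp j).Monic := by
    refine monic_of_injective (f := Int.castRingHom ℝ) Int.cast_injective ?_
    rw [x.Pperp_eq]
    exact Matrix.charpoly_monic _
  have hdeg : (x.Pperp j).natDegree = x.corank := by
    rw [← natDegree_map_eq_of_injective (f := Int.castRingHom ℝ) Int.cast_injective, x.Pperp_eq,
      Matrix.charpoly_natDegree_eq_dim, Fintype.card_fin]
  have hcorank : rank (roots L) + x.corank = n := by
    have h1 := Submodule.finrank_add_finrank_orthogonal (Submodule.span ℝ (roots L))
    rw [Module.finrank_eq_card_basis x.basis, Fintype.card_fin, finrank_euclideanSpace_fin] at h1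
    exact h1
  obtain ⟨hPdeg, s, hs, hPs⟩ := hP
  refine ⟨?_, monic_dvd_prod_cyclotomic s hs Q hQ ⟨x.Pperp j, by rw [h, hPs]⟩⟩
  rw [← h, hQ.natDegree_mul hmonic, hdeg] at hPdeg
  omega

/-- The map `M_j` computed in step B9 is the mass function of the coset `γ_j W(L)`. -/
theorem RunB7.M_eq_mass (x : RunB7 L) (hL : IsIntegralLattice L) (j : Fin x.numClasses)
    (P : Car n) : x.M j P = mass (weylCoset (x.γ j) L) (P.1.map (Int.castRingHom ℝ)) := by
  classical
  have hR := isRootSet_roots L hL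
  obtain ⟨φ, h, hP⟩ := x.exists_isRegular hR
  obtain ⟨_, hγd, hγR, hfin⟩ := x.γ_spec h hP j
  have : Finite (reflGroup (roots L)) := finite_weylGroup hL
  have hreps := x.isOrbitReps j
  have hl : ∀ S : x.irrReps j, x.l j S.1 = orbitSize (x.γ j) S.1 := fun S => x.l_eq j S.1 S.2
  choose f hf using fun S : x.irrReps j => x.model_iso S.1 (x.irrReps_subset j S.2)
  have hspan : ∀ S : x.irrReps j, Submodule.span ℝ (x.model S.1) = ⊤ := fun S =>
    span_model_eq_top (f S) (hf S) (by simp)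
  have hSL : ∀ S : x.irrReps j, S.1 ⊆ (L : Set (Eucl n)) := fun S α hα =>
    ((hreps.component S.1 S.2).1 hα).1
  have hreg : ∀ S : x.irrReps j, IsRegular (x.model S.1) (φ ∘ₗ (f S).toLinearMap) := fun S =>
    isRegular_model h (hreps.component S.1 S.2) (hf S)
  have hfinT : ∀ S : x.irrReps j, Finite (reflGroup (x.model S.1)) := fun S =>
    finite_reflGroup_of_model hR (hreps.component S.1 S.2).1 (hf S)
  have hroots : ∀ S : x.irrReps j, roots (rootLattice (x.model S.1)) = x.model S.1 := fun S =>
    roots_rootLattice_model (hreps.component S.1 S.2) (hf S) (hspan S)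
  choose σ hσd hσ using fun S : x.irrReps j =>
    exists_pull_orbit h (hreps.component S.1 S.2) hγd hfin (hf S)
  -- the elements of the cosets `σ S W(S)` have integral characteristic polynomials `e S`
  have hcar : ∀ (S : x.irrReps j) (y : reflGroup (x.model S.1)), ∃ K : Car (rank S.1),
      K.1.map (Int.castRingHom ℝ) = isomCharpoly (σ S * y.1) := by
    intro S y
    have hy : y.1 ∈ weylGroup (rootLattice (x.model S.1)) := by
      rw [weylGroup_rootLattice (hroots S)]
      exact y.2
    obtain ⟨K, hK, hKm⟩ := exists_mem_Car_model (hreps.component S.1 S.2) (hf S)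
      (mul_mem (diagramGroup_le_orthogonalGroup (hreg S) (hσd S)) (weylGroup_le_orthogonalGroup
        (isIntegralLattice_rootLattice_model hL (hSL S) (hf S)) hy))
    exact ⟨⟨K, hK⟩, hKm⟩
  choose e he using hcar
  -- the masses found for the coset of `τ` are those of the coset of `σ S`, since the orders agree
  have hmass : ∀ (S : x.irrReps j) (K : Car (rank S.1)), x.irrMass S.1 (x.d j S.1) K =
      (Nat.card {y // e S y = K} : ℚ) / Nat.card (reflGroup (x.model S.1)) := by
    intro S K
    have hd := x.d_isOrder j S.1 S.2
    rw [hl S] at hd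
    rw [x.irrMass_eq j S.1 S.2, carMass, mass_weylCoset_eq (hreg S)
      ((isIrreducible_of_mem (hreps.component S.1 S.2)).comap (f S) (hf S)) (hspan S) (hroots S)
      (hσd S) _ ((x.τ_order j S.1 S.2).trans (orderOf_pull (hf S) (hspan S) (hσ S) hd).symm),
      mass_weylCoset (weylGroup_rootLattice (hroots S))]
    congr 2
    refine Nat.card_congr (Equiv.subtypeEquivRight fun y => ?_)
    rw [← he, map_intCast_injective.eq_iff, Subtype.ext_iff]
  have hroot : ∀ Q : Car (rank (roots L)), x.rootMass j Q =
      (Nat.card {y : ∀ S : x.irrReps j, reflGroup (x.model S.1) //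
        ∏ S : x.irrReps j, expand ℤ (x.l j S.1) (e S (y S)).1 = Q.1} : ℚ) /
      Nat.card (∀ S : x.irrReps j, reflGroup (x.model S.1)) := by
    intro Q
    rw [RunB7.rootMass]
    simp only [hmass]
    exact finsum_prod_card e
      fun g => ∏ S : x.irrReps j, expand ℤ (x.l j S.1) (g S).1 = Q.1
  have hcount := card_weyl_mul_card hR hγR hfin hreps hf x.basis (x.A j) (x.A_eq j) hσ
    (P.1.map (Int.castRingHom ℝ))
  have hiff : ∀ y : ∀ S : x.irrReps j, reflGroup (x.model S.1),
      ((∏ S : x.irrReps j, expand ℝ (orbitSize (x.γ j) S.1) (isomCharpoly (σ S * (y S).1))) *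
        (x.A j).charpoly = P.1.map (Int.castRingHom ℝ)) ↔
      (∏ S : x.irrReps j, expand ℤ (x.l j S.1) (e S (y S)).1) * x.Pperp j = P.1 := by
    intro y
    rw [← map_intCast_injective.eq_iff, Polynomial.map_mul, Polynomial.map_prod, x.Pperp_eq]
    simp only [map_expand, he, hl]
  rw [Nat.card_congr (Equiv.subtypeEquivRight hiff)] at hcount
  have hWpos : (Nat.card (reflGroup (roots L)) : ℚ) ≠ 0 := Nat.cast_ne_zero.2 Nat.card_pos.ne'
  have hYpos : (Nat.card (∀ S : x.irrReps j, reflGroup (x.model S.1)) : ℚ) ≠ 0 :=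
    Nat.cast_ne_zero.2 Nat.card_pos.ne'
  have hlpos : ∀ S : x.irrReps j, 0 < x.l j S.1 := fun S => by
    rw [hl]; exact (orbitSize_spec hfin S.1).1
  rw [mass_weylCoset (K := reflGroup (roots L)) rfl]
  -- both sides are the proportion of the families whose polynomials yield `P`
  trans (Nat.card {y : ∀ S : x.irrReps j, reflGroup (x.model S.1) //
      (∏ S : x.irrReps j, expand ℤ (x.l j S.1) (e S (y S)).1) * x.Pperp j = P.1} : ℚ) /
    Nat.card (∀ S : x.irrReps j, reflGroup (x.model S.1))
  · rw [RunB7.M]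
    split_ifs with hQ
    · rw [hroot]
      congr 2
      refine Nat.card_congr (Equiv.subtypeEquivRight fun y => ?_)
      have hspec := hQ.choose_spec
      have hne : x.Pperp j ≠ 0 := right_ne_zero_of_mul fun h0 =>
        (Car.monic P.2).ne_zero (hspec.trans h0)
      exact (mul_left_inj' hne).symm.trans (Iff.of_eq (congrArg _ hspec.symm))
    · -- if `P` is not of the form `Q P_j`, it does not occur in the coset
      have : IsEmpty {y : ∀ S : x.irrReps j, reflGroup (x.model S.1) //
          (∏ S : x.irrReps j, expand ℤ (x.l j S.1) (e S (y S)).1) * x.Pperp j = P.1} := by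
        refine ⟨fun y => hQ ⟨⟨_, x.mem_Car_of_mul_eq j P.2 ?_ y.2⟩, y.2.symm⟩⟩
        exact monic_prod_of_monic _ _ fun S _ => (Car.monic (e S (y.1 S)).2).expand (hlpos S)
      rw [Nat.card_of_isEmpty, Nat.cast_zero, zero_div]
  · rw [div_eq_div_iff hYpos hWpos, mul_comm]
    exact_mod_cast hcount.symm

/-- `O(L)` is the semidirect product of `O(L)_ρ` and `W(L)`, so that a number of elements of
`O(L)` is the sum of its contributions from the cosets `h W(L)`, for `h` in `O(L)_ρ`. -/
theorem ncard_orthogonalGroup (hL : IsIntegralLattice L) (x : RunB1 L)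
    [Fintype (orthogonalStabilizer L x.ρ)] (p : (Eucl n ≃ₗᵢ[ℝ] Eucl n) → Prop) :
    {g | g ∈ orthogonalGroup L ∧ p g}.ncard =
      ∑ k : orthogonalStabilizer L x.ρ, Nat.card {w : weylGroup L // p (k.1 * w)} := by
  have hR := isRootSet_roots L hL
  obtain ⟨φ, h, hP⟩ := x.exists_isRegular hR
  have := finite_weylGroup hL
  have hWfin : Finite (reflGroup (roots L)) := this
  have hWO := weylGroup_le_orthogonalGroup hL
  have hH : ∀ {g}, g ∈ orthogonalStabilizer L x.ρ ↔
      g ∈ orthogonalGroup L ∧ g ∈ diagramGroup (roots L) φ :=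
    mem_orthogonalStabilizer_iff h hP rfl
  rw [← Nat.card_sigma, ← Nat.card_coe_set_eq]
  symm
  refine Nat.card_congr (Equiv.ofBijective
    (fun y => ⟨y.1.1 * y.2.1.1, mul_mem (hH.1 y.1.2).1 (hWO y.2.1.2), y.2.2⟩) ⟨?_, ?_⟩)
  · rintro ⟨⟨k, hk⟩, ⟨⟨w, hw⟩, hp⟩⟩ ⟨⟨k', hk'⟩, ⟨⟨w', hw'⟩, hp'⟩⟩ heq
    have heq : k * w = k' * w' := congrArg Subtype.val heq
    have h1 : k'⁻¹ * k = w' * w⁻¹ := by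
      rw [inv_mul_eq_iff_eq_mul, ← mul_assoc, ← heq, mul_inv_cancel_right]
    have h2 : w' * w⁻¹ = 1 := by
      refine h.eq_one_of_pos (mul_mem hw' (inv_mem hw)) ?_
      rw [← h1]
      exact (mem_diagramGroup h).1 (mul_mem (inv_mem (hH.1 hk').2) (hH.1 hk).2)
    rw [h2] at h1
    have h3 : w' = w := mul_inv_eq_one.1 h2
    have h4 : k' = k := inv_mul_eq_one.1 h1
    subst h3 h4
    rfl
  · rintro ⟨g, hg, hp⟩
    obtain ⟨w, hw, hpos⟩ := h.exists_mul_pos (map_roots hg)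
    exact ⟨⟨⟨g * w, hH.2 ⟨mul_mem hg (hWO hw), (mem_diagramGroup h).2 hpos⟩⟩,
      ⟨⟨w⁻¹, inv_mem hw⟩, by simpa using hp⟩⟩, Subtype.ext (mul_inv_cancel_right g w)⟩

omit [DiscreteTopology L] [IsZLattice ℝ L] in
theorem card_weylCoset_conj {k g : Eucl n ≃ₗᵢ[ℝ] Eucl n} (hk : k ∈ orthogonalGroup L)
    (P : ℝ[X]) :
    Nat.card {w : weylGroup L // isomCharpoly (k * g * k⁻¹ * w.1) = P} =
      Nat.card {w : weylGroup L // isomCharpoly (g * w.1) = P} := by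
  have hconj : ∀ w : Eucl n ≃ₗᵢ[ℝ] Eucl n, k * g * k⁻¹ * (k * w * k⁻¹) = k * (g * w) * k⁻¹ := by
    intro w; group
  refine (Nat.card_congr (Equiv.ofBijective
    (fun w => ⟨⟨k * w.1.1 * k⁻¹, weylGroup_conj_mem hk w.1.2⟩, by
      change isomCharpoly (k * g * k⁻¹ * (k * w.1.1 * k⁻¹)) = P
      rw [hconj, isomCharpoly_conj, w.2]⟩) ⟨?_, ?_⟩)).symm
  · rintro ⟨⟨w, hw⟩, hp⟩ ⟨⟨w', hw'⟩, hp'⟩ heq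
    have heq : k * w * k⁻¹ = k * w' * k⁻¹ := congrArg (fun z => z.1.1) heq
    have : w = w' := mul_left_cancel (mul_right_cancel heq)
    subst this
    rfl
  · rintro ⟨⟨w, hw⟩, hp⟩
    have h1 : k * (k⁻¹ * w * k) * k⁻¹ = w := by group
    have hw' : k⁻¹ * w * k ∈ weylGroup L := by
      rw [← weylGroup_conj_mem_iff hk, h1]
      exact hw
    refine ⟨⟨⟨k⁻¹ * w * k, hw'⟩, ?_⟩, Subtype.ext (Subtype.ext h1)⟩
    change isomCharpoly (g * (k⁻¹ * w * k)) = P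
    rw [← isomCharpoly_conj k, ← hconj, h1]
    exact hp

theorem RunB7.output_eq (x : RunB7 L) (hL : IsIntegralLattice L) :
    x.output = characteristicMasses L := by
  classical
  have := finite_orthogonalStabilizer (L := L) x.ρ
  have := Fintype.ofFinite (orthogonalStabilizer L x.ρ)
  have := finite_weylGroup hL
  have hWpos : (Nat.card (weylGroup L) : ℚ) ≠ 0 := Nat.cast_ne_zero.2 Nat.card_pos.ne'
  let ε := x.permGroupEquiv
  have : Fintype x.permGroup := Fintype.ofEquiv _ ε.toEquiv
  -- `γ_j` is determined by the permutation `r_j` of the canonical vectors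
  have hr : ∀ j, ε.symm (x.r j) = ⟨x.γ j, x.γ_mem j⟩ := by
    intro j
    rw [MulEquiv.symm_apply_eq]
    refine Subtype.ext (Equiv.ext fun v => Subtype.ext ?_)
    rw [x.permGroupEquiv_apply, x.γ_eq]
  have hsum : ∀ F : (Eucl n ≃ₗᵢ[ℝ] Eucl n) → ℚ,
      (∀ k ∈ orthogonalStabilizer L x.ρ, ∀ g, F (k * g * k⁻¹) = F g) →
      ∑ k : orthogonalStabilizer L x.ρ, F k.1 = ∑ j, (x.m j : ℚ) * F (x.γ j) := by
    intro F hF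
    rw [← ε.symm.toEquiv.sum_comp]
    refine (sum_eq_sum_conjClasses x.r_bijective (fun k => F (ε.symm k).1) ?_).trans ?_
    · intro k g
      rw [map_mul, map_mul, map_inv]
      exact hF _ (ε.symm k).2 _
    · refine Finset.sum_congr rfl fun j _ => ?_
      rw [hr, x.m_eq]
  funext P
  rw [RunB7.output, characteristicMasses, carMass, mass]
  have h1 := ncard_orthogonalGroup hL x.toRunB1 fun _ => True
  have h2 := ncard_orthogonalGroup hL x.toRunB1
    fun g => isomCharpoly g = P.1.map (Int.castRingHom ℝ)
  have h3 := hsum (fun _ => 1) fun _ _ _ => rfl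
  have h4 := hsum (fun g => (Nat.card {w : weylGroup L //
    isomCharpoly (g * w.1) = P.1.map (Int.castRingHom ℝ)} : ℚ)) fun k hk g => by
      rw [card_weylCoset_conj (orthogonalStabilizer_le _ hk)]
  have hnum : ({g : Eucl n ≃ₗᵢ[ℝ] Eucl n | g ∈ (orthogonalGroup L : Set (Eucl n ≃ₗᵢ[ℝ] Eucl n)) ∧
      LinearMap.charpoly (g.toLinearEquiv : Eucl n →ₗ[ℝ] Eucl n) =
        P.1.map (Int.castRingHom ℝ)}.ncard : ℚ) =
      (∑ j, (x.m j : ℚ) * x.M j P) * Nat.card (weylGroup L) := by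
    refine Eq.trans (congrArg Nat.cast h2) ?_
    rw [Nat.cast_sum, h4, Finset.sum_mul]
    refine Finset.sum_congr rfl fun j _ => ?_
    rw [x.M_eq_mass hL, mass_weylCoset (K := weylGroup L) rfl, mul_assoc, div_mul_cancel₀ _ hWpos]
  have hden : ((orthogonalGroup L : Set (Eucl n ≃ₗᵢ[ℝ] Eucl n)).ncard : ℚ) =
      (∑ j, (x.m j : ℚ)) * Nat.card (weylGroup L) := by
    simp only [and_true] at h1
    refine Eq.trans (congrArg Nat.cast h1) ?_
    simp only [mul_one] at h3
    rw [← h3, Nat.cast_sum, Finset.sum_mul]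
    refine Finset.sum_congr rfl fun k _ => ?_
    rw [one_mul, Nat.card_congr (Equiv.subtypeUnivEquiv fun _ => trivial)]
  rw [hnum, hden, mul_div_mul_right _ _ hWpos]

end Output

end CharMass

end

/-- For every integral lattice `L` in `ℝⁿ`, Algorithm B can always be carried out to its end,
whatever choices are made on the way (each step can be completed after any execution of the
previous ones), and every execution of it returns the characteristic masses of `L`. -/
theorem mainTheorem4 (n : ℕ) (L : Submodule ℤ (CharMass.Eucl n)) [DiscreteTopology L]
    [IsZLattice ℝ L] (hL : CharMass.IsIntegralLattice L) :
    (Nonempty (CharMass.RunB1 L) ∧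
      (∀ x : CharMass.RunB1 L, ∃ y : CharMass.RunB2 L, y.toRunB1 = x) ∧
      (∀ x : CharMass.RunB2 L, ∃ y : CharMass.RunB4 L, y.toRunB2 = x) ∧
      (∀ x : CharMass.RunB4 L, ∃ y : CharMass.RunB5 L, y.toRunB4 = x) ∧
      (∀ x : CharMass.RunB5 L, ∃ y : CharMass.RunB6 L, y.toRunB5 = x) ∧
      (∀ x : CharMass.RunB6 L, ∃ y : CharMass.RunB7 L, y.toRunB6 = x)) ∧
    ∀ x : CharMass.RunB7 L, x.output = CharMass.characteristicMasses L := by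
  exact ⟨⟨CharMass.nonempty_runB1 hL, fun x => x.exists_runB2, fun x => x.exists_runB4,
    fun x => x.exists_runB5 hL, fun x => x.exists_runB6 hL, fun x => x.exists_runB7 hL⟩,
    fun x => x.output_eq hL⟩
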